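/- Let $\widehat{\mathfrak g}=\mathfrak{sl}(2,\mathbb C)\otimes\mathbb C[t,t^{-1}]\oplus\mathbb C\mathbf k$ be the affine Lie algebra, with $\mathbf k$ central and $[x\otimes t^m,y\otimes t^n]=[x,y]\otimes t^{m+n}+m\,\mathrm{tr}(xy)\,\delta_{m+n,0}\,\mathbf k$; write $x(n)$ for the action of $x\otimes t^n$. Fix a level $\ell\in\mathbb N=\{0,1,2,\dots\}$. For $n\in\mathbb N$ let $M(n)$ be the irreducible $\mathfrak{sl}(2,\mathbb C)$-module of highest weight $n$ (of dimension $n+1$), on which $x(0)$ acts as $x$, $x(k)$ acts as $0$ for $k>0$, and $\mathbf k$ acts as $\ell$; let $V^{M(n)}$ be the generalized Verma module, that is, the $\widehat{\mathfrak g}$-module induced from the module $M(n)$ of $\mathfrak{sl}(2,\mathbb C)\otimes\mathbb C[t]\oplus\mathbb C\mathbf k$; let $J(n)\subset V^{M(n)}$ be its maximal proper submodule and $L(n)=V^{M(n)}/J(n)$. For $d\in\mathbb Z$ let $V^{M(n)}(d)$ be the span of the vectors $x_1(-n_1)\cdots x_k(-n_k)u$ with $k\ge 0$, $x_i\in\mathfrak{sl}(2,\mathbb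 C)$, $n_i>0$, $u\in M(n)$ and $n_1+\dots+n_k=d$; thus $V^{M(n)}(0)=M(n)$, and $V^{M(n)}(d)=0$ for $d<0$. **Theorem 6.3.** Let $p,q,r\in\mathbb N$. Suppose that $J(r)$ is irreducible and isomorphic as a $\widehat{\mathfrak g}$-module to $L(r')$ for some $r'\in\mathbb N$, that $J(r')$ is irreducible and isomorphic to $L(r'')$ for some $r''\in\mathbb N$, and that there are no nonzero $\mathfrak{sl}(2,\mathbb C)$-homomorphisms from $M(p)\otimes M(q)$ to $M(r')$ or to $M(r'')$. Then for every $f\in\mathrm{Hom}_{\mathfrak{sl}(2,\mathbb C)}(M(p)\otimes M(q),M(r))$ there is a unique family of linear maps $$\mathcal Y_m\colon M(p)\otimes M(q)\to V^{M(r)}(-m),\qquad u\otimes v\mapsto\mathcal Y_m(u)v,\qquad m\in\mathbb Z,$$ such that $\mathcal Y_0=f$ and $$x(n)\,\mathcal Y_m(u)v-\mathcal Y_m(u)\,x(n)v=\mathcal Y_{m+n}(x(0)u)v$$ for all $x\in\mathfrak{sl}(2,\mathbb C)$, $u\in M(p)$, $v\in M(q)$, $m\in\mathbb Z$ and $n\ge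 0$. -/

import Mathlib

open scoped TensorProduct

noncomputable section

namespace AffineSl2

/-! ### The Lie algebra `sl(2, ℂ)` and its invariant form -/

/-- The Lie algebra `sl(2, ℂ)` of traceless complex `2 × 2` matrices. -/
abbrev Sl2 : Type := LieAlgebra.SpecialLinear.sl (Fin 2) ℂ

/-- The invariant form `⟨x, y⟩ = tr (x y)` on `sl(2, ℂ)`. In the standard basis it is
`⟨e, f⟩ = ⟨h, h⟩ / 2 = 1`, all other pairings of basis vectors being zero. -/
def form : LinearMap.BilinForm ℂ Sl2 :=
  LinearMap.mk₂ ℂ (fun x y => Matrix.trace (x.1 * y.1))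
    (fun x y z => by simp [add_mul]) (fun c x y => by simp)
    (fun x y z => by simp [mul_add]) (fun c x y => by simp)

theorem sl2_apply_one_one (x : Sl2) : x.1 1 1 = -x.1 0 0 := by
  have h : Matrix.trace x.1 = 0 := x.2
  rw [Matrix.trace_fin_two] at h
  linear_combination h

theorem form_apply (x y : Sl2) : form x y = Matrix.trace (x.1 * y.1) := rfl

theorem form_isSymm : form.IsSymm := ⟨fun x y => by
  simp [form_apply, Matrix.trace_mul_comm x.1 y.1]⟩

theorem form_lieInvariant : form.lieInvariant Sl2 := by
  intro x y z
  simp only [form_apply, LieAlgebra.SpecialLinear.sl_bracket, sub_mul, mul_sub, Matrix.trace_sub]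
  rw [← mul_assoc, ← mul_assoc, Matrix.trace_mul_cycle x.1 y.1 z.1,
    Matrix.trace_mul_cycle z.1 x.1 y.1]
  ring

/-! ### The finite-dimensional irreducible modules `M(n)` -/

/-- The irreducible `sl(2, ℂ)`-module `M(n)` with highest weight `n`, of dimension `n + 1`. An
element is the family of its coordinates in a basis `v₀, …, vₙ` for which
`h vᵢ = (n - 2 i) vᵢ`, `e vᵢ = i vᵢ₋₁`, `f vᵢ = (n - i) vᵢ₊₁`. -/
def Irr (n : ℕ) : Type := Fin (n + 1) → ℂ

instance (n : ℕ) : AddCommGroup (Irr n) := inferInstanceAs (AddCommGroup (Fin (n + 1) → ℂ))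
instance (n : ℕ) : Module ℂ (Irr n) := inferInstanceAs (Module ℂ (Fin (n + 1) → ℂ))

namespace Irr

variable {n : ℕ}

/-- The `i`-th coordinate, extended by zero to all integers `i`. -/
def coord (v : Irr n) (i : ℤ) : ℂ :=
  if h : 0 ≤ i ∧ i ≤ n then v ⟨i.toNat, by omega⟩ else 0

/-- The vector `a h v + b e v + c f v`. -/
def act (a b c : ℂ) (v : Irr n) : Irr n := fun i =>
  a * ((n : ℂ) - 2 * (i : ℕ)) * v.coord (i : ℕ)
    + b * ((i : ℕ) + 1) * v.coord ((i : ℕ) + 1)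
    + c * ((n : ℂ) - (i : ℕ) + 1) * v.coord ((i : ℕ) - 1)

theorem ext_coord {v w : Irr n} (h : ∀ i : ℤ, v.coord i = w.coord i) : v = w := by
  funext i
  have hi := i.2
  have := h (i : ℕ)
  simpa [coord, show (i : ℕ) ≤ n by omega] using this

theorem coord_of_lt {v : Irr n} {i : ℤ} (h : i < 0) : v.coord i = 0 := by
  simp [coord, show ¬ 0 ≤ i by omega]

theorem coord_of_gt {v : Irr n} {i : ℤ} (h : (n : ℤ) < i) : v.coord i = 0 := by
  simp [coord, show ¬ i ≤ n by omega]

theorem coord_add (v w : Irr n) (i : ℤ) : (v + w).coord i = v.coord i + w.coord i := by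
  unfold coord
  split_ifs
  · rfl
  · simp

theorem coord_smul (t : ℂ) (v : Irr n) (i : ℤ) : (t • v).coord i = t * v.coord i := by
  unfold coord
  split_ifs
  · rfl
  · simp

theorem coord_act (a b c : ℂ) (v : Irr n) (i : ℤ) :
    (act a b c v).coord i = a * ((n : ℂ) - 2 * i) * v.coord i
      + b * (i + 1) * v.coord (i + 1) + c * ((n : ℂ) - i + 1) * v.coord (i - 1) := by
  by_cases h : 0 ≤ i ∧ i ≤ n
  · obtain ⟨k, rfl⟩ := Int.eq_ofNat_of_zero_le h.1
    rw [coord, dif_pos h]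
    simp [act]
  · rw [coord, dif_neg h]
    rcases lt_or_ge i 0 with h0 | h0
    · rw [coord_of_lt h0, coord_of_lt (show i - 1 < 0 by omega)]
      rcases eq_or_ne i (-1) with rfl | h1
      · simp
      · rw [coord_of_lt (show i + 1 < 0 by omega)]; simp
    · have h1 : (n : ℤ) < i := by
        by_contra h2
        exact h ⟨h0, by omega⟩
      rw [coord_of_gt h1, coord_of_gt (show (n : ℤ) < i + 1 by omega)]
      rcases eq_or_ne i (n + 1) with rfl | h1
      · simp
      · rw [coord_of_gt (show (n : ℤ) < i - 1 by omega)]; simp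

/-- A traceless matrix `!![a, b; c, -a]` is `a h + b e + c f`. -/
instance : LieRingModule Sl2 (Irr n) where
  bracket x v := act (x.1 0 0) (x.1 0 1) (x.1 1 0) v
  add_lie x y v := ext_coord fun i => by
    have h : (x + y).1 = x.1 + y.1 := rfl
    simp only [coord_add, coord_act, h, Matrix.add_apply]
    ring
  lie_add x v w := ext_coord fun i => by
    simp only [coord_add, coord_act]
    ring
  leibniz_lie x y v := ext_coord fun i => by
    have hx := sl2_apply_one_one x
    have hy := sl2_apply_one_one y
    simp only [coord_add, coord_act, LieAlgebra.SpecialLinear.sl_bracket, Matrix.sub_apply,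
      Matrix.mul_apply, Fin.sum_univ_two, hx, hy, add_sub_cancel_right, sub_add_cancel]
    push_cast
    ring

theorem lie_eq_act (x : Sl2) (v : Irr n) : ⁅x, v⁆ = act (x.1 0 0) (x.1 0 1) (x.1 1 0) v := rfl

instance : LieModule ℂ Sl2 (Irr n) where
  smul_lie t x v := ext_coord fun i => by
    have h : (t • x).1 = t • x.1 := rfl
    simp only [lie_eq_act, coord_smul, coord_act, h, Matrix.smul_apply, smul_eq_mul]
    ring
  lie_smul t x v := ext_coord fun i => by
    simp only [lie_eq_act, coord_smul, coord_act]
    ring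

end Irr

/-! ### The affine Lie algebra -/

/-- The cocycle `(x ⊗ tᵐ, y ⊗ tⁿ) ↦ m ⟨x, y⟩ δ_{m + n, 0}` on the loop algebra
`sl(2, ℂ) ⊗ ℂ[t, t⁻¹]`. Mathlib's residue cocycle attached to a form `Φ` is
`n Φ(x, y) δ_{m + n, 0}`, so it is taken for `Φ = -⟨·, ·⟩`. -/
def cocycle : LieModule.Cohomology.twoCocycle ℂ (LieAlgebra.loopAlgebra ℂ ℤ Sl2)
    (TrivialLieModule ℂ (LieAlgebra.loopAlgebra ℂ ℤ Sl2) ℂ) :=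
  LieAlgebra.LoopAlgebra.twoCocycleOfBilinear ℂ ℤ Sl2 (-form)
    (fun x y z => by
      have := form_lieInvariant x y z
      simp only [LinearMap.neg_apply, this])
    ⟨fun x y => by
      have := form_isSymm.eq x y
      simpa using this⟩

/-- The affine Lie algebra `sl(2, ℂ) ⊗ ℂ[t, t⁻¹] ⊕ ℂ 𝐤`. -/
abbrev Affine : Type := LieAlgebra.ofTwoCocycle cocycle

/-- The element `x ⊗ tⁿ`, written `x(n)` when it acts on a module. -/
def loop (n : ℤ) (x : Sl2) : Affine :=
  LieAlgebra.ofProd cocycle (AddMonoidAlgebra.single n 1 ⊗ₜ[ℂ] x, 0)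

/-- The central element `𝐤`. -/
def central : Affine :=
  LieAlgebra.ofProd cocycle (0, (TrivialLieModule.equiv ℂ _ ℂ).symm 1)

theorem cocycle_single (m n : ℤ) (x y : Sl2) :
    (cocycle : LieAlgebra.loopAlgebra ℂ ℤ Sl2 →ₗ[ℂ] LieAlgebra.loopAlgebra ℂ ℤ Sl2 →ₗ[ℂ]
      TrivialLieModule ℂ (LieAlgebra.loopAlgebra ℂ ℤ Sl2) ℂ)
        (AddMonoidAlgebra.single m 1 ⊗ₜ[ℂ] x) (AddMonoidAlgebra.single n 1 ⊗ₜ[ℂ] y) =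
      (if m + n = 0 then (m : ℂ) * form x y else 0) • (TrivialLieModule.equiv ℂ _ ℂ).symm 1 := by
  apply (TrivialLieModule.equiv ℂ _ ℂ).injective
  change LieAlgebra.LoopAlgebra.residuePairing ℂ ℤ Sl2 (-form) _ _ = _
  rw [LieAlgebra.LoopAlgebra.residuePairing_apply_apply]
  rw [LieAlgebra.LoopAlgebra.toFinsupp_single_tmul, LieAlgebra.LoopAlgebra.toFinsupp_single_tmul,
    Finsupp.sum_single_index (by simp)]
  by_cases h : m + n = 0
  · obtain rfl : n = -m := by omega
    simp
  · have h' : m ≠ -n := by omega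
    simp [h, h']

theorem lie_loop_loop (m n : ℤ) (x y : Sl2) :
    ⁅loop m x, loop n y⁆ =
      loop (m + n) ⁅x, y⁆ + (if m + n = 0 then (m : ℂ) * form x y else 0) • central := by
  rw [LieAlgebra.bracket_ofTwoCocycle, loop, loop, loop, central, ← LieAlgebra.of_smul,
    ← LieAlgebra.of_add]
  refine congrArg _ (Prod.ext ?_ ?_)
  · simp only [Equiv.symm_apply_apply, LieAlgebra.ExtendScalars.bracket_tmul, Prod.smul_mk,
      Prod.mk_add_mk, smul_zero, add_zero, AddMonoidAlgebra.single_mul_single, mul_one]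
  · simp only [Equiv.symm_apply_apply, lie_zero, add_zero, sub_zero, cocycle_single, Prod.smul_mk,
      Prod.mk_add_mk, zero_add]

theorem lie_central (a : Affine) : ⁅central, a⁆ = 0 := by
  rw [LieAlgebra.bracket_ofTwoCocycle, central, ← LieAlgebra.of_zero]
  refine congrArg _ (Prod.ext ?_ ?_)
  · simp
  · simp [trivial_lie_zero]

/-! ### Generalized Verma modules -/

/-- The universal enveloping algebra of the affine Lie algebra. -/
abbrev UAff : Type := UniversalEnvelopingAlgebra ℂ Affine

/-- The action of `x ⊗ tⁿ`, `n ≥ 0`, on an `sl(2, ℂ)`-module on which the `x ⊗ tⁿ` with `n > 0`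
act by zero. -/
def posAct {M : Type*} [AddCommGroup M] [Bracket Sl2 M] (n : ℕ) (x : Sl2) (u : M) : M :=
  if n = 0 then ⁅x, u⁆ else 0

section Verma

variable (ℓ : ℂ) (r : ℕ)

/-- The relations `y a ⊗ u = y ⊗ a u` for `a` in the span of `𝐤` and the `x ⊗ tⁿ` with `n ≥ 0`,
which make `U ⊗ M(r)` into the tensor product over the enveloping algebra of that span. Here
`𝐤` acts on `M(r)` by `ℓ`. -/
def vermaRel : Submodule UAff (UAff ⊗[ℂ] Irr r) :=
  Submodule.span UAff
    ({w | ∃ (n : ℕ) (x : Sl2) (u : Irr r),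
        w = UniversalEnvelopingAlgebra.ι ℂ (loop n x) ⊗ₜ[ℂ] u - 1 ⊗ₜ[ℂ] posAct n x u} ∪
      {w | ∃ u : Irr r,
        w = UniversalEnvelopingAlgebra.ι ℂ central ⊗ₜ[ℂ] u - 1 ⊗ₜ[ℂ] (ℓ • u)})

/-- The generalized Verma module `V^{M(r)}` of level `ℓ`, induced from `M(r)`. -/
def Verma : Type := (UAff ⊗[ℂ] Irr r) ⧸ vermaRel ℓ r

instance : AddCommGroup (Verma ℓ r) :=
  inferInstanceAs (AddCommGroup ((UAff ⊗[ℂ] Irr r) ⧸ vermaRel ℓ r))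
instance : Module UAff (Verma ℓ r) :=
  inferInstanceAs (Module UAff ((UAff ⊗[ℂ] Irr r) ⧸ vermaRel ℓ r))
instance : Module ℂ (Verma ℓ r) :=
  inferInstanceAs (Module ℂ ((UAff ⊗[ℂ] Irr r) ⧸ vermaRel ℓ r))
instance : IsScalarTower ℂ UAff (Verma ℓ r) :=
  inferInstanceAs (IsScalarTower ℂ UAff ((UAff ⊗[ℂ] Irr r) ⧸ vermaRel ℓ r))

attribute [local instance 100] LieRing.ofAssociativeRing in
instance : LieRingModule Affine (Verma ℓ r) where
  bracket a w := UniversalEnvelopingAlgebra.ι ℂ a • w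
  add_lie a b w := by simp only [map_add, add_smul]
  lie_add a v w := smul_add _ _ _
  leibniz_lie a b w := by
    rw [LieHom.map_lie, LieRing.of_associative_ring_bracket, sub_smul, mul_smul, mul_smul,
      sub_add_cancel]

instance : LieModule ℂ Affine (Verma ℓ r) where
  smul_lie t a w := by
    change UniversalEnvelopingAlgebra.ι ℂ (t • a) • w = t • (UniversalEnvelopingAlgebra.ι ℂ a • w)
    rw [map_smul, smul_assoc]
  lie_smul t a w := smul_algebra_smul_comm t (UniversalEnvelopingAlgebra.ι ℂ a) w

namespace Verma

/-- The map `u ↦ 1 ⊗ u` from `M(r)` to `V^{M(r)}`. -/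
def incl : Irr r →ₗ[ℂ] Verma ℓ r where
  toFun u := Submodule.Quotient.mk (1 ⊗ₜ[ℂ] u)
  map_add' u v := by rw [TensorProduct.tmul_add, Submodule.Quotient.mk_add]; rfl
  map_smul' t u := by rw [TensorProduct.tmul_smul, Submodule.Quotient.mk_smul]; rfl

/-- The homogeneous subspace `V^{M(r)}(d)`: the span of the vectors `x₁(-n₁) ⋯ xₖ(-nₖ) u` with
`u ∈ M(r)`, `nᵢ > 0` and `n₁ + ⋯ + nₖ = d`. It is zero for `d < 0`. -/
def grade (d : ℤ) : Submodule ℂ (Verma ℓ r) :=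
  Submodule.span ℂ {w | ∃ (s : List (Sl2 × ℕ)) (u : Irr r),
    (∀ a ∈ s, 0 < a.2) ∧ (s.map fun a => (a.2 : ℤ)).sum = d ∧
      w = s.foldr (fun a v => ⁅loop (-(a.2 : ℤ)) a.1, v⁆) (incl ℓ r u)}

/-- The maximal proper submodule `J(r)` of `V^{M(r)}`: the sum of all its proper submodules.
At every level `ℓ ≠ -2` this sum is again proper, so that it is the largest proper submodule. -/
def maxProper : LieSubmodule ℂ Affine (Verma ℓ r) := sSup {N | N ≠ ⊤}

/-- The irreducible quotient `L(r) = V^{M(r)} / J(r)`. -/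
abbrev IrrQuot : Type := Verma ℓ r ⧸ maxProper ℓ r

end Verma

end Verma

end AffineSl2

end

/-! Write V(s) for the Verma module, J(s) for `maxProper`, and V̂(s) for `completion`, the space of
families (y_d) with y_d in V(s)(d); let Ĵ(s) be the families in V̂(s) with all members in J(s). Let
the current algebra sl(2) ⊗ ℂ[t] act on X = M(p) ⊗ M(q) through t = 1 on M(p) and t = 0 on M(q).
Putting y_d = Y_{-d}, the commutator formula says exactly that y : X → V̂(r) is a map of
current-algebra modules (`Verma.equivariant_iff`).

The full dual V(s)*, on which x(n) acts by minus the transpose of x(-n), is coinduced: equivariant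
maps X → V(s)* correspond to sl(2)-maps X → M(s)* ≅ M(s) (`Verma.exists_isDualHom`,
`Verma.IsDualHom.eq_zero`). This rests on the freeness of V(s) over the enveloping algebra of the
negative part. Hence f gives F : X → V(r)*, and there are no nonzero equivariant maps from X to
V(r')* or V(r'')*.

The contravariant form extends to V̂(r) → V(r)*; its kernel is Ĵ(r) and its image is the annihilator
of J(r). Finding Y amounts to lifting F equivariantly through this map
(`Verma.exists_unique_equivariant_lift`). Since J(r) is the image of a map α from V(r'), and F ∘ α =
0, each F(w) lies in the image, so F has a linear lift s. The ambiguity Ĵ(r) is V̂(r')/Ĵ(r'), which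
the form of V(r') embeds in V(r')*. By coinduction this embedding extends to an equivariant Ψ :
V̂(r) → V(r')*, because α maps M(r') onto an sl(2)-direct summand of a graded piece of V(r)
(`exists_retraction`). The form and Ψ are jointly injective on V̂(r).

It remains to lift F with Ψ = 0. Pulled back to V(r'') along V(r'') → J(r'), the map Ψ ∘ s becomes
equivariant, hence zero. So Ψ(s w) annihilates J(r') and equals the form of V(r') at some z; then s
w - α z is the required lift, and joint injectivity makes it linear and equivariant. Any equivariant
lift y has Ψ ∘ y = 0, which gives uniqueness. -/

noncomputable section
namespace AffineSl2

/-! ### Linear maps out of the affine Lie algebra and its representations of a given level -/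

section AffineLift

variable {W : Type*} [AddCommGroup W] [Module ℂ W]

/-- The linear map on the affine Lie algebra with prescribed values on the `x ⊗ tⁿ` and on `𝐤`. -/
def affLift (A : ℤ → Sl2 →ₗ[ℂ] W) (w : W) : Affine →ₗ[ℂ] W where
  toFun a := Finsupp.lsum ℂ A (LieAlgebra.LoopAlgebra.toFinsupp ℂ ℤ Sl2 a.carrier.1) +
    TrivialLieModule.equiv ℂ _ ℂ a.carrier.2 • w
  map_add' a b := by
    change Finsupp.lsum ℂ A (LieAlgebra.LoopAlgebra.toFinsupp ℂ ℤ Sl2 (a.carrier.1 + b.carrier.1)) +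
      TrivialLieModule.equiv ℂ _ ℂ (a.carrier.2 + b.carrier.2) • w = _
    rw [map_add, map_add, map_add, add_smul]
    abel
  map_smul' c a := by
    change Finsupp.lsum ℂ A (LieAlgebra.LoopAlgebra.toFinsupp ℂ ℤ Sl2 (c • a.carrier.1)) +
      TrivialLieModule.equiv ℂ _ ℂ (c • a.carrier.2) • w = _
    rw [map_smul, map_smul, map_smul, smul_add, smul_assoc, RingHom.id_apply]

@[simp]
theorem affLift_loop (A : ℤ → Sl2 →ₗ[ℂ] W) (w : W) (n : ℤ) (x : Sl2) :
    affLift A w (loop n x) = A n x := by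
  change Finsupp.lsum ℂ A (LieAlgebra.LoopAlgebra.toFinsupp ℂ ℤ Sl2
    (AddMonoidAlgebra.single n 1 ⊗ₜ[ℂ] x)) + TrivialLieModule.equiv ℂ _ ℂ 0 • w = _
  rw [LieAlgebra.LoopAlgebra.toFinsupp_single_tmul]
  simp

@[simp]
theorem affLift_central (A : ℤ → Sl2 →ₗ[ℂ] W) (w : W) : affLift A w central = w := by
  change Finsupp.lsum ℂ A (LieAlgebra.LoopAlgebra.toFinsupp ℂ ℤ Sl2 0) +
    TrivialLieModule.equiv ℂ _ ℂ ((TrivialLieModule.equiv ℂ _ ℂ).symm 1) • w = _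
  simp

end AffineLift

/-- The map `x ↦ x ⊗ tⁿ` as a linear map. -/
def loopₗ (n : ℤ) : Sl2 →ₗ[ℂ] Affine where
  toFun := loop n
  map_add' x y := by rw [loop, TensorProduct.tmul_add, loop, loop, ← LieAlgebra.of_add]; simp
  map_smul' c x := by rw [loop, TensorProduct.tmul_smul, loop, ← LieAlgebra.of_smul]; simp

theorem loop_add (n : ℤ) (x y : Sl2) : loop n (x + y) = loop n x + loop n y :=
  (loopₗ n).map_add x y

theorem loop_smul (n : ℤ) (c : ℂ) (x : Sl2) : loop n (c • x) = c • loop n x :=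
  (loopₗ n).map_smul c x

theorem loop_neg (n : ℤ) (x : Sl2) : loop n (-x) = -loop n x := (loopₗ n).map_neg x

/-- The affine Lie algebra is spanned by the `x ⊗ tⁿ` and `𝐤`. -/
theorem affine_induction {P : Affine → Prop} (a : Affine) (hl : ∀ n x, P (loop n x))
    (hc : P central) (hadd : ∀ a b, P a → P b → P (a + b)) (hsmul : ∀ (c : ℂ) a, P a → P (c • a)) :
    P a := by
  have h0 : P 0 := by simpa using hsmul 0 _ hc
  have hloop : ∀ f : ℤ →₀ Sl2,
      P (LieAlgebra.ofProd cocycle ((LieAlgebra.LoopAlgebra.toFinsupp ℂ ℤ Sl2).symm f, 0)) := by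
    intro f
    induction f using Finsupp.induction_linear with
    | zero => rw [map_zero]; exact h0
    | add f g hf hg =>
      have := hadd _ _ hf hg
      rw [← LieAlgebra.of_add] at this
      simpa using this
    | single n x => rw [LieAlgebra.LoopAlgebra.toFinsupp_symm_single]; exact hl n x
  obtain ⟨f, s⟩ := a
  have h1 := hloop (LieAlgebra.LoopAlgebra.toFinsupp ℂ ℤ Sl2 f)
  have h2 := hsmul (TrivialLieModule.equiv ℂ _ ℂ s) _ hc
  have h3 := hadd _ _ h1 h2
  rw [central, ← LieAlgebra.of_smul, ← LieAlgebra.of_add] at h3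
  convert h3 using 1
  change LieAlgebra.ofProd cocycle (f, s) = _
  congr 1
  refine Prod.ext ?_ ?_
  · simp
  · apply (TrivialLieModule.equiv ℂ _ ℂ).injective
    simp

theorem lie_central_right (a : Affine) : ⁅a, central⁆ = 0 := by
  rw [← lie_skew, lie_central, neg_zero]

/-- A family of operators `A n x` on `W`, for `x` in `sl(2, ℂ)` and `n` an integer, that satisfies
the relations of the affine Lie algebra with `𝐤` acting as the scalar `ℓ`. -/
def IsLevelRep {W : Type*} [AddCommGroup W] [Module ℂ W] (ℓ : ℂ)
    (A : ℤ → Sl2 →ₗ[ℂ] Module.End ℂ W) : Prop :=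
  ∀ (m n : ℤ) (x y : Sl2) (w : W), A m x (A n y w) - A n y (A m x w) =
    A (m + n) ⁅x, y⁆ w + (if m + n = 0 then (m : ℂ) * form x y else 0) • ℓ • w

attribute [local instance 100] LieRing.ofAssociativeRing

/-- The representation of the affine Lie algebra given by a family of operators. -/
def IsLevelRep.toLieHom {W : Type*} [AddCommGroup W] [Module ℂ W] {ℓ : ℂ}
    {A : ℤ → Sl2 →ₗ[ℂ] Module.End ℂ W} (hA : IsLevelRep ℓ A) : Affine →ₗ⁅ℂ⁆ Module.End ℂ W where
  __ := affLift A (ℓ • LinearMap.id)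
  map_lie' {a b} := by
    simp only [AddHom.toFun_eq_coe, LinearMap.coe_toAddHom, LieRing.of_associative_ring_bracket]
    induction b using affine_induction with
    | hc =>
      rw [lie_central_right, map_zero, affLift_central]
      ext w; simp
    | hadd b b' h h' => rw [lie_add, map_add, h, h', map_add]; noncomm_ring
    | hsmul c b h => rw [lie_smul, map_smul, h, map_smul, smul_sub, mul_smul_comm, smul_mul_assoc]
    | hl n y =>
      induction a using affine_induction with
      | hc =>
        rw [lie_central, map_zero, affLift_central]
        ext w; simp
      | hadd b b' h h' => rw [add_lie, map_add, h, h', map_add]; noncomm_ring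
      | hsmul c b h => rw [smul_lie, map_smul, h, map_smul, smul_sub, mul_smul_comm, smul_mul_assoc]
      | hl m x =>
        rw [lie_loop_loop, map_add, map_smul, affLift_central, affLift_loop, affLift_loop,
          affLift_loop]
        ext w
        simp only [LinearMap.add_apply, LinearMap.smul_apply, LinearMap.id_apply,
          LinearMap.sub_apply, Module.End.mul_apply, hA m n x y w]

theorem IsLevelRep.toLieHom_loop {W : Type*} [AddCommGroup W] [Module ℂ W] {ℓ : ℂ}
    {A : ℤ → Sl2 →ₗ[ℂ] Module.End ℂ W} (hA : IsLevelRep ℓ A) (n : ℤ) (x : Sl2) :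
    hA.toLieHom (loop n x) = A n x := affLift_loop _ _ _ _

theorem IsLevelRep.toLieHom_central {W : Type*} [AddCommGroup W] [Module ℂ W] {ℓ : ℂ}
    {A : ℤ → Sl2 →ₗ[ℂ] Module.End ℂ W} (hA : IsLevelRep ℓ A) :
    hA.toLieHom central = ℓ • LinearMap.id := affLift_central _ _

/-- An induction principle for the enveloping algebra. -/
theorem UEA_induction {L : Type*} [LieRing L] [LieAlgebra ℂ L]
    {P : UniversalEnvelopingAlgebra ℂ L → Prop} (a : UniversalEnvelopingAlgebra ℂ L) (h1 : P 1)
    (hι : ∀ b a, P a → P (UniversalEnvelopingAlgebra.ι ℂ b * a))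
    (hadd : ∀ a b, P a → P b → P (a + b)) (hsmul : ∀ (c : ℂ) a, P a → P (c • a)) : P a := by
  let S : Submodule ℂ (UniversalEnvelopingAlgebra ℂ L) :=
    { carrier := {a | P a}
      add_mem' := fun {a b} ha hb => hadd a b ha hb
      zero_mem' := by simpa using hsmul 0 _ h1
      smul_mem' := fun c a ha => hsmul c a ha }
  -- The left multipliers of `S` form a subalgebra containing the image of `ι`. By the universal
  -- property the identity factors through it, so it is everything.
  let T : Subalgebra ℂ (UniversalEnvelopingAlgebra ℂ L) :=
    { carrier := {a | ∀ b ∈ S, a * b ∈ S}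
      add_mem' := fun {a b} ha hb c hc => by rw [add_mul]; exact S.add_mem (ha c hc) (hb c hc)
      mul_mem' := fun {a b} ha hb c hc => by rw [mul_assoc]; exact ha _ (hb c hc)
      algebraMap_mem' := fun r c hc => by
        rw [← Algebra.smul_def]; exact S.smul_mem r hc }
  let g : L →ₗ⁅ℂ⁆ T :=
    { toFun := fun b => ⟨UniversalEnvelopingAlgebra.ι ℂ b, fun c hc => hι b c hc⟩
      map_add' := fun b c => Subtype.ext (by simp)
      map_smul' := fun r b => Subtype.ext (by simp)
      map_lie' := fun {b c} => Subtype.ext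
        ((UniversalEnvelopingAlgebra.ι ℂ).map_lie b c) }
  have h : T.val.comp (UniversalEnvelopingAlgebra.lift ℂ g) =
      AlgHom.id ℂ (UniversalEnvelopingAlgebra ℂ L) := by
    apply UniversalEnvelopingAlgebra.hom_ext
    ext b
    change T.val (UniversalEnvelopingAlgebra.lift ℂ g (UniversalEnvelopingAlgebra.ι ℂ b)) = _
    rw [UniversalEnvelopingAlgebra.lift_ι_apply]
    rfl
  have h2 : a ∈ T := by
    have := congrArg (fun f => f a) h
    simp only [AlgHom.coe_comp, Function.comp_apply, AlgHom.coe_id, id_eq] at this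
    rw [← this]
    exact (UniversalEnvelopingAlgebra.lift ℂ g a).2
  exact mul_one a ▸ h2 1 h1

/-! ### Generators and universal property of Verma modules. -/

namespace Verma

variable {ℓ : ℂ} {r : ℕ}

theorem lie_eq_smul (a : Affine) (v : Verma ℓ r) :
    ⁅a, v⁆ = UniversalEnvelopingAlgebra.ι ℂ a • v := rfl

theorem smul_incl (a : UAff) (u : Irr r) :
    a • incl ℓ r u = (Submodule.Quotient.mk (a ⊗ₜ[ℂ] u) : (UAff ⊗[ℂ] Irr r) ⧸ vermaRel ℓ r) := by
  change a • (Submodule.Quotient.mk (1 ⊗ₜ[ℂ] u) : (UAff ⊗[ℂ] Irr r) ⧸ vermaRel ℓ r) = _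
  rw [← Submodule.Quotient.mk_smul, TensorProduct.smul_tmul', smul_eq_mul, mul_one]

theorem loop_incl (n : ℕ) (x : Sl2) (u : Irr r) :
    ⁅loop n x, incl ℓ r u⁆ = incl ℓ r (posAct n x u) := by
  rw [lie_eq_smul, smul_incl]
  refine (Submodule.Quotient.eq _).2 (Submodule.subset_span (Or.inl ⟨n, x, u, rfl⟩))

theorem loop_zero_incl (x : Sl2) (u : Irr r) : ⁅loop 0 x, incl ℓ r u⁆ = incl ℓ r ⁅x, u⁆ :=
  loop_incl 0 x u

theorem loop_pos_incl {n : ℤ} (hn : 0 < n) (x : Sl2) (u : Irr r) : ⁅loop n x, incl ℓ r u⁆ = 0 := by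
  lift n to ℕ using hn.le
  rw [loop_incl, posAct, if_neg (by omega), map_zero]

theorem central_incl (u : Irr r) : ⁅central, incl ℓ r u⁆ = ℓ • incl ℓ r u := by
  rw [lie_eq_smul, smul_incl, ← map_smul]
  refine (Submodule.Quotient.eq _).2 (Submodule.subset_span (Or.inr ⟨u, rfl⟩))

/-- The Verma module is generated by `M(r)`. -/
theorem eq_top_of_lie_stable {S : Submodule ℂ (Verma ℓ r)} (h0 : ∀ u, incl ℓ r u ∈ S)
    (h : ∀ (a : Affine), ∀ v ∈ S, ⁅a, v⁆ ∈ S) : S = ⊤ := by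
  have h1 : ∀ (a : UAff) (u : Irr r), a • incl ℓ r u ∈ S := by
    intro a u
    induction a using UEA_induction with
    | h1 => rw [one_smul]; exact h0 u
    | hι b a ha => rw [mul_smul]; exact h b _ ha
    | hadd a b ha hb => rw [add_smul]; exact S.add_mem ha hb
    | hsmul c a ha => rw [smul_assoc]; exact S.smul_mem c ha
  refine eq_top_iff.2 fun v _ => ?_
  obtain ⟨t, rfl⟩ := Submodule.Quotient.mk_surjective _ v
  induction t with
  | zero => exact S.zero_mem
  | add s t hs ht => exact S.add_mem (hs trivial) (ht trivial)
  | tmul a u => exact (smul_incl (ℓ := ℓ) a u) ▸ h1 a u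

theorem lie_central_apply (v : Verma ℓ r) : ⁅central, v⁆ = ℓ • v := by
  let S : Submodule ℂ (Verma ℓ r) :=
    { carrier := {v | ⁅central, v⁆ = ℓ • v}
      add_mem' := fun {v w} hv hw => by
        rw [Set.mem_ofPred_eq] at *; rw [lie_add, hv, hw, smul_add]
      zero_mem' := by simp
      smul_mem' := fun c v hv => by
        rw [Set.mem_ofPred_eq] at *; rw [lie_smul, hv, smul_comm] }
  have hS : S = ⊤ := by
    refine eq_top_of_lie_stable central_incl fun a v hv => ?_
    change ⁅central, ⁅a, v⁆⁆ = ℓ • ⁅a, v⁆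
    rw [leibniz_lie, lie_central, zero_lie, zero_add, show ⁅central, v⁆ = ℓ • v from hv, lie_smul]
  exact (hS ▸ Submodule.mem_top : v ∈ S)

/-- The monomial `x₁(-n₁) ⋯ xₖ(-nₖ) u`. -/
def mono (s : List (Sl2 × ℕ)) (u : Irr r) : Verma ℓ r :=
  s.foldr (fun a v => ⁅loop (-(a.2 : ℤ)) a.1, v⁆) (incl ℓ r u)

/-- The Verma module is generated by `M(r)` under the `x(-n)` with `n > 0`. -/
theorem eq_top_of_neg_stable {S : Submodule ℂ (Verma ℓ r)} (h0 : ∀ u, incl ℓ r u ∈ S)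
    (h : ∀ n : ℕ, 0 < n → ∀ x, ∀ v ∈ S, ⁅loop (-(n : ℤ)) x, v⁆ ∈ S) : S = ⊤ := by
  let T : Submodule ℂ (Verma ℓ r) := Submodule.span ℂ
    {w | ∃ (s : List (Sl2 × ℕ)) (u : Irr r), (∀ a ∈ s, 0 < a.2) ∧ w = mono s u}
  have hTS : T ≤ S := by
    refine Submodule.span_le.2 ?_
    rintro _ ⟨s, u, hs, rfl⟩
    induction s with
    | nil => exact h0 u
    | cons a s ih =>
      exact h a.2 (hs a (by simp)) a.1 _ (ih fun b hb => hs b (by simp [hb]))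
  have hneg : ∀ n : ℕ, 0 < n → ∀ x, ∀ v ∈ T, ⁅loop (-(n : ℤ)) x, v⁆ ∈ T := by
    intro n hn x v hv
    induction hv using Submodule.span_induction with
    | zero => rw [lie_zero]; exact T.zero_mem
    | add v w _ _ hv hw => rw [lie_add]; exact T.add_mem hv hw
    | smul c v _ hv => rw [lie_smul]; exact T.smul_mem c hv
    | mem v hv =>
      obtain ⟨s, u, hs, rfl⟩ := hv
      refine Submodule.subset_span ⟨(x, n) :: s, u, ?_, rfl⟩
      simpa [hn] using fun a b hab => hs (a, b) hab
  -- The acting element stays arbitrary in the induction: in `⁅a, ⁅b, v⁆⁆ = ⁅⁅a, b⁆, v⁆ + ⁅b, ⁅a,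
  -- v⁆⁆` both `⁅⁅a, b⁆, v⁆` and `⁅a, v⁆` are covered by the shorter monomial `v`.
  have key : ∀ (s : List (Sl2 × ℕ)) (u : Irr r), (∀ a ∈ s, 0 < a.2) →
      ∀ a : Affine, ⁅a, (mono s u : Verma ℓ r)⁆ ∈ T := by
    intro s u hs
    have hT0 : ∀ u, incl ℓ r u ∈ T := fun u =>
      Submodule.subset_span ⟨[], u, by simp, rfl⟩
    induction s with
    | nil =>
      intro a
      induction a using affine_induction with
      | hc => exact central_incl (ℓ := ℓ) u ▸ T.smul_mem ℓ (hT0 u)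
      | hadd a b ha hb => rw [add_lie]; exact T.add_mem ha hb
      | hsmul c a ha => rw [smul_lie]; exact T.smul_mem c ha
      | hl n x =>
        rcases lt_or_ge n 0 with hn | hn
        · obtain ⟨k, rfl⟩ : ∃ k : ℕ, n = -(k : ℤ) := ⟨n.natAbs, by omega⟩
          exact hneg k (by omega) x _ (hT0 u)
        · lift n to ℕ using hn
          exact loop_incl (ℓ := ℓ) n x u ▸ hT0 _
    | cons b s ih =>
      intro a
      have hs' : ∀ a ∈ s, 0 < a.2 := fun c hc => hs c (by simp [hc])
      change ⁅a, ⁅loop (-(b.2 : ℤ)) b.1, (mono s u : Verma ℓ r)⁆⁆ ∈ T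
      rw [leibniz_lie]
      exact T.add_mem (ih hs' _) (hneg b.2 (hs b (by simp)) b.1 _ (ih hs' a))
  refine eq_top_iff.2 ((eq_top_of_lie_stable (S := T) (fun u => ?_) ?_).ge.trans hTS)
  · exact Submodule.subset_span ⟨[], u, by simp, rfl⟩
  · intro a v hv
    induction hv using Submodule.span_induction with
    | zero => rw [lie_zero]; exact T.zero_mem
    | add v w _ _ hv hw => rw [lie_add]; exact T.add_mem hv hw
    | smul c v _ hv => rw [lie_smul]; exact T.smul_mem c hv
    | mem v hv =>
      obtain ⟨s, u, hs, rfl⟩ := hv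
      exact key s u hs a

/-- The operators `x(n)` on the Verma module. -/
def act (ℓ : ℂ) (r : ℕ) (n : ℤ) : Sl2 →ₗ[ℂ] Module.End ℂ (Verma ℓ r) where
  toFun x :=
    { toFun := fun v => ⁅loop n x, v⁆
      map_add' := fun v w => lie_add _ _ _
      map_smul' := fun c v => lie_smul _ _ _ }
  map_add' x y := by ext v; simp [loop_add]
  map_smul' c x := by ext v; simp [loop_smul]

@[simp] theorem act_apply (n : ℤ) (x : Sl2) (v : Verma ℓ r) : act ℓ r n x v = ⁅loop n x, v⁆ := rfl

theorem act_isLevelRep : IsLevelRep ℓ (act ℓ r) := fun m n x y v => by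
  simp only [act_apply]
  rw [← lie_lie, lie_loop_loop, add_lie, smul_lie, lie_central_apply]

/-- The universal property of the Verma module. -/
theorem exists_lift {W : Type*} [AddCommGroup W] [Module ℂ W] {A : ℤ → Sl2 →ₗ[ℂ] Module.End ℂ W}
    (hA : IsLevelRep ℓ A) (i : Irr r →ₗ[ℂ] W)
    (hi : ∀ (n : ℕ) x u, A n x (i u) = i (posAct n x u)) :
    ∃ T : Verma ℓ r →ₗ[ℂ] W, (∀ u, T (incl ℓ r u) = i u) ∧
      ∀ n x v, T ⁅loop n x, v⁆ = A n x (T v) := by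
  let Φ : UAff →ₐ[ℂ] Module.End ℂ W := UniversalEnvelopingAlgebra.lift ℂ hA.toLieHom
  have hΦ : ∀ a, Φ (UniversalEnvelopingAlgebra.ι ℂ a) = hA.toLieHom a := fun a =>
    UniversalEnvelopingAlgebra.lift_ι_apply ℂ _ a
  let T₀ : UAff ⊗[ℂ] Irr r →ₗ[ℂ] W := TensorProduct.lift ((LinearMap.lcomp ℂ W i) ∘ₗ Φ.toLinearMap)
  have hT₀ : ∀ a u, T₀ (a ⊗ₜ u) = Φ a (i u) := fun a u => rfl
  have hT₁ : ∀ (a : UAff) t, T₀ (a • t) = Φ a (T₀ t) := by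
    intro a t
    induction t with
    | zero => simp
    | add s t hs ht => rw [smul_add, map_add, hs, ht, map_add, map_add]
    | tmul b u => rw [TensorProduct.smul_tmul', hT₀, hT₀, smul_eq_mul, map_mul, Module.End.mul_apply]
  have hker : (vermaRel ℓ r).restrictScalars ℂ ≤ LinearMap.ker T₀ := by
    intro t ht
    rw [Submodule.restrictScalars_mem] at ht
    rw [LinearMap.mem_ker]
    induction ht using Submodule.span_induction with
    | zero => simp
    | add s t _ _ hs ht => rw [map_add, hs, ht, add_zero]
    | smul a t _ ht => rw [hT₁, ht, map_zero]
    | mem t ht =>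
      rcases ht with ⟨n, x, u, rfl⟩ | ⟨u, rfl⟩
      · rw [map_sub, hT₀, hT₀, hΦ, hA.toLieHom_loop, map_one, Module.End.one_apply, hi, sub_self]
      · rw [map_sub, hT₀, hT₀, hΦ, hA.toLieHom_central, map_one, Module.End.one_apply, map_smul]
        simp
  let T : Verma ℓ r →ₗ[ℂ] W := ((vermaRel ℓ r).restrictScalars ℂ).liftQ T₀ hker
  have hT : ∀ t, T (Submodule.Quotient.mk t : (UAff ⊗[ℂ] Irr r) ⧸ vermaRel ℓ r) = T₀ t :=
    fun t => rfl
  refine ⟨T, fun u => ?_, fun n x v => ?_⟩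
  · refine (hT _).trans ?_
    rw [hT₀, map_one, Module.End.one_apply]
  · obtain ⟨t, rfl⟩ := Submodule.Quotient.mk_surjective _ v
    refine (hT (UniversalEnvelopingAlgebra.ι ℂ (loop n x) • t)).trans ?_
    rw [hT₁, hΦ, hA.toLieHom_loop]
    rfl

end Verma
end AffineSl2
end

noncomputable section
namespace AffineSl2

attribute [local instance 100] LieRing.ofAssociativeRing

/-! ### The module induced from `M(r)`, realised on the enveloping algebra of the negative part -/

/-- The span of the `x ⊗ t⁻ⁿ` with `n > 0`. -/
def negPart : LieSubalgebra ℂ Affine where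
  __ := Submodule.span ℂ {a | ∃ (n : ℕ) (x : Sl2), 0 < n ∧ a = loop (-(n : ℤ)) x}
  lie_mem' {a b} ha hb := by
    simp only [Submodule.carrier_eq_coe, SetLike.mem_coe] at ha hb ⊢
    induction ha using Submodule.span_induction with
    | zero => rw [zero_lie]; exact Submodule.zero_mem _
    | add a a' _ _ h h' => rw [add_lie]; exact Submodule.add_mem _ h h'
    | smul c a _ h => rw [smul_lie]; exact Submodule.smul_mem _ c h
    | mem a ha =>
      obtain ⟨m, x, hm, rfl⟩ := ha
      induction hb using Submodule.span_induction with
      | zero => rw [lie_zero]; exact Submodule.zero_mem _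
      | add a a' _ _ h h' => rw [lie_add]; exact Submodule.add_mem _ h h'
      | smul c a _ h => rw [lie_smul]; exact Submodule.smul_mem _ c h
      | mem b hb =>
        obtain ⟨n, y, hn, rfl⟩ := hb
        rw [lie_loop_loop, if_neg (by omega), zero_smul, add_zero]
        refine Submodule.subset_span ⟨m + n, ⁅x, y⁆, by omega, ?_⟩
        congr 1
        push_cast
        ring

theorem loop_mem_negPart {n : ℤ} (hn : n < 0) (x : Sl2) : loop n x ∈ negPart :=
  Submodule.subset_span ⟨n.natAbs, x, by omega, by congr 1; omega⟩

theorem negPart_induction {P : negPart → Prop} (b : negPart)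
    (hl : ∀ n x (hn : n < 0), P ⟨loop n x, loop_mem_negPart hn x⟩)
    (hadd : ∀ a b, P a → P b → P (a + b)) (hsmul : ∀ (c : ℂ) a, P a → P (c • a)) : P b := by
  obtain ⟨b, hb⟩ := b
  have hb' : b ∈ Submodule.span ℂ {a | ∃ (n : ℕ) (x : Sl2), 0 < n ∧ a = loop (-(n : ℤ)) x} := hb
  induction hb' using Submodule.span_induction with
  | zero =>
    have := hsmul 0 _ (hl (-1) 0 (by omega))
    rwa [zero_smul] at this
  | add a a' ha ha' h h' => exact hadd ⟨a, ha⟩ ⟨a', ha'⟩ (h ha) (h' ha')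
  | smul c a ha h => exact hsmul c ⟨a, ha⟩ (h ha)
  | mem a ha =>
    obtain ⟨m, x, hm, rfl⟩ := ha
    exact hl _ x (by omega)

theorem negPart_coe_add (a b : negPart) : ((a + b : negPart) : Affine) = a + b := rfl

theorem negPart_coe_smul (c : ℂ) (a : negPart) : ((c • a : negPart) : Affine) = c • (a : Affine) :=
  rfl

/-- The projection onto the negative part. -/
def negProj : Affine →ₗ[ℂ] negPart :=
  affLift (fun n => if hn : n < 0 then
    (loopₗ n).codRestrict negPart.toSubmodule (loop_mem_negPart hn) else 0) 0

theorem negProj_loop_neg {n : ℤ} (hn : n < 0) (x : Sl2) :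
    negProj (loop n x) = ⟨loop n x, loop_mem_negPart hn x⟩ := by
  rw [negProj, affLift_loop, dif_pos hn]
  rfl

theorem negProj_loop_nonneg {n : ℤ} (hn : 0 ≤ n) (x : Sl2) : negProj (loop n x) = 0 := by
  rw [negProj, affLift_loop, dif_neg (by omega), LinearMap.zero_apply]

theorem negProj_central : negProj central = 0 := affLift_central _ _

theorem negProj_coe (b : negPart) : negProj b = b := by
  induction b using negPart_induction with
  | hl n x hn => exact negProj_loop_neg hn x
  | hadd a b ha hb => rw [negPart_coe_add, map_add, ha, hb]
  | hsmul c a ha => rw [negPart_coe_smul, map_smul, ha]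

/-- The action on `M(r)` of the nonnegative part, extended by zero to the affine algebra. -/
def topAct (ℓ : ℂ) (r : ℕ) : Affine →ₗ[ℂ] Module.End ℂ (Irr r) :=
  affLift (fun n => if n = 0 then (LieModule.toEnd ℂ Sl2 (Irr r) : Sl2 →ₗ[ℂ] _) else 0)
    (ℓ • LinearMap.id)

variable {ℓ : ℂ} {r : ℕ}

theorem topAct_loop_nonneg (n : ℕ) (x : Sl2) (u : Irr r) :
    topAct ℓ r (loop n x) u = posAct n x u := by
  rw [topAct, affLift_loop, posAct]
  rcases Nat.eq_zero_or_pos n with rfl | hn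
  · simp
  · rw [if_neg (by omega), if_neg (by omega)]; rfl

theorem topAct_central (u : Irr r) : topAct ℓ r central u = ℓ • u := by
  rw [topAct, affLift_central]; rfl

theorem topAct_negPart (b : negPart) (u : Irr r) : topAct ℓ r b u = 0 := by
  induction b using negPart_induction with
  | hl n x hn =>
    change topAct ℓ r (loop n x) u = 0
    rw [topAct, affLift_loop, if_neg (by omega)]; rfl
  | hadd a b ha hb => rw [negPart_coe_add, map_add, LinearMap.add_apply, ha, hb, add_zero]
  | hsmul c a ha => rw [negPart_coe_smul, map_smul, LinearMap.smul_apply, ha, smul_zero]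

/-- The free module over the enveloping algebra of the negative part generated by `M(r)`. -/
abbrev FreeMod (r : ℕ) : Type := UniversalEnvelopingAlgebra ℂ negPart ⊗[ℂ] Irr r

theorem freeMod_induction {P : FreeMod r → Prop} (q : FreeMod r) (h1 : ∀ u, P (1 ⊗ₜ u))
    (hι : ∀ (b : negPart) q, P q → P (UniversalEnvelopingAlgebra.ι ℂ b • q))
    (hadd : ∀ p q, P p → P q → P (p + q)) (hsmul : ∀ (c : ℂ) q, P q → P (c • q)) : P q := by
  induction q using TensorProduct.induction_on with
  | zero => simpa using h1 0
  | add p q hp hq => exact hadd p q hp hq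
  | tmul a u =>
    induction a using UEA_induction (L := negPart) with
    | h1 => exact h1 u
    | hι b a ha => rw [← smul_eq_mul, ← TensorProduct.smul_tmul']; exact hι b _ ha
    | hadd a b ha hb => rw [TensorProduct.add_tmul]; exact hadd _ _ ha hb
    | hsmul c a ha => rw [← TensorProduct.smul_tmul']; exact hsmul c _ ha

/-- Multiplication by an element of the negative part. -/
def negMul (b : negPart) : Module.End ℂ (FreeMod r) :=
  Module.toModuleEnd ℂ (S := UniversalEnvelopingAlgebra ℂ negPart) (FreeMod r)
    (UniversalEnvelopingAlgebra.ι ℂ b)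

@[simp] theorem negMul_apply (b : negPart) (q : FreeMod r) :
    negMul b q = UniversalEnvelopingAlgebra.ι ℂ b • q := rfl

/-- The action `(b g)(a) = b g(a) - g([b, a])` on linear maps out of the affine algebra. -/
def homAct (r : ℕ) : negPart →ₗ⁅ℂ⁆ Module.End ℂ (Affine →ₗ[ℂ] FreeMod r) where
  toFun b :=
    { toFun := fun g => (negMul b) ∘ₗ g - g ∘ₗ (LieModule.toEnd ℂ Affine Affine (b : Affine))
      map_add' := fun g g' => by ext a; simp; abel
      map_smul' := fun c g => by
        ext a
        simp [smul_sub, smul_comm c] }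
  map_add' b b' := by
    ext g a
    simp [add_smul]
    abel
  map_smul' c b := by
    ext g a
    simp [smul_sub]
  map_lie' {b b'} := by
    ext g a
    simp only [LieRing.of_associative_ring_bracket, LinearMap.sub_apply, Module.End.mul_apply,
      LinearMap.coe_mk, AddHom.coe_mk, LinearMap.comp_apply, negMul_apply, LieHom.map_lie,
      LieSubalgebra.coe_bracket, sub_smul, mul_smul, LieModule.toEnd_apply_apply, map_sub]
    abel

/-- The action of the affine algebra on the generators. -/
def genAct (ℓ : ℂ) (r : ℕ) : Irr r →ₗ[ℂ] Affine →ₗ[ℂ] FreeMod r where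
  toFun u :=
    { toFun := fun a => UniversalEnvelopingAlgebra.ι ℂ (negProj a) ⊗ₜ u + 1 ⊗ₜ topAct ℓ r a u
      map_add' := fun a b => by simp [TensorProduct.add_tmul, TensorProduct.tmul_add]; abel
      map_smul' := fun c a => by simp [TensorProduct.smul_tmul'] }
  map_add' u v := by ext a; simp [TensorProduct.tmul_add]; abel
  map_smul' c u := by ext a; simp

theorem genAct_apply (u : Irr r) (a : Affine) : genAct ℓ r u a =
    UniversalEnvelopingAlgebra.ι ℂ (negProj a) ⊗ₜ u + 1 ⊗ₜ topAct ℓ r a u := rfl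

/-- Linear maps out of the free module that intertwine a given action of the negative part. -/
theorem exists_freeMod_lift {W : Type*} [AddCommGroup W] [Module ℂ W]
    (φ : negPart →ₗ⁅ℂ⁆ Module.End ℂ W) (i : Irr r →ₗ[ℂ] W) :
    ∃ T : FreeMod r →ₗ[ℂ] W, (∀ u, T (1 ⊗ₜ u) = i u) ∧
      ∀ (b : negPart) q, T (UniversalEnvelopingAlgebra.ι ℂ b • q) = φ b (T q) := by
  let Φ := UniversalEnvelopingAlgebra.lift ℂ φ
  let T : FreeMod r →ₗ[ℂ] W := TensorProduct.lift ((LinearMap.lcomp ℂ W i) ∘ₗ Φ.toLinearMap)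
  have hT : ∀ a u, T (a ⊗ₜ u) = Φ a (i u) := fun a u => rfl
  refine ⟨T, fun u => by rw [hT, map_one, Module.End.one_apply], fun b q => ?_⟩
  induction q using TensorProduct.induction_on with
  | zero => simp
  | add p q hp hq => rw [smul_add, map_add, hp, hq, map_add, map_add]
  | tmul a u =>
    rw [TensorProduct.smul_tmul', hT, hT, smul_eq_mul, map_mul, Module.End.mul_apply,
      UniversalEnvelopingAlgebra.lift_ι_apply]

/-- Reading `T q a` as a q, the recursion is a b q = b a q - [b, a] q. It determines the action of
the whole affine algebra from its values on generators, without a basis of the enveloping algebra.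
-/
theorem exists_affine_act (ℓ : ℂ) (r : ℕ) : ∃ T : FreeMod r →ₗ[ℂ] Affine →ₗ[ℂ] FreeMod r,
    (∀ u, T (1 ⊗ₜ u) = genAct ℓ r u) ∧
      ∀ (b : negPart) q a, T (UniversalEnvelopingAlgebra.ι ℂ b • q) a =
        UniversalEnvelopingAlgebra.ι ℂ b • T q a - T q ⁅(b : Affine), a⁆ :=
  (exists_freeMod_lift (homAct r) (genAct ℓ r)).imp fun _ hT =>
    ⟨hT.1, fun b q a => LinearMap.congr_fun (hT.2 b q) a⟩

/-! ### The recursive operators satisfy the affine relations. -/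

section Induced

variable {W : Type*} [AddCommGroup W] [Module ℂ W]

theorem affine_commutator_of_loop {T : W →ₗ[ℂ] Affine →ₗ[ℂ] W}
    (hcen : ∀ q, T q central = ℓ • q) (q : W)
    (h : ∀ m n x y, T (T q (loop n y)) (loop m x) - T (T q (loop m x)) (loop n y) =
      T q ⁅loop m x, loop n y⁆) (a a' : Affine) :
    T (T q a') a - T (T q a) a' = T q ⁅a, a'⁆ := by
  induction a using affine_induction with
  | hc => rw [hcen, hcen, lie_central, map_zero, map_smul, LinearMap.smul_apply, sub_self]
  | hadd a b ha hb =>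
    rw [add_lie, map_add (T q) ⁅a, a'⁆, ← ha, ← hb]
    simp only [map_add, LinearMap.add_apply]
    abel
  | hsmul c a ha =>
    rw [smul_lie, map_smul (T q) c ⁅a, a'⁆, ← ha]
    simp only [map_smul, LinearMap.smul_apply, smul_sub]
  | hl m x =>
    induction a' using affine_induction with
    | hc => rw [hcen, hcen, lie_central_right, map_zero, map_smul, LinearMap.smul_apply, sub_self]
    | hadd a b ha hb =>
      rw [lie_add, map_add (T q) ⁅_, a⁆, ← ha, ← hb]
      simp only [map_add, LinearMap.add_apply]
      abel
    | hsmul c a ha =>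
      rw [lie_smul, map_smul (T q) c ⁅_, a⁆, ← ha]
      simp only [map_smul, LinearMap.smul_apply, smul_sub]
    | hl n y => exact h m n x y

variable {μ : negPart →ₗ⁅ℂ⁆ Module.End ℂ W} {i : Irr r →ₗ[ℂ] W} {T : W →ₗ[ℂ] Affine →ₗ[ℂ] W}

/-- On negative elements the recursion reproduces `μ`: b'(b q) - [b', b] q = b(b' q) because `μ` is
a Lie homomorphism. -/
theorem induced_apply_negPart
    (hind : ∀ S : Submodule ℂ W, (∀ u, i u ∈ S) → (∀ b, ∀ q ∈ S, μ b q ∈ S) → S = ⊤)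
    (hT1 : ∀ u a, T (i u) a = μ (negProj a) (i u) + i (topAct ℓ r a u))
    (hT : ∀ (b : negPart) q a, T (μ b q) a = μ b (T q a) - T q ⁅(b : Affine), a⁆)
    (b : negPart) (q : W) : T q b = μ b q := by
  let S : Submodule ℂ W :=
    { carrier := {q | ∀ b : negPart, T q b = μ b q}
      add_mem' := fun hp hq b => by rw [map_add, LinearMap.add_apply, hp, hq, map_add]
      zero_mem' := fun b => by simp
      smul_mem' := fun c q hq b => by rw [map_smul, LinearMap.smul_apply, hq, map_smul] }
  have hS : S = ⊤ := by
    refine hind S (fun u b => ?_) (fun b' q hq b => ?_)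
    · rw [hT1, negProj_coe, topAct_negPart, map_zero, add_zero]
    · rw [hT, hq, ← LieSubalgebra.coe_bracket, hq, LieHom.map_lie,
        LieRing.of_associative_ring_bracket, LinearMap.sub_apply, Module.End.mul_apply,
        Module.End.mul_apply]
      abel
  exact (hS ▸ Submodule.mem_top : q ∈ S) b

theorem induced_apply_central
    (hind : ∀ S : Submodule ℂ W, (∀ u, i u ∈ S) → (∀ b, ∀ q ∈ S, μ b q ∈ S) → S = ⊤)
    (hT1 : ∀ u a, T (i u) a = μ (negProj a) (i u) + i (topAct ℓ r a u))
    (hT : ∀ (b : negPart) q a, T (μ b q) a = μ b (T q a) - T q ⁅(b : Affine), a⁆)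
    (q : W) : T q central = ℓ • q := by
  let S : Submodule ℂ W :=
    { carrier := {q | T q central = ℓ • q}
      add_mem' := fun {p q} hp hq => by
        rw [Set.mem_ofPred_eq] at *; rw [map_add, LinearMap.add_apply, hp, hq, smul_add]
      zero_mem' := by simp
      smul_mem' := fun c q hq => by
        rw [Set.mem_ofPred_eq] at *; rw [map_smul, LinearMap.smul_apply, hq, smul_comm] }
  have hS : S = ⊤ := by
    refine hind S (fun u => ?_) (fun b q hq => ?_)
    · change T (i u) central = ℓ • i u
      rw [hT1, negProj_central, topAct_central, map_zero, LinearMap.zero_apply, zero_add, map_smul]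
    · change T (μ b q) central = ℓ • μ b q
      rw [hT, show T q central = ℓ • q from hq, lie_central_right, map_zero, sub_zero, map_smul]
  exact (hS ▸ Submodule.mem_top : q ∈ S)

/-- The relation passes from `q` to `μ b q` by the Jacobi identity. On generators, a negative
argument is handled by the recursion itself; for two nonnegative arguments the relation is that of
M(r), the cocycle contributing nothing since m + n = 0 forces m = 0. -/
theorem induced_commutator
    (hind : ∀ S : Submodule ℂ W, (∀ u, i u ∈ S) → (∀ b, ∀ q ∈ S, μ b q ∈ S) → S = ⊤)
    (hT1 : ∀ u a, T (i u) a = μ (negProj a) (i u) + i (topAct ℓ r a u))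
    (hT : ∀ (b : negPart) q a, T (μ b q) a = μ b (T q a) - T q ⁅(b : Affine), a⁆)
    (q : W) (a a' : Affine) : T (T q a') a - T (T q a) a' = T q ⁅a, a'⁆ := by
  have hneg := induced_apply_negPart hind hT1 hT
  have hcomm : ∀ (b : negPart) q a, T (T q b) a - T (T q a) b = T q ⁅a, (b : Affine)⁆ := by
    intro b q a
    rw [hneg, hneg, hT, ← lie_skew, map_neg]
    abel
  let S : Submodule ℂ W :=
    { carrier := {q | ∀ a a', T (T q a') a - T (T q a) a' = T q ⁅a, a'⁆}
      add_mem' := fun hp hq a a' => by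
        simp only [map_add, LinearMap.add_apply, ← hp a a', ← hq a a']; abel
      zero_mem' := fun a a' => by simp
      smul_mem' := fun c q hq a a' => by
        simp only [map_smul, LinearMap.smul_apply, ← hq a a', smul_sub] }
  have hS : S = ⊤ := by
    refine hind S (fun u => ?_) (fun b q hq a a' => ?_)
    · refine affine_commutator_of_loop (induced_apply_central hind hT1 hT) _ fun m n x y => ?_
      rcases lt_or_ge n 0 with hn | hn
      · exact hcomm ⟨loop n y, loop_mem_negPart hn y⟩ _ _
      rcases lt_or_ge m 0 with hm | hm
      · rw [← neg_sub, hcomm ⟨loop m x, loop_mem_negPart hm x⟩, ← map_neg, lie_skew]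
      lift n to ℕ using hn
      lift m to ℕ using hm
      have hpos : ∀ (n : ℕ) x u, T (i u) (loop n x) = i (posAct n x u) := fun n x u => by
        rw [hT1, negProj_loop_nonneg (by omega), topAct_loop_nonneg, map_zero,
          LinearMap.zero_apply, zero_add]
      rw [lie_loop_loop, map_add, map_smul, induced_apply_central hind hT1 hT, hpos, hpos, hpos,
        hpos, ← Nat.cast_add, hpos, ← map_sub]
      rcases Nat.eq_zero_or_pos m with rfl | hm
      · rcases Nat.eq_zero_or_pos n with rfl | hn
        · simp [posAct]
        · simp [posAct, show n ≠ 0 by omega]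
      · rw [if_neg (by omega), zero_smul, add_zero]
        simp [posAct, show m ≠ 0 by omega]
    · rw [hT, hT, hT, map_sub, map_sub, LinearMap.sub_apply, LinearMap.sub_apply, hT, hT,
        leibniz_lie (b : Affine), map_add, ← hq a a', ← hq ⁅(b : Affine), a⁆,
        ← hq a ⁅(b : Affine), a'⁆, map_sub]
      abel
  exact (hS ▸ Submodule.mem_top : q ∈ S) a a'

theorem exists_isLevelRep_of_induced
    (hind : ∀ S : Submodule ℂ W, (∀ u, i u ∈ S) → (∀ b, ∀ q ∈ S, μ b q ∈ S) → S = ⊤)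
    (hT1 : ∀ u a, T (i u) a = μ (negProj a) (i u) + i (topAct ℓ r a u))
    (hT : ∀ (b : negPart) q a, T (μ b q) a = μ b (T q a) - T q ⁅(b : Affine), a⁆) :
    ∃ A : ℤ → Sl2 →ₗ[ℂ] Module.End ℂ W, IsLevelRep ℓ A ∧
      (∀ (n : ℕ) x u, A n x (i u) = i (posAct n x u)) ∧
      ∀ n x (hn : n < 0) q, A n x q = μ ⟨loop n x, loop_mem_negPart hn x⟩ q := by
  let A : ℤ → Sl2 →ₗ[ℂ] (W →ₗ[ℂ] W) := fun n => T.flip ∘ₗ loopₗ n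
  have hA : ∀ n x q, A n x q = T q (loop n x) := fun n x q => rfl
  refine ⟨A, fun m n x y q => ?_, fun n x u => ?_, fun n x hn q => ?_⟩
  · rw [hA, hA, hA, hA, induced_commutator hind hT1 hT, lie_loop_loop, map_add, map_smul,
      induced_apply_central hind hT1 hT, hA]
  · rw [hA, hT1, negProj_loop_nonneg (by omega), topAct_loop_nonneg, map_zero,
      LinearMap.zero_apply, zero_add]
  · exact induced_apply_negPart hind hT1 hT ⟨loop n x, loop_mem_negPart hn x⟩ q

end Induced

/-- The multiplication action of the negative part on the free module. -/
def negMulHom (r : ℕ) : negPart →ₗ⁅ℂ⁆ Module.End ℂ (FreeMod r) where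
  toFun := negMul
  map_add' b b' := by ext q; simp [add_smul]
  map_smul' c b := by ext q; simp
  map_lie' {b b'} := by
    ext q
    simp [LieRing.of_associative_ring_bracket, sub_smul, mul_smul]

/-- The inclusion of the generators into the free module. -/
def freeIncl (r : ℕ) : Irr r →ₗ[ℂ] FreeMod r :=
  TensorProduct.mk ℂ (UniversalEnvelopingAlgebra ℂ negPart) (Irr r) 1

theorem freeMod_eq_top (S : Submodule ℂ (FreeMod r)) (h1 : ∀ u, freeIncl r u ∈ S)
    (h2 : ∀ b, ∀ q ∈ S, negMulHom r b q ∈ S) : S = ⊤ := by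
  refine eq_top_iff.2 fun q _ => ?_
  induction q using freeMod_induction with
  | h1 u => exact h1 u
  | hι b q hq => exact h2 b q (hq trivial)
  | hadd p q hp hq => exact S.add_mem (hp trivial) (hq trivial)
  | hsmul c q hq => exact S.smul_mem c (hq trivial)

theorem genAct_eq (u : Irr r) (a : Affine) : genAct ℓ r u a =
    negMulHom r (negProj a) (freeIncl r u) + freeIncl r (topAct ℓ r a u) := by
  rw [genAct_apply]
  change _ = UniversalEnvelopingAlgebra.ι ℂ (negProj a) • (1 ⊗ₜ u : FreeMod r) + _
  rw [TensorProduct.smul_tmul', smul_eq_mul, mul_one]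
  rfl

/-- The universal property then maps the Verma module to this free module, which is how freeness
over the negative part gets used. -/
theorem exists_level_rep_freeMod (ℓ : ℂ) (r : ℕ) :
    ∃ A : ℤ → Sl2 →ₗ[ℂ] Module.End ℂ (FreeMod r), IsLevelRep ℓ A ∧
      (∀ (n : ℕ) x u, A n x (freeIncl r u) = freeIncl r (posAct n x u)) ∧
      ∀ n x (hn : n < 0) q, A n x q = negMulHom r ⟨loop n x, loop_mem_negPart hn x⟩ q :=
  (exists_affine_act ℓ r).elim fun _ hT =>
    exists_isLevelRep_of_induced freeMod_eq_top
      (fun u a => (LinearMap.congr_fun (hT.1 u) a).trans (genAct_eq u a)) hT.2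

end AffineSl2
end

noncomputable section
namespace AffineSl2

attribute [local instance 100] LieRing.ofAssociativeRing

/-! ### Representations of the current algebra and pairings with Verma modules -/

section Current

variable {X : Type*} [AddCommGroup X] [Module ℂ X]

/-- A family of operators `A n x`, `n ≥ 0`, satisfying the relations of the current algebra
`sl(2, ℂ) ⊗ ℂ[t]`. -/
def IsCurrentRep (A : ℕ → Sl2 →ₗ[ℂ] Module.End ℂ X) : Prop :=
  ∀ (m n : ℕ) (x y : Sl2) (w : X), A m x (A n y w) - A n y (A m x w) = A (m + n) ⁅x, y⁆ w

/-- The transposed action on the dual space of the negative part, extended by zero. -/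
def dualActAux (A : ℕ → Sl2 →ₗ[ℂ] Module.End ℂ X) :
    Affine →ₗ[ℂ] Module.End ℂ (Module.Dual ℂ X) :=
  affLift (fun n => if n < 0 then -(Module.Dual.transpose ∘ₗ A n.natAbs) else 0) 0

theorem dualActAux_loop (A : ℕ → Sl2 →ₗ[ℂ] Module.End ℂ X) {n : ℕ} (hn : 0 < n) (x : Sl2)
    (φ : Module.Dual ℂ X) (w : X) : dualActAux A (loop (-(n : ℤ)) x) φ w = -φ (A n x w) := by
  rw [dualActAux, affLift_loop, if_pos (by omega), Int.natAbs_neg, Int.natAbs_natCast]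
  rfl

/-- The transposed action of the negative part on the dual space. -/
def dualAct {A : ℕ → Sl2 →ₗ[ℂ] Module.End ℂ X} (hA : IsCurrentRep A) :
    negPart →ₗ⁅ℂ⁆ Module.End ℂ (Module.Dual ℂ X) where
  __ := dualActAux A ∘ₗ negPart.toSubmodule.subtype
  map_lie' {a b} := by
    change dualActAux A ⁅(a : Affine), (b : Affine)⁆ =
      dualActAux A a * dualActAux A b - dualActAux A b * dualActAux A a
    induction a using negPart_induction with
    | hadd a a' h h' =>
      rw [negPart_coe_add, add_lie, map_add, h, h', map_add, add_mul, mul_add]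
      abel
    | hsmul c a h =>
      rw [negPart_coe_smul, smul_lie, map_smul, h, map_smul, smul_sub, mul_smul_comm,
        smul_mul_assoc]
    | hl m x hm =>
      induction b using negPart_induction with
      | hadd a a' h h' =>
        rw [negPart_coe_add, lie_add, map_add, h, h', map_add, add_mul, mul_add]
        abel
      | hsmul c a h =>
        rw [negPart_coe_smul, lie_smul, map_smul, h, map_smul, smul_sub, mul_smul_comm,
          smul_mul_assoc]
      | hl n y hn =>
        obtain ⟨m, rfl⟩ : ∃ k : ℕ, m = -(k : ℤ) := ⟨m.natAbs, by omega⟩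
        obtain ⟨n, rfl⟩ : ∃ k : ℕ, n = -(k : ℤ) := ⟨n.natAbs, by omega⟩
        ext φ w
        rw [lie_loop_loop, if_neg (by omega), zero_smul, add_zero, ← neg_add, ← Nat.cast_add,
          dualActAux_loop A (by omega), LinearMap.sub_apply, Module.End.mul_apply,
          Module.End.mul_apply, LinearMap.sub_apply, dualActAux_loop A (by omega),
          dualActAux_loop A (by omega), dualActAux_loop A (by omega),
          dualActAux_loop A (by omega), ← hA m n x y w, map_sub]
        ring

theorem dualAct_loop {A : ℕ → Sl2 →ₗ[ℂ] Module.End ℂ X} (hA : IsCurrentRep A) {n : ℕ} (hn : 0 < n)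
    (x : Sl2) (φ : Module.Dual ℂ X) (w : X) :
    dualAct hA ⟨loop (-(n : ℤ)) x, loop_mem_negPart (by omega) x⟩ φ w = -φ (A n x w) :=
  dualActAux_loop A hn x φ w

/-! ### Duals of Verma modules as coinduced modules. -/

namespace Verma

variable {ℓ : ℂ} {r : ℕ}

/-- A Verma module is freely generated by `M(r)` under the negative part. -/
theorem exists_neg_lift (ℓ : ℂ) {W : Type*} [AddCommGroup W] [Module ℂ W]
    (φ : negPart →ₗ⁅ℂ⁆ Module.End ℂ W) (i : Irr r →ₗ[ℂ] W) :
    ∃ F : Verma ℓ r →ₗ[ℂ] W, (∀ u, F (incl ℓ r u) = i u) ∧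
      ∀ n x (hn : n < 0) v, F ⁅loop n x, v⁆ = φ ⟨loop n x, loop_mem_negPart hn x⟩ (F v) := by
  obtain ⟨B, hB, hB0, hBneg⟩ := exists_level_rep_freeMod ℓ r
  obtain ⟨T, hT0, hT⟩ := exists_lift hB (freeIncl r) hB0
  obtain ⟨G, hG0, hG⟩ := exists_freeMod_lift φ i
  refine ⟨G ∘ₗ T, fun u => ?_, fun n x hn v => ?_⟩
  · rw [LinearMap.comp_apply, hT0]
    exact hG0 u
  · rw [LinearMap.comp_apply, hT, hBneg _ _ hn]
    exact hG _ _

/-- A map to the dual of a Verma module that intertwines the action of the current algebra with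
the transposed action of the nonpositive part. -/
def IsDualHom (A : ℕ → Sl2 →ₗ[ℂ] Module.End ℂ X) (S : X →ₗ[ℂ] Module.Dual ℂ (Verma ℓ r)) : Prop :=
  ∀ (n : ℕ) x w v, S (A n x w) v = -S w ⁅loop (-(n : ℤ)) x, v⁆

/-- The coinduced nature of the dual of a Verma module. -/
theorem exists_isDualHom {A : ℕ → Sl2 →ₗ[ℂ] Module.End ℂ X} (hA : IsCurrentRep A)
    (ψ : X →ₗ[ℂ] Module.Dual ℂ (Irr r)) (hψ : ∀ x w u, ψ (A 0 x w) u = -ψ w ⁅x, u⁆) :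
    ∃ S : X →ₗ[ℂ] Module.Dual ℂ (Verma ℓ r), (∀ w u, S w (incl ℓ r u) = ψ w u) ∧
      IsDualHom A S := by
  -- Exchanging the two arguments turns the wanted map into one from the Verma module to the dual of
  -- `X`, where freeness over the negative part applies.
  obtain ⟨F, hF0, hF⟩ := exists_neg_lift ℓ (dualAct hA) ψ.flip
  have hS0 : ∀ w u, F (incl ℓ r u) w = ψ w u := fun w u => by
    rw [hF0]
    rfl
  have hSneg : ∀ (n : ℕ), 0 < n → ∀ x w v,
      F v (A n x w) = -F ⁅loop (-(n : ℤ)) x, v⁆ w := fun n hn x w v => by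
    rw [hF _ _ (by omega), dualAct_loop hA hn, neg_neg]
  refine ⟨F.flip, hS0, fun n x w v => ?_⟩
  change F v (A n x w) = -F ⁅loop (-(n : ℤ)) x, v⁆ w
  rcases Nat.eq_zero_or_pos n with rfl | hn
  -- Equivariance for n = 0 is not built into `F`; it spreads from M(r), where it is `hψ`, because
  -- bracketing with x(0) preserves the negative part.
  · let P : Submodule ℂ (Verma ℓ r) :=
      { carrier := {v | ∀ x w, F v (A 0 x w) = -F ⁅loop 0 x, v⁆ w}
        add_mem' := fun hv hv' x w => by
          rw [lie_add, map_add, map_add, LinearMap.add_apply, LinearMap.add_apply,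
            hv, hv', neg_add]
        zero_mem' := fun x w => by simp
        smul_mem' := fun c v hv x w => by
          rw [lie_smul, map_smul, map_smul, LinearMap.smul_apply,
            LinearMap.smul_apply, hv, smul_neg] }
    have hP : P = ⊤ := by
      refine eq_top_of_neg_stable (fun u x w => ?_) (fun m hm y v hv x w => ?_)
      · rw [loop_zero_incl, hS0, hS0, hψ]
      · have h1 := hA 0 m x y w
        have h2 : ⁅loop 0 x, ⁅loop (-(m : ℤ)) y, v⁆⁆ =
            ⁅loop (-(m : ℤ)) ⁅x, y⁆, v⁆ + ⁅loop (-(m : ℤ)) y, ⁅loop 0 x, v⁆⁆ := by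
          rw [leibniz_lie, lie_loop_loop, if_neg (by omega), zero_smul, add_zero, zero_add]
        have h3 := congrArg (F v) h1
        rw [map_sub, zero_add] at h3
        rw [h2, map_add, LinearMap.add_apply]
        linear_combination hSneg m hm y (A 0 x w) v + hSneg m hm ⁅x, y⁆ w v +
          hSneg m hm y w ⁅loop 0 x, v⁆ - hv x (A m y w) + h3
    have : v ∈ P := hP ▸ Submodule.mem_top
    simpa using this x w
  · exact hSneg n hn x w v

/-- The uniqueness half of coinduction: M(r) generates under the x(-n), and these can be moved to
the other argument. -/
theorem IsDualHom.eq_zero {A : ℕ → Sl2 →ₗ[ℂ] Module.End ℂ X}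
    {S : X →ₗ[ℂ] Module.Dual ℂ (Verma ℓ r)} (hS : IsDualHom A S)
    (h0 : ∀ w u, S w (incl ℓ r u) = 0) : S = 0 := by
  let P : Submodule ℂ (Verma ℓ r) :=
    { carrier := {v | ∀ w, S w v = 0}
      add_mem' := fun hv hv' w => by rw [map_add, hv, hv', add_zero]
      zero_mem' := fun w => map_zero _
      smul_mem' := fun c v hv w => by rw [map_smul, hv, smul_zero] }
  have hP : P = ⊤ := by
    refine eq_top_of_neg_stable (fun u w => h0 w u) (fun m hm y v hv w => ?_)
    rw [← neg_eq_iff_eq_neg.2 (hS m y w v), hv, neg_zero]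
  ext w v
  exact (hP ▸ Submodule.mem_top : v ∈ P) w

theorem IsDualHom.sub {A : ℕ → Sl2 →ₗ[ℂ] Module.End ℂ X}
    {S S' : X →ₗ[ℂ] Module.Dual ℂ (Verma ℓ r)} (hS : IsDualHom A S) (hS' : IsDualHom A S') :
    IsDualHom A (S - S') := fun n x w v => by
  rw [LinearMap.sub_apply, LinearMap.sub_apply, LinearMap.sub_apply, LinearMap.sub_apply, hS, hS']
  ring

theorem IsDualHom.ext {A : ℕ → Sl2 →ₗ[ℂ] Module.End ℂ X}
    {S S' : X →ₗ[ℂ] Module.Dual ℂ (Verma ℓ r)} (hS : IsDualHom A S) (hS' : IsDualHom A S')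
    (h0 : ∀ w u, S w (incl ℓ r u) = S' w (incl ℓ r u)) : S = S' :=
  sub_eq_zero.1 ((hS.sub hS').eq_zero fun w u => sub_eq_zero.2 (h0 w u))

/-- Coinducing the identity of M(r)*, with the positive part acting by zero, extends every
functional on M(r) to the Verma module. -/
theorem incl_injective (ℓ : ℂ) (r : ℕ) : Function.Injective (incl ℓ r) := by
  let D : Sl2 →ₗ[ℂ] Module.End ℂ (Module.Dual ℂ (Irr r)) :=
    -(Module.Dual.transpose ∘ₗ (LieModule.toEnd ℂ Sl2 (Irr r) : Sl2 →ₗ[ℂ] _))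
  have hD : ∀ x φ u, D x φ u = -φ ⁅x, u⁆ := fun x φ u => rfl
  let A : ℕ → Sl2 →ₗ[ℂ] Module.End ℂ (Module.Dual ℂ (Irr r)) := fun n => if n = 0 then D else 0
  have hA : IsCurrentRep A := by
    intro m n x y φ
    rcases Nat.eq_zero_or_pos m with rfl | hm
    · rcases Nat.eq_zero_or_pos n with rfl | hn
      · ext u
        simp only [A, if_true, LinearMap.sub_apply, hD, lie_lie, map_sub]
        ring
      · simp [A, show n ≠ 0 by omega]
    · simp [A, show m ≠ 0 by omega]
  obtain ⟨S, hS, -⟩ := exists_isDualHom (ℓ := ℓ) hA LinearMap.id fun x φ u => hD x φ u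
  rw [← LinearMap.ker_eq_bot, LinearMap.ker_eq_bot']
  intro u hu
  rw [← Module.forall_dual_apply_eq_zero_iff ℂ]
  intro φ
  have := hS φ u
  rw [hu, map_zero] at this
  exact this.symm

/-! ### The grading of a Verma module -/

/-- The action `(x(n) y)_d = x(n) y_{d + n}` on families of vectors. -/
def famAct (ℓ : ℂ) (r : ℕ) (n : ℤ) : Sl2 →ₗ[ℂ] Module.End ℂ (ℤ → Verma ℓ r) where
  toFun x :=
    { toFun := fun y d => ⁅loop n x, y (d + n)⁆
      map_add' := fun y z => by ext d; simp
      map_smul' := fun c y => by ext d; simp }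
  map_add' x x' := by ext y d; simp [loop_add]
  map_smul' c x := by ext y d; simp [loop_smul]

@[simp] theorem famAct_apply (n : ℤ) (x : Sl2) (y : ℤ → Verma ℓ r) (d : ℤ) :
    famAct ℓ r n x y d = ⁅loop n x, y (d + n)⁆ := rfl

theorem famAct_isLevelRep : IsLevelRep ℓ (famAct ℓ r) := fun m n x y w => by
  ext d
  have h := act_isLevelRep m n x y (w (d + m + n))
  simp only [act_apply] at h
  simp only [Pi.sub_apply, famAct_apply, Pi.add_apply, Pi.smul_apply]
  rw [show d + n + m = d + m + n by ring, show d + (m + n) = d + m + n by ring, h]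
  split_ifs with hmn
  · rw [show d + m + n = d by omega]
  · simp


/-- Families with shifted indices form a representation of the same level, so sending M(r) to
families concentrated in degree 0 extends to the map taking a vector to its family of components.
This shows that the spans `grade` are independent. -/
theorem exists_homogeneous_components (ℓ : ℂ) (r : ℕ) :
    ∃ T : Verma ℓ r →ₗ[ℂ] (ℤ → Verma ℓ r), (∀ u, T (incl ℓ r u) = Pi.single 0 (incl ℓ r u)) ∧
      ∀ n x v, T ⁅loop n x, v⁆ = famAct ℓ r n x (T v) := by
  refine exists_lift famAct_isLevelRep
    ((LinearMap.single ℂ (fun _ : ℤ => Verma ℓ r) 0) ∘ₗ incl ℓ r) fun n x u => ?_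
  ext d
  simp only [famAct_apply, LinearMap.comp_apply, LinearMap.coe_single]
  rcases Nat.eq_zero_or_pos n with rfl | hn
  · rw [Nat.cast_zero, add_zero]
    rcases eq_or_ne d 0 with rfl | hd
    · rw [Pi.single_eq_same, Pi.single_eq_same]; exact loop_incl 0 x u
    · rw [Pi.single_eq_of_ne hd, Pi.single_eq_of_ne hd, lie_zero]
  · rw [posAct, if_neg (by omega), map_zero, Pi.single_zero, Pi.zero_apply]
    rcases eq_or_ne (d + n) 0 with hd | hd
    · rw [hd, Pi.single_eq_same]; exact loop_pos_incl (by omega) x u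
    · rw [Pi.single_eq_of_ne hd, lie_zero]

/-- The homogeneous component of degree `d`. -/
def comp (ℓ : ℂ) (r : ℕ) (d : ℤ) : Module.End ℂ (Verma ℓ r) :=
  LinearMap.proj d ∘ₗ (exists_homogeneous_components ℓ r).choose

theorem comp_incl (d : ℤ) (u : Irr r) :
    comp ℓ r d (incl ℓ r u) = if d = 0 then incl ℓ r u else 0 := by
  have h := (exists_homogeneous_components ℓ r).choose_spec.1 u
  rw [comp, LinearMap.comp_apply, h, LinearMap.proj_apply, Pi.single_apply]

theorem comp_loop (d n : ℤ) (x : Sl2) (v : Verma ℓ r) :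
    comp ℓ r d ⁅loop n x, v⁆ = ⁅loop n x, comp ℓ r (d + n) v⁆ := by
  have h := (exists_homogeneous_components ℓ r).choose_spec.2 n x v
  rw [comp, LinearMap.comp_apply, h]
  rfl

theorem grade_eq (d : ℤ) : grade ℓ r d = Submodule.span ℂ {w | ∃ (s : List (Sl2 × ℕ)) (u : Irr r),
    (∀ a ∈ s, 0 < a.2) ∧ (s.map fun a => (a.2 : ℤ)).sum = d ∧ w = mono s u} := rfl

theorem comp_mono (s : List (Sl2 × ℕ)) (u : Irr r) (d : ℤ) :
    comp ℓ r d (mono s u) =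
      if d = (s.map fun a => (a.2 : ℤ)).sum then mono s u else 0 := by
  induction s generalizing d with
  | nil => exact comp_incl d u
  | cons a s ih =>
    change comp ℓ r d ⁅loop (-(a.2 : ℤ)) a.1, (mono s u : Verma ℓ r)⁆ = _
    rw [comp_loop, ih, List.map_cons, List.sum_cons]
    by_cases h : d = a.2 + (s.map fun a => (a.2 : ℤ)).sum
    · rw [if_pos h, if_pos (by omega)]; rfl
    · rw [if_neg h, if_neg (by omega), lie_zero]

theorem comp_of_mem_grade {d : ℤ} {v : Verma ℓ r} (hv : v ∈ grade ℓ r d) (e : ℤ) :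
    comp ℓ r e v = if e = d then v else 0 := by
  rw [grade_eq] at hv
  induction hv using Submodule.span_induction with
  | zero => simp
  | add v w _ _ hv hw => rw [map_add, hv, hw]; split_ifs <;> simp
  | smul c v _ hv => rw [map_smul, hv]; split_ifs <;> simp
  | mem v hv =>
    obtain ⟨s, u, -, rfl, rfl⟩ := hv
    exact comp_mono s u e

theorem incl_mem_grade (u : Irr r) : incl ℓ r u ∈ grade ℓ r 0 :=
  Submodule.subset_span ⟨[], u, by simp, by simp, rfl⟩

theorem loop_neg_mem_grade {n : ℕ} (hn : 0 < n) (x : Sl2) {d : ℤ} {v : Verma ℓ r}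
    (hv : v ∈ grade ℓ r d) : ⁅loop (-(n : ℤ)) x, v⁆ ∈ grade ℓ r (d + n) := by
  rw [grade_eq] at hv
  induction hv using Submodule.span_induction with
  | zero => rw [lie_zero]; exact Submodule.zero_mem _
  | add v w _ _ hv hw => rw [lie_add]; exact Submodule.add_mem _ hv hw
  | smul c v _ hv => rw [lie_smul]; exact Submodule.smul_mem _ c hv
  | mem v hv =>
    obtain ⟨s, u, hs, hd, rfl⟩ := hv
    refine Submodule.subset_span ⟨(x, n) :: s, u, ?_, ?_, rfl⟩
    · simpa [hn] using fun a b hab => hs (a, b) hab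
    · simp [hd, add_comm]

theorem comp_mem_grade (d : ℤ) (v : Verma ℓ r) : comp ℓ r d v ∈ grade ℓ r d := by
  let P : Submodule ℂ (Verma ℓ r) :=
    { carrier := {v | ∀ d, comp ℓ r d v ∈ grade ℓ r d}
      add_mem' := fun hv hv' d => by rw [map_add]; exact Submodule.add_mem _ (hv d) (hv' d)
      zero_mem' := fun d => by rw [map_zero]; exact Submodule.zero_mem _
      smul_mem' := fun c v hv d => by rw [map_smul]; exact Submodule.smul_mem _ c (hv d) }
  have hP : P = ⊤ := by
    refine eq_top_of_neg_stable (fun u d => ?_) (fun n hn x v hv d => ?_)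
    · rw [comp_incl]
      split_ifs with h
      · exact h ▸ incl_mem_grade u
      · exact Submodule.zero_mem _
    · rw [comp_loop]
      have := loop_neg_mem_grade hn x (hv (d + -n))
      rwa [neg_add_cancel_right] at this
  exact (hP ▸ Submodule.mem_top : v ∈ P) d

theorem mem_grade_iff {d : ℤ} {v : Verma ℓ r} : v ∈ grade ℓ r d ↔ comp ℓ r d v = v :=
  ⟨fun h => by rw [comp_of_mem_grade h, if_pos rfl], fun h => h ▸ comp_mem_grade d v⟩

theorem comp_comp (d e : ℤ) (v : Verma ℓ r) :
    comp ℓ r e (comp ℓ r d v) = if e = d then comp ℓ r d v else 0 :=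
  comp_of_mem_grade (comp_mem_grade d v) e

theorem loop_mem_grade (n : ℤ) (x : Sl2) {d : ℤ} {v : Verma ℓ r} (hv : v ∈ grade ℓ r d) :
    ⁅loop n x, v⁆ ∈ grade ℓ r (d - n) := by
  rw [mem_grade_iff, comp_loop, sub_add_cancel, mem_grade_iff.1 hv]

theorem exists_eq_sum_comp (v : Verma ℓ r) : ∃ s : Finset ℤ, v = ∑ d ∈ s, comp ℓ r d v := by
  let P : Submodule ℂ (Verma ℓ r) :=
    -- Allowing every larger index set lets the supports of two summands be merged.
    { carrier := {v | ∃ s : Finset ℤ, ∀ t, s ⊆ t → v = ∑ d ∈ t, comp ℓ r d v}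
      add_mem' := by
        rintro v w ⟨s, hs⟩ ⟨t, ht⟩
        refine ⟨s ∪ t, fun a ha => ?_⟩
        simp only [map_add, Finset.sum_add_distrib]
        rw [← hs a (Finset.union_subset_left ha), ← ht a (Finset.union_subset_right ha)]
      zero_mem' := ⟨∅, fun t _ => by simp⟩
      smul_mem' := by
        rintro c v ⟨s, hs⟩
        refine ⟨s, fun t ht => ?_⟩
        simp only [map_smul]
        rw [← Finset.smul_sum, ← hs t ht] }
  have hP : P = ⊤ := by
    refine eq_top_of_neg_stable (fun u => ?_) (fun n hn x v hv => ?_)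
    · refine ⟨{0}, fun t ht => ?_⟩
      simp only [comp_incl]
      rw [Finset.sum_ite_eq', if_pos (ht (by simp))]
    · obtain ⟨s, hs⟩ := hv
      refine ⟨s.map (addRightEmbedding (n : ℤ)), fun t ht => ?_⟩
      have h1 : t = (t.map (addRightEmbedding (-n : ℤ))).map (addRightEmbedding (n : ℤ)) := by
        ext a; simp
      have h2 : s ⊆ t.map (addRightEmbedding (-n : ℤ)) := fun a ha =>
        Finset.mem_map.2 ⟨a + n, ht (Finset.mem_map_of_mem _ ha), by simp⟩
      rw [h1, Finset.sum_map]
      simp only [addRightEmbedding_apply, comp_loop, add_neg_cancel_right]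
      conv_lhs => rw [hs _ h2]
      rw [lie_sum]
  obtain ⟨s, hs⟩ := (hP ▸ Submodule.mem_top : v ∈ P)
  exact ⟨s, hs s subset_rfl⟩

theorem ext_comp {v w : Verma ℓ r} (h : ∀ d, comp ℓ r d v = comp ℓ r d w) : v = w := by
  rw [← sub_eq_zero]
  obtain ⟨s, hs⟩ := exists_eq_sum_comp (v - w)
  rw [hs]
  exact Finset.sum_eq_zero fun d _ => by rw [map_sub, h, sub_self]

theorem sum_degrees_nonneg (s : List (Sl2 × ℕ)) : 0 ≤ (s.map fun a => (a.2 : ℤ)).sum := by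
  refine List.sum_nonneg fun d hd => ?_
  obtain ⟨a, -, rfl⟩ := List.mem_map.1 hd
  exact Int.natCast_nonneg _

theorem grade_zero_eq : grade ℓ r 0 = LinearMap.range (incl ℓ r) := by
  refine le_antisymm (Submodule.span_le.2 ?_) ?_
  · rintro _ ⟨s, u, hs, hd, rfl⟩
    cases s with
    | nil => exact ⟨u, rfl⟩
    | cons a s =>
      exfalso
      have h1 : 0 < a.2 := hs a (by simp)
      have h2 : 0 ≤ (s.map fun a => (a.2 : ℤ)).sum := sum_degrees_nonneg s
      rw [List.map_cons, List.sum_cons] at hd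
      omega
  · rintro _ ⟨u, rfl⟩
    exact incl_mem_grade u

theorem grade_of_neg {d : ℤ} (hd : d < 0) : grade ℓ r d = ⊥ := by
  rw [eq_bot_iff]
  refine Submodule.span_le.2 ?_
  rintro _ ⟨s, u, hs, rfl, rfl⟩
  have h2 : 0 ≤ (s.map fun a => (a.2 : ℤ)).sum := sum_degrees_nonneg s
  omega

instance : Module.Finite ℂ (Irr r) := inferInstanceAs (Module.Finite ℂ (Fin (r + 1) → ℂ))

theorem grade_fg (d : ℕ) : (grade ℓ r d).FG := by
  induction d using Nat.strong_induction_on with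
  | _ d ih =>
    have hle : grade ℓ r d ≤ LinearMap.range (incl ℓ r) ⊔
        ⨆ n ∈ Finset.Icc 1 d, Submodule.map₂ (act ℓ r (-(n : ℤ))) ⊤ (grade ℓ r ((d - n : ℕ) : ℤ)) := by
      refine Submodule.span_le.2 ?_
      rintro _ ⟨s, u, hs, hd, rfl⟩
      cases s with
      | nil => exact Submodule.mem_sup_left ⟨u, rfl⟩
      | cons a s =>
        have h1 : 0 < a.2 := hs a (by simp)
        have h2 : 0 ≤ (s.map fun a => (a.2 : ℤ)).sum := sum_degrees_nonneg s
        rw [List.map_cons, List.sum_cons] at hd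
        refine Submodule.mem_sup_right (Submodule.mem_iSup_of_mem a.2
          (Submodule.mem_iSup_of_mem (Finset.mem_Icc.2 ⟨h1, by omega⟩) ?_))
        refine Submodule.apply_mem_map₂ (act ℓ r (-(a.2 : ℤ))) (Submodule.mem_top (x := a.1))
          (Submodule.subset_span ⟨s, u, fun b hb => hs b (by simp [hb]), ?_, rfl⟩)
        omega
    refine Submodule.FG.of_le ?_ hle
    refine Submodule.FG.sup ?_ (Submodule.fg_biSup _ _ fun n hn => ?_)
    · exact Module.Finite.iff_fg.1 (Module.Finite.range _)
    · rw [Finset.mem_Icc] at hn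
      exact Submodule.FG.map₂ _ Module.Finite.fg_top (ih _ (by omega))

instance (d : ℤ) : FiniteDimensional ℂ (grade ℓ r d) := by
  rcases lt_or_ge d 0 with hd | hd
  · rw [grade_of_neg hd]; infer_instance
  · lift d to ℕ using hd
    exact Module.Finite.iff_fg.2 (grade_fg d)

/-! ### Submodules stable under a rescaling of the grading -/

/-- The substitution t ↦ 2t preserves the affine relations and induces `τ`. Since the powers of 2
are distinct, its eigenspaces are the graded pieces, so `τ`-stable subspaces are graded. -/
theorem exists_rescaling (ℓ : ℂ) (r : ℕ) : ∃ τ : Module.End ℂ (Verma ℓ r),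
    (∀ n x v, τ ⁅loop n x, v⁆ = (2 : ℂ) ^ n • ⁅loop n x, τ v⁆) ∧
      ∀ d v, comp ℓ r d (τ v) = (2 : ℂ) ^ (-d) • comp ℓ r d v := by
  have hA : IsLevelRep ℓ fun n => (2 : ℂ) ^ n • act ℓ r n := fun m n x y w => by
    have h := act_isLevelRep m n x y w
    simp only [LinearMap.smul_apply, map_smul, smul_smul, ← zpow_add₀ (two_ne_zero (α := ℂ))]
    rw [add_comm n m, ← smul_sub, h, smul_add]
    congr 1
    split_ifs with hmn
    · rw [hmn, zpow_zero, one_smul]; simp [smul_smul]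
    · simp
  obtain ⟨τ, h0, hτ⟩ := exists_lift hA (incl ℓ r) fun n x u => by
    rw [LinearMap.smul_apply, LinearMap.smul_apply, act_apply, loop_incl]
    rcases Nat.eq_zero_or_pos n with rfl | hn
    · simp
    · simp [posAct, show n ≠ 0 by omega]
  refine ⟨τ, hτ, fun d v => ?_⟩
  let P : Submodule ℂ (Verma ℓ r) :=
    { carrier := {v | ∀ d, comp ℓ r d (τ v) = (2 : ℂ) ^ (-d) • comp ℓ r d v}
      add_mem' := fun hv hv' d => by rw [map_add, map_add, map_add, hv, hv', smul_add]
      zero_mem' := fun d => by simp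
      smul_mem' := fun c v hv d => by rw [map_smul, map_smul, map_smul, hv, smul_comm] }
  have hP : P = ⊤ := by
    refine eq_top_of_neg_stable (fun u d => ?_) (fun n hn x v hv d => ?_)
    · rw [h0, comp_incl]
      split_ifs with h
      · simp [h]
      · simp
    · rw [hτ, LinearMap.smul_apply, LinearMap.smul_apply, act_apply, map_smul, comp_loop, comp_loop,
        hv, lie_smul, smul_smul, ← zpow_add₀ (two_ne_zero (α := ℂ))]
      congr 2
      ring
  exact (hP ▸ Submodule.mem_top : v ∈ P) d

/-- Induction on the support: `τ v - 2 ^ (-a) • v` loses the component of degree a and rescales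
every other one by a nonzero factor. -/
theorem comp_mem_of_rescaling {τ : Module.End ℂ (Verma ℓ r)}
    (hτ : ∀ d v, comp ℓ r d (τ v) = (2 : ℂ) ^ (-d) • comp ℓ r d v)
    {N : Submodule ℂ (Verma ℓ r)} (hN : ∀ v ∈ N, τ v ∈ N) {v : Verma ℓ r} (hv : v ∈ N) (d : ℤ) :
    comp ℓ r d v ∈ N := by
  have key : ∀ (s : Finset ℤ) (v : Verma ℓ r), v ∈ N → (∀ d, d ∉ s → comp ℓ r d v = 0) →
      ∀ d, comp ℓ r d v ∈ N := by
    intro s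
    induction s using Finset.induction_on with
    | empty => exact fun v _ h d => h d (by simp) ▸ N.zero_mem
    | insert a s ha ih =>
      intro v hv h
      have hs : ∀ d, d ≠ a → comp ℓ r d v ∈ N := by
        intro d hd
        have h1 : ∀ d, comp ℓ r d (τ v - (2 : ℂ) ^ (-a) • v) =
            ((2 : ℂ) ^ (-d) - (2 : ℂ) ^ (-a)) • comp ℓ r d v := fun d => by
          rw [map_sub, hτ, map_smul, sub_smul]
        have h2 := ih (τ v - (2 : ℂ) ^ (-a) • v) (N.sub_mem (hN v hv) (N.smul_mem _ hv))
          (fun e he => by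
            rw [h1]
            rcases eq_or_ne e a with rfl | hea
            · rw [sub_self, zero_smul]
            · rw [h e (by simp [he, hea]), smul_zero]) d
        rw [h1] at h2
        refine (N.smul_mem_iff ?_).1 h2
        rw [sub_ne_zero]
        intro h3
        have h4 : (2 : ℝ) ^ (-d) = (2 : ℝ) ^ (-a) := by
          simpa [norm_zpow] using congrArg (fun z : ℂ => ‖z‖) h3
        have := zpow_right_injective₀ (by norm_num : (0 : ℝ) < 2) (by norm_num) h4
        omega
      intro d
      rcases eq_or_ne d a with rfl | hda
      · have h5 : comp ℓ r d v = v - ∑ e ∈ s, comp ℓ r e v := by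
          refine ext_comp fun e => ?_
          rw [comp_comp, map_sub, map_sum]
          simp only [comp_comp]
          rw [Finset.sum_ite_eq]
          by_cases hes : e ∈ s
          · rw [if_pos hes, sub_self, if_neg (ne_of_mem_of_not_mem hes ha)]
          · rw [if_neg hes, sub_zero]
            split_ifs with hed
            · rw [hed]
            · rw [h e (by simp [hes, hed])]
        rw [h5]
        exact N.sub_mem hv (N.sum_mem fun e he => hs e (ne_of_mem_of_not_mem he ha))
      · exact hs d hda
  obtain ⟨s, hs⟩ := exists_eq_sum_comp v
  refine key s v hv (fun d hd => ?_) d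
  rw [hs, map_sum]
  simp only [comp_comp]
  rw [Finset.sum_ite_eq, if_neg hd]

end Verma
end Current
end AffineSl2
end

noncomputable section
namespace AffineSl2

/-! ### Finite-dimensional representations of `sl(2, ℂ)` -/

/-- The element `e` of the standard basis. -/
def sE : Sl2 := ⟨!![0, 1; 0, 0], by
  change Matrix.trace (_ : Matrix (Fin 2) (Fin 2) ℂ) = 0
  simp [Matrix.trace_fin_two]⟩

/-- The element `f` of the standard basis. -/
def sF : Sl2 := ⟨!![0, 0; 1, 0], by
  change Matrix.trace (_ : Matrix (Fin 2) (Fin 2) ℂ) = 0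
  simp [Matrix.trace_fin_two]⟩

/-- The element `h` of the standard basis. -/
def sH : Sl2 := ⟨!![1, 0; 0, -1], by
  change Matrix.trace (_ : Matrix (Fin 2) (Fin 2) ℂ) = 0
  simp [Matrix.trace_fin_two]⟩

theorem sl2_eq (x : Sl2) : x = x.1 0 0 • sH + x.1 0 1 • sE + x.1 1 0 • sF := by
  have h := sl2_apply_one_one x
  apply Subtype.ext
  change x.1 = x.1 0 0 • sH.1 + x.1 0 1 • sE.1 + x.1 1 0 • sF.1
  ext i j
  fin_cases i <;> fin_cases j <;> simp [sH, sE, sF, h]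

theorem lie_sE_sF : ⁅sE, sF⁆ = sH := by
  apply Subtype.ext
  rw [LieAlgebra.SpecialLinear.sl_bracket]
  ext i j
  fin_cases i <;> fin_cases j <;> simp [sH, sE, sF]

theorem lie_sH_sE : ⁅sH, sE⁆ = (2 : ℂ) • sE := by
  apply Subtype.ext
  rw [LieAlgebra.SpecialLinear.sl_bracket]
  change _ = (2 : ℂ) • sE.1
  ext i j
  fin_cases i <;> fin_cases j <;> norm_num [sH, sE, sF, Matrix.mul_apply]

theorem lie_sH_sF : ⁅sH, sF⁆ = (-2 : ℂ) • sF := by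
  apply Subtype.ext
  rw [LieAlgebra.SpecialLinear.sl_bracket]
  change _ = (-2 : ℂ) • sF.1
  ext i j
  fin_cases i <;> fin_cases j <;> norm_num [sH, sE, sF, Matrix.mul_apply]

theorem isSl2Triple : IsSl2Triple sH sE sF where
  h_ne_zero h := by
    have := congrArg (fun x : Sl2 => x.1 0 0) h
    simp [sH] at this
  lie_e_f := lie_sE_sF
  lie_h_e_nsmul := by rw [lie_sH_sE, two_smul, two_nsmul]
  lie_h_f_nsmul := by rw [lie_sH_sF, neg_smul, two_smul, two_nsmul]

theorem lie_sE_sF_apply {W : Type*} [AddCommGroup W] [LieRingModule Sl2 W] (w : W) :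
    ⁅sE, ⁅sF, w⁆⁆ = ⁅sF, ⁅sE, w⁆⁆ + ⁅sH, w⁆ := by
  rw [leibniz_lie, lie_sE_sF, add_comm]

/-! ### Homomorphisms to M(n) from functionals. -/

section Modules

variable {W : Type*} [AddCommGroup W] [Module ℂ W] [LieRingModule Sl2 W] [LieModule ℂ Sl2 W]

theorem lie_eq_combination (x : Sl2) (w : W) :
    ⁅x, w⁆ = x.1 0 0 • ⁅sH, w⁆ + x.1 0 1 • ⁅sE, w⁆ + x.1 1 0 • ⁅sF, w⁆ := by
  conv_lhs => rw [sl2_eq x]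
  simp

theorem lie_sE_sH_apply (w : W) : ⁅sE, ⁅sH, w⁆⁆ = ⁅sH, ⁅sE, w⁆⁆ - (2 : ℂ) • ⁅sE, w⁆ := by
  rw [leibniz_lie sH, lie_sH_sE, smul_lie]; abel

theorem lie_sF_sH_apply (w : W) : ⁅sF, ⁅sH, w⁆⁆ = ⁅sH, ⁅sF, w⁆⁆ + (2 : ℂ) • ⁅sF, w⁆ := by
  rw [leibniz_lie sH, lie_sH_sF, smul_lie, neg_smul]; abel

/-- The functionals `w ↦ φ (eⁱ w) / i!`. -/
def raised (φ : Module.Dual ℂ W) : ℕ → Module.Dual ℂ W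
  | 0 => φ
  | i + 1 => ((i : ℂ) + 1)⁻¹ • (raised φ i ∘ₗ LieModule.toEnd ℂ Sl2 W sE)

theorem raised_zero (φ : Module.Dual ℂ W) : raised φ 0 = φ := rfl

theorem raised_succ (φ : Module.Dual ℂ W) (i : ℕ) (w : W) :
    raised φ (i + 1) w = ((i : ℂ) + 1)⁻¹ * raised φ i ⁅sE, w⁆ := rfl

theorem raised_sE (φ : Module.Dual ℂ W) (i : ℕ) (w : W) :
    raised φ i ⁅sE, w⁆ = ((i : ℂ) + 1) * raised φ (i + 1) w := by
  have : (i : ℂ) + 1 ≠ 0 := Nat.cast_add_one_ne_zero i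
  rw [raised_succ]
  field_simp

theorem raised_sH {φ : Module.Dual ℂ W} {c : ℂ} (hH : ∀ w, φ ⁅sH, w⁆ = c * φ w) (i : ℕ) (w : W) :
    raised φ i ⁅sH, w⁆ = (c - 2 * i) * raised φ i w := by
  induction i generalizing w with
  | zero => simpa [raised_zero] using hH w
  | succ i ih =>
    rw [raised_succ, raised_succ, lie_sE_sH_apply, map_sub, map_smul, ih, smul_eq_mul]
    push_cast
    ring

theorem raised_zero_sF {φ : Module.Dual ℂ W} (hF : ∀ w, φ ⁅sF, w⁆ = 0) (w : W) :
    raised φ 0 ⁅sF, w⁆ = 0 := hF w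

theorem raised_succ_sF {φ : Module.Dual ℂ W} {c : ℂ} (hH : ∀ w, φ ⁅sH, w⁆ = c * φ w)
    (hF : ∀ w, φ ⁅sF, w⁆ = 0) (i : ℕ) (w : W) :
    raised φ (i + 1) ⁅sF, w⁆ = (c - i) * raised φ i w := by
  induction i generalizing w with
  | zero =>
    rw [raised_succ, raised_zero, lie_sE_sF_apply, map_add, hF, hH]
    simp
  | succ i ih =>
    have h1 : (i : ℂ) + 1 ≠ 0 := Nat.cast_add_one_ne_zero i
    have h2 : (i : ℂ) + 1 + 1 ≠ 0 := by exact_mod_cast Nat.cast_add_one_ne_zero (R := ℂ) (i + 1)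
    rw [raised_succ, lie_sE_sF_apply, map_add, ih, raised_sH hH, raised_sE]
    push_cast
    field_simp
    ring

theorem raised_eq_pow_toEnd (φ : Module.Dual ℂ W) (i : ℕ) (w : W) :
    (LieModule.toEnd ℂ Sl2 (Module.Dual ℂ W) sE ^ i) φ w =
      (-1) ^ i * (i.factorial : ℂ) * raised φ i w := by
  induction i generalizing w with
  | zero => simp [raised_zero]
  | succ i ih =>
    rw [pow_succ', Module.End.mul_apply, LieModule.toEnd_apply_apply, Module.Dual.lie_apply, ih,
      raised_sE, Nat.factorial_succ]
    push_cast
    ring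

/-- In the dual module `φ`, if nonzero, is primitive of weight n for the opposite triple, so finite
dimension gives e^(n+1) φ = 0. -/
theorem raised_eq_zero [FiniteDimensional ℂ W] {φ : Module.Dual ℂ W} {n : ℕ}
    (hH : ∀ w, φ ⁅sH, w⁆ = n * φ w) (hF : ∀ w, φ ⁅sF, w⁆ = 0) {i : ℕ} (hi : n < i) :
    raised φ i = 0 := by
  have key : raised φ (n + 1) = 0 := by
    rcases eq_or_ne φ 0 with rfl | hφ
    · ext w
      have := raised_eq_pow_toEnd (0 : Module.Dual ℂ W) (n + 1) w
      rw [map_zero, LinearMap.zero_apply, eq_comm, mul_eq_zero] at this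
      exact this.resolve_left (by simp [Nat.factorial_ne_zero])
    · have hP : isSl2Triple.symm.HasPrimitiveVectorWith φ (n : ℂ) :=
        { ne_zero := hφ
          lie_h := by
            ext w
            rw [neg_lie, LinearMap.neg_apply, Module.Dual.lie_apply, neg_neg, hH]
            rfl
          lie_e := by
            ext w
            rw [Module.Dual.lie_apply, hF, neg_zero, LinearMap.zero_apply] }
      have h := hP.pow_toEnd_f_eq_zero_of_eq_nat rfl
      ext w
      have := raised_eq_pow_toEnd φ (n + 1) w
      rw [h, LinearMap.zero_apply, eq_comm, mul_eq_zero] at this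
      exact this.resolve_left (by simp [Nat.factorial_ne_zero])
  obtain ⟨k, rfl⟩ := Nat.exists_eq_add_of_lt hi
  induction k with
  | zero => exact key
  | succ k ih =>
    ext w
    rw [show n + (k + 1) + 1 = n + k + 1 + 1 by ring, raised_succ, ih (by omega)]
    simp

theorem coord_mk {n : ℕ} {a : ℕ → ℂ} (ha : ∀ i, n < i → a i = 0) (i : ℕ) :
    Irr.coord (n := n) (fun k => a k) i = a i := by
  unfold Irr.coord
  split_ifs with h
  · simp
  · exact (ha i (by omega)).symm

theorem Irr.coord_lie {n : ℕ} (x : Sl2) (v : Irr n) (i : ℤ) :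
    ⁅x, v⁆.coord i = x.1 0 0 * ((n : ℂ) - 2 * i) * v.coord i
      + x.1 0 1 * (i + 1) * v.coord (i + 1) + x.1 1 0 * ((n : ℂ) - i + 1) * v.coord (i - 1) :=
  coord_act _ _ _ _ _

/-- A functional that is a highest weight vector in the dual gives a homomorphism to `M(n)`. -/
theorem exists_hom_to_irr [FiniteDimensional ℂ W] {φ : Module.Dual ℂ W} {n : ℕ}
    (hH : ∀ w, φ ⁅sH, w⁆ = n * φ w) (hF : ∀ w, φ ⁅sF, w⁆ = 0) :
    ∃ T : W →ₗ⁅ℂ, Sl2⁆ Irr n, ∀ w (i : ℕ), (T w).coord i = raised φ i w := by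
  -- In the chosen basis e vᵢ = i vᵢ₋₁, so the coordinate at v₀ of eⁱ v is i! times the i-th
  -- coordinate of v; this dictates the functionals φ(eⁱ w)/i!.
  let T₀ : W →ₗ[ℂ] Irr n :=
    { toFun := fun w k => raised φ k w
      map_add' := fun v w => by funext k; exact map_add _ _ _
      map_smul' := fun c w => by funext k; exact map_smul _ _ _ }
  have hT : ∀ w (i : ℕ), (T₀ w).coord i = raised φ i w := fun w i =>
    coord_mk (a := fun k => raised φ k w)
      (fun i hi => by rw [raised_eq_zero hH hF hi, LinearMap.zero_apply]) i
  refine ⟨{ T₀ with map_lie' := fun {x w} => Irr.ext_coord fun i => ?_ }, hT⟩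
  change (T₀ ⁅x, w⁆).coord i = ⁅x, T₀ w⁆.coord i
  rcases lt_or_ge i 0 with hi | hi
  · rw [Irr.coord_of_lt hi, Irr.coord_of_lt hi]
  lift i to ℕ using hi
  rw [Irr.coord_lie, hT, lie_eq_combination, map_add, map_add, map_smul, map_smul, map_smul,
    raised_sE, raised_sH hH, hT, show ((i : ℤ) + 1) = ((i + 1 : ℕ) : ℤ) by simp, hT]
  cases i with
  | zero =>
    rw [raised_zero_sF hF, Irr.coord_of_lt (by simp)]
    simp [mul_assoc]
  | succ i =>
    rw [raised_succ_sF hH hF, show (((i + 1 : ℕ) : ℤ) - 1) = (i : ℕ) by simp, hT]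
    simp only [smul_eq_mul]
    push_cast
    ring

end Modules

/-! ### Weight basis, self-duality and irreducibility of M(n). -/

namespace Irr

variable {n : ℕ}

theorem coord_zero (i : ℤ) : coord (0 : Irr n) i = 0 := by
  unfold coord
  split_ifs <;> rfl

/-- The basis vectors of `M(n)`. -/
def vec (i : Fin (n + 1)) : Irr n := Pi.single (M := fun _ => ℂ) i 1

theorem coord_vec (i : Fin (n + 1)) (k : ℤ) :
    (vec i).coord k = if k = ((i : ℕ) : ℤ) then 1 else 0 := by
  have hi := i.2
  unfold coord vec
  split_ifs with h1 h2 h2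
  · subst h2
    simp
  · rw [Pi.single_apply, if_neg]
    rintro rfl
    simp at h2
    omega
  · omega
  · rfl

theorem dual_ext {W : Type*} [AddCommGroup W] [Module ℂ W] {S T : Irr n →ₗ[ℂ] W}
    (h : ∀ i, S (vec i) = T (vec i)) : S = T :=
  LinearMap.pi_ext' (φ := fun _ : Fin (n + 1) => ℂ) fun i => LinearMap.ext_ring (h i)

theorem span_vec : Submodule.span ℂ (Set.range (vec (n := n))) = ⊤ :=
  (Pi.basisFun ℂ (Fin (n + 1))).span_eq ▸ by
    congr 2
    funext i
    simp [vec]; rfl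

theorem sH_vec (i : Fin (n + 1)) : ⁅sH, vec i⁆ = ((n : ℂ) - 2 * (i : ℕ)) • vec i := by
  refine ext_coord fun k => ?_
  rw [coord_lie, coord_smul, coord_vec]
  simp only [sH]
  split_ifs with h
  · subst h; simp
  · simp

theorem sE_vec_succ (i : ℕ) (hi : i + 1 < n + 1) :
    ⁅sE, vec (⟨i + 1, hi⟩ : Fin (n + 1))⁆ =
      ((i : ℂ) + 1) • vec (⟨i, by omega⟩ : Fin (n + 1)) := by
  refine ext_coord fun k => ?_
  rw [coord_lie, coord_smul, coord_vec, coord_vec, coord_vec, coord_vec]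
  by_cases h : k = i
  · subst h; simp [sE]
  · simp [sE, h]

theorem sE_vec_zero : ⁅sE, vec (0 : Fin (n + 1))⁆ = 0 := by
  refine ext_coord fun k => ?_
  rw [coord_lie, coord_vec, coord_vec, coord_vec, coord_zero]
  by_cases h : k + 1 = 0
  · obtain rfl : k = -1 := by omega
    simp [sE]
  · simp [sE, h]

theorem sF_vec (i : ℕ) (hi : i + 1 < n + 1) :
    ⁅sF, vec (⟨i, by omega⟩ : Fin (n + 1))⁆ =
      ((n : ℂ) - i) • vec (⟨i + 1, hi⟩ : Fin (n + 1)) := by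
  refine ext_coord fun k => ?_
  rw [coord_lie, coord_smul, coord_vec, coord_vec, coord_vec, coord_vec]
  by_cases h : k = i + 1
  · subst h
    simp [sF]
    ring
  · simp [sF, h, show k - 1 ≠ i by omega]

theorem sF_vec_last : ⁅sF, vec (Fin.last n)⁆ = 0 := by
  refine ext_coord fun k => ?_
  rw [coord_lie, coord_vec, coord_vec, coord_vec, coord_zero]
  by_cases h : k - 1 = n
  · obtain rfl : k = n + 1 := by omega
    simp [sF]
  · simp [sF, h]

/-- `M(n)` is self-dual. -/
theorem exists_dualIso (n : ℕ) : ∃ D : Irr n ≃ₗ[ℂ] Module.Dual ℂ (Irr n),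
    ∀ (x : Sl2) u v, D ⁅x, u⁆ v = -D u ⁅x, v⁆ := by
  -- The lowest weight vector has weight -n, and dualizing changes the sign: evaluation there has
  -- weight n and kills the image of `sF`.
  let φ : Module.Dual ℂ (Module.Dual ℂ (Irr n)) := Module.Dual.eval ℂ _ (vec (Fin.last n))
  have hφ : ∀ f, φ f = f (vec (Fin.last n)) := fun f => rfl
  obtain ⟨T, hT⟩ := exists_hom_to_irr (φ := φ) (n := n)
    (fun f => by
      rw [hφ, hφ, Module.Dual.lie_apply, sH_vec, map_smul, Fin.val_last, smul_eq_mul]; ring)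
    (fun f => by rw [hφ, Module.Dual.lie_apply, sF_vec_last, map_zero, neg_zero])
  -- A functional in the kernel vanishes at the lowest vector; the kernel is stable under `sE`, so
  -- the vanishing climbs the weight basis.
  have key : ∀ k : ℕ, ∀ hk : k ≤ n, ∀ f, T f = 0 →
      f (vec (⟨n - k, by omega⟩ : Fin (n + 1))) = 0 := by
    intro k
    induction k with
    | zero =>
      intro _ f hf
      have := hT f 0
      rw [hf, coord_zero] at this
      exact this.symm
    | succ k ih =>
      intro hk f hf
      have h1 := ih (by omega) ⁅sE, f⁆ (by rw [LieModuleHom.map_lie, hf, lie_zero])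
      rw [Module.Dual.lie_apply, neg_eq_zero] at h1
      have h2 := sE_vec_succ (n := n) (n - (k + 1)) (by omega)
      have h3 : n - (k + 1) + 1 = n - k := by omega
      simp only [h3] at h2
      rw [h2, map_smul, smul_eq_mul, mul_eq_zero] at h1
      exact h1.resolve_left (Nat.cast_add_one_ne_zero _)
  have hinj : Function.Injective (T : Module.Dual ℂ (Irr n) →ₗ[ℂ] Irr n) := by
    rw [← LinearMap.ker_eq_bot, LinearMap.ker_eq_bot']
    intro f hf
    refine dual_ext fun i => ?_
    have h := key (n - i) (by omega) f hf
    have hi := i.2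
    rw [LinearMap.zero_apply, ← h]
    congr 2
    ext
    simp; omega
  have hbij : Function.Bijective (T : Module.Dual ℂ (Irr n) →ₗ[ℂ] Irr n) :=
    ⟨hinj, (LinearMap.injective_iff_surjective_of_finrank_eq_finrank
      Subspace.dual_finrank_eq).1 hinj⟩
  let D := (LinearEquiv.ofBijective (T : Module.Dual ℂ (Irr n) →ₗ[ℂ] Irr n) hbij).symm
  refine ⟨D, fun x u v => ?_⟩
  have h1 : ∀ f, D (T f) = f := fun f =>
    (LinearEquiv.ofBijective (T : Module.Dual ℂ (Irr n) →ₗ[ℂ] Irr n) hbij).symm_apply_apply f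
  obtain ⟨f, rfl⟩ := hbij.2 u
  change D ⁅x, T f⁆ v = -D (T f) ⁅x, v⁆
  rw [← LieModuleHom.map_lie, h1, h1, Module.Dual.lie_apply]

/-- `M(n)` is irreducible. -/
theorem eq_bot_or_eq_top {S : Submodule ℂ (Irr n)} (hS : ∀ (x : Sl2), ∀ u ∈ S, ⁅x, u⁆ ∈ S) :
    S = ⊥ ∨ S = ⊤ := by
  refine or_iff_not_imp_left.2 fun hbot => ?_
  obtain ⟨u, hu, hu0⟩ := S.ne_bot_iff.1 hbot
  -- Applying `sE` lowers the largest index with nonzero coordinate until a multiple of v₀ remains.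
  have h0 : ∀ k : ℕ, ∀ u ∈ S, u ≠ 0 → (∀ i : ℤ, k < i → u.coord i = 0) →
      vec (0 : Fin (n + 1)) ∈ S := by
    intro k
    induction k with
    | zero =>
      intro u hu hu0 h
      have h1 : u = u.coord 0 • vec 0 := by
        refine ext_coord fun i => ?_
        rw [coord_smul, coord_vec]
        rcases lt_trichotomy i 0 with hi | rfl | hi
        · rw [coord_of_lt hi, if_neg (by simp; omega), mul_zero]
        · simp
        · rw [h i hi, if_neg (by simp; omega), mul_zero]
      have h2 : u.coord 0 ≠ 0 := fun h2 => hu0 (by rw [h1, h2, zero_smul])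
      rw [h1] at hu
      exact (S.smul_mem_iff h2).1 hu
    | succ k ih =>
      intro u hu hu0 h
      by_cases hk : u.coord (k + 1 : ℕ) = 0
      · refine ih u hu hu0 fun i hi => ?_
        rcases eq_or_ne i (k + 1 : ℕ) with rfl | hne
        · exact hk
        · exact h i (by push_cast at hne ⊢; omega)
      · have hc : ∀ i : ℤ, ⁅sE, u⁆.coord i = (i + 1) * u.coord (i + 1) := fun i => by
          rw [coord_lie]; simp [sE]
        refine ih ⁅sE, u⁆ (hS _ _ hu) (fun h1 => ?_) fun i hi => ?_
        · have := hc k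
          rw [h1, coord_zero, eq_comm, mul_eq_zero] at this
          have h2 : ((k : ℤ) : ℂ) + 1 ≠ 0 := by
            simpa using Nat.cast_add_one_ne_zero (R := ℂ) k
          refine hk ?_
          push_cast
          exact this.resolve_left h2
        · rw [hc, h (i + 1) (by push_cast; omega), mul_zero]
  have hvec : ∀ k (hk : k < n + 1), vec (⟨k, hk⟩ : Fin (n + 1)) ∈ S := by
    intro k
    induction k with
    | zero => exact fun _ => h0 n u hu hu0 fun i hi => coord_of_gt hi
    | succ k ih =>
      intro hk
      have h1 := hS sF _ (ih (by omega))
      rw [sF_vec k hk] at h1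
      refine (S.smul_mem_iff ?_).1 h1
      rw [sub_ne_zero]
      exact_mod_cast (by omega : n ≠ k)
  rw [eq_top_iff, ← span_vec, Submodule.span_le]
  rintro _ ⟨i, rfl⟩
  exact hvec i i.2

end Irr

/-! ### The Casimir operator. -/

section Casimir

variable {W : Type*} [AddCommGroup W] [Module ℂ W] [LieRingModule Sl2 W] [LieModule ℂ Sl2 W]

/-- The operator `h² + 2 h + 4 f e`, a multiple of the Casimir operator. -/
def casimir (w : W) : W := ⁅sH, ⁅sH, w⁆⁆ + (2 : ℂ) • ⁅sH, w⁆ + (4 : ℂ) • ⁅sF, ⁅sE, w⁆⁆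

theorem casimir_sF (w : W) : casimir ⁅sF, w⁆ = ⁅sF, casimir w⁆ := by
  simp only [casimir, lie_add, lie_smul, lie_sF_sH_apply, lie_sE_sF_apply, smul_add]
  module

theorem casimir_sE (w : W) : casimir ⁅sE, w⁆ = ⁅sE, casimir w⁆ := by
  simp only [casimir, lie_add, lie_smul, lie_sE_sH_apply, lie_sE_sF_apply, smul_add, lie_sub]
  module

theorem lie_sH_casimir {w : W} {c : ℂ} (hw : ⁅sH, w⁆ = c • w) :
    ⁅sH, casimir w⁆ = c • casimir w := by
  have h : ⁅sH, ⁅sF, ⁅sE, w⁆⁆⁆ = c • ⁅sF, ⁅sE, w⁆⁆ := by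
    rw [leibniz_lie, leibniz_lie sH sE, lie_sH_sF, lie_sH_sE, hw]
    simp only [smul_lie, lie_smul, lie_add]
    module
  simp only [casimir, hw, lie_add, lie_smul, h]
  module

theorem casimir_of_lie_sE_eq_zero {w : W} {c : ℂ} (hw : ⁅sH, w⁆ = c • w) (he : ⁅sE, w⁆ = 0) :
    casimir w = (c * (c + 2)) • w := by
  simp only [casimir, hw, lie_smul, he, lie_zero]
  module

end Casimir

/-! ### Splitting off a copy of M(n). -/

section Retraction

variable {W : Type*} [AddCommGroup W] [Module ℂ W] [LieRingModule Sl2 W] [LieModule ℂ Sl2 W]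
  [FiniteDimensional ℂ W]

theorem eq_zero_of_lie_sF_eq_zero {w : W} {n : ℕ} (hn : 0 < n) (hw : ⁅sH, w⁆ = (n : ℂ) • w)
    (hf : ⁅sF, w⁆ = 0) : w = 0 := by
  by_contra h0
  have hP : isSl2Triple.symm.HasPrimitiveVectorWith w (-(n : ℂ)) :=
    { ne_zero := h0
      lie_h := by rw [neg_lie, hw, neg_smul]
      lie_e := hf }
  obtain ⟨k, hk⟩ := hP.exists_nat
  have : ((k + n : ℕ) : ℂ) = 0 := by push_cast; rw [← hk]; ring
  have := Nat.cast_eq_zero.1 this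
  omega

/-- Otherwise the vectors eᵏ w would be eigenvectors of h for infinitely many eigenvalues. -/
theorem exists_pow_sE_eq_zero {w : W} {c : ℂ} (hw : ⁅sH, w⁆ = c • w) :
    ∃ k : ℕ, (LieModule.toEnd ℂ Sl2 W sE ^ k) w = 0 := by
  by_contra! contra
  have hinj : Function.Injective fun k : ℕ => c + 2 * (k : ℂ) := fun a b hab => by
    simpa using hab
  have hli := Module.End.eigenvectors_linearIndependent' (LieModule.toEnd ℂ Sl2 W sH)
    (fun k : ℕ => c + 2 * (k : ℂ)) hinj (fun k => (LieModule.toEnd ℂ Sl2 W sE ^ k) w)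
    fun k => ⟨Module.End.mem_eigenspace_iff.2 (isSl2Triple.lie_h_pow_toEnd_e hw k), contra k⟩
  exact not_finite_iff_infinite.2 inferInstance hli.finite

/-- This replaces complete reducibility. If f w ≠ 0, it is a highest weight vector of weight n and
Casimir eigenvalue n(n+2). Then C w - n(n+2) w is killed by f and has positive weight, so it is
zero. The last nonzero eᵏ w has the same eigenvalue, yet its weight n+2+2k demands (n+2+2k)(n+4+2k).
-/
theorem lie_sF_eq_zero_of_lie_sE_lie_sF_eq_zero {w : W} {n : ℕ}
    (hw : ⁅sH, w⁆ = ((n : ℂ) + 2) • w) (hef : ⁅sE, ⁅sF, w⁆⁆ = 0) : ⁅sF, w⁆ = 0 := by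
  by_contra h0
  have hFw : ⁅sH, ⁅sF, w⁆⁆ = (n : ℂ) • ⁅sF, w⁆ := by
    rw [leibniz_lie, lie_sH_sF, hw, smul_lie, lie_smul]
    module
  have hC : casimir w = ((n : ℂ) * (n + 2)) • w := by
    rw [← sub_eq_zero]
    refine eq_zero_of_lie_sF_eq_zero (n := n + 2) (by omega) ?_ ?_
    · rw [lie_sub, lie_smul, hw, lie_sH_casimir hw]
      push_cast
      module
    · rw [lie_sub, lie_smul, ← casimir_sF, casimir_of_lie_sE_eq_zero hFw hef, sub_self]
  have hw0 : w ≠ 0 := fun h => h0 (by rw [h, lie_zero])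
  obtain ⟨k, hk, hk1⟩ := Nat.exists_not_and_succ_of_not_zero_of_exists
    (p := fun k => (LieModule.toEnd ℂ Sl2 W sE ^ k) w = 0) (by simpa using hw0)
    (exists_pow_sE_eq_zero hw)
  have hCk : ∀ k : ℕ, casimir ((LieModule.toEnd ℂ Sl2 W sE ^ k) w) =
      ((n : ℂ) * (n + 2)) • (LieModule.toEnd ℂ Sl2 W sE ^ k) w := by
    intro k
    induction k with
    | zero => simpa using hC
    | succ k ih =>
      rw [pow_succ', Module.End.mul_apply, LieModule.toEnd_apply_apply, casimir_sE, ih, lie_smul]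
  have h1 := casimir_of_lie_sE_eq_zero (isSl2Triple.lie_h_pow_toEnd_e hw k) (by
    rw [pow_succ', Module.End.mul_apply] at hk1
    exact hk1)
  rw [hCk, ← sub_eq_zero, ← sub_smul, smul_eq_zero] at h1
  have h2 := h1.resolve_right hk
  have h3 : (n * (n + 2) : ℕ) = (n + 2 + 2 * k) * (n + 2 + 2 * k + 2) := by
    have := sub_eq_zero.1 h2
    exact_mod_cast this
  nlinarith [Nat.zero_le k, Nat.zero_le n, Nat.zero_le (n * k)]

/-- A copy of `M(n)` in a module on which `h` is diagonalisable is a direct summand. -/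
theorem exists_retraction {n : ℕ}
    (hss : ⨆ c, (LieModule.toEnd ℂ Sl2 W sH).eigenspace c = ⊤) (j : Irr n →ₗ⁅ℂ, Sl2⁆ W)
    (hj : Function.Injective j) : ∃ ρ : W →ₗ⁅ℂ, Sl2⁆ Irr n, ∀ u, ρ (j u) = u := by
  set E : ℂ → Submodule ℂ W := (LieModule.toEnd ℂ Sl2 W sH).eigenspace with hEdef
  have hE : ∀ c w, w ∈ E c ↔ ⁅sH, w⁆ = c • w := fun c w => Module.End.mem_eigenspace_iff
  -- A functional supported on weight n kills the image of f once it kills f applied to weight n +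
  -- 2. The image of v₀ avoids that space by the Casimir argument, so such a functional can be
  -- normalized to 1 there.
  let K : Submodule ℂ W := (E (n + 2)).map (LieModule.toEnd ℂ Sl2 W sF)
  have hv0 : j (Irr.vec 0) ≠ 0 := fun h => by
    have h1 : Irr.vec (0 : Fin (n + 1)) = 0 := hj (h.trans (map_zero j).symm)
    have := Irr.coord_vec (0 : Fin (n + 1)) 0
    rw [h1, Irr.coord_zero] at this
    simp at this
  have hK : j (Irr.vec 0) ∉ K := by
    rintro ⟨w, hw, hfw⟩
    rw [LieModule.toEnd_apply_apply] at hfw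
    refine hv0 (hfw ▸ lie_sF_eq_zero_of_lie_sE_lie_sF_eq_zero ((hE _ _).1 hw) ?_)
    rw [hfw, ← LieModuleHom.map_lie, Irr.sE_vec_zero, map_zero]
  obtain ⟨φ₁, hφ₁, hKφ⟩ := Submodule.exists_le_ker_of_notMem hK
  have hcompl : IsCompl (E n) (⨆ c, ⨆ (_ : c ≠ (n : ℂ)), E c) := by
    refine ⟨(Module.End.eigenspaces_iSupIndep _) _, codisjoint_iff.2 ?_⟩
    rw [eq_top_iff, ← hss]
    refine iSup_le fun c => ?_
    rcases eq_or_ne c (n : ℂ) with rfl | hc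
    · exact le_sup_left
    · exact le_sup_of_le_right (le_iSup₂_of_le c hc le_rfl)
  let φ : Module.Dual ℂ W := (φ₁ (j (Irr.vec 0)))⁻¹ •
    (φ₁ ∘ₗ (E n).subtype ∘ₗ Submodule.projectionOnto _ _ hcompl)
  have hφ_self : ∀ w ∈ E n, φ w = (φ₁ (j (Irr.vec 0)))⁻¹ * φ₁ w := fun w hw => by
    have := Submodule.projectionOnto_apply_left hcompl ⟨w, hw⟩
    simp only [φ, LinearMap.smul_apply, LinearMap.comp_apply, smul_eq_mul]
    rw [this]
    rfl
  have hφ_ne : ∀ c ≠ (n : ℂ), ∀ w ∈ E c, φ w = 0 := fun c hc w hw => by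
    have : Submodule.projectionOnto _ _ hcompl w = 0 :=
      (Submodule.projectionOnto_apply_eq_zero_iff hcompl).2
        (Submodule.mem_iSup_of_mem c (Submodule.mem_iSup_of_mem hc hw))
    simp only [φ, LinearMap.smul_apply, LinearMap.comp_apply, this, map_zero, smul_zero]
  have hφH : ∀ w, φ ⁅sH, w⁆ = n * φ w := by
    intro w
    have hw : w ∈ ⨆ c, E c := hss ▸ Submodule.mem_top
    induction hw using Submodule.iSup_induction' with
    | zero => simp
    | add v w _ _ hv hw => rw [lie_add, map_add, map_add, hv, hw, mul_add]
    | mem c w hw =>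
      rw [(hE c w).1 hw, map_smul, smul_eq_mul]
      rcases eq_or_ne c (n : ℂ) with rfl | hc
      · rfl
      · rw [hφ_ne c hc w hw, mul_zero, mul_zero]
  have hφF : ∀ w, φ ⁅sF, w⁆ = 0 := by
    intro w
    have hw : w ∈ ⨆ c, E c := hss ▸ Submodule.mem_top
    induction hw using Submodule.iSup_induction' with
    | zero => simp
    | add v w _ _ hv hw => rw [lie_add, map_add, hv, hw, add_zero]
    | mem c w hw =>
      have h1 : ⁅sF, w⁆ ∈ E (c - 2) := by
        rw [hE, leibniz_lie, lie_sH_sF, (hE c w).1 hw, smul_lie, lie_smul]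
        module
      rcases eq_or_ne c ((n : ℂ) + 2) with rfl | hc
      · rw [add_sub_cancel_right] at h1
        have h2 : ⁅sF, w⁆ ∈ K := ⟨w, hw, rfl⟩
        rw [hφ_self _ h1, LinearMap.mem_ker.1 (hKφ h2), mul_zero]
      · exact hφ_ne _ (fun h => hc (by rw [← h]; ring)) _ h1
  obtain ⟨T, hT⟩ := exists_hom_to_irr hφH hφF
  have hφj : ∀ u, φ (j u) = u.coord 0 := by
    let co : Irr n →ₗ[ℂ] ℂ :=
      { toFun := fun u => u.coord 0
        map_add' := fun u v => Irr.coord_add u v 0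
        map_smul' := fun c u => Irr.coord_smul c u 0 }
    have h : φ ∘ₗ (j : Irr n →ₗ[ℂ] W) = co := by
      refine Irr.dual_ext fun i => ?_
      change φ (j (Irr.vec i)) = (Irr.vec i).coord 0
      rw [Irr.coord_vec]
      rcases eq_or_ne i 0 with rfl | hi
      · have h1 : j (Irr.vec (0 : Fin (n + 1))) ∈ E n := by
          rw [hE, ← LieModuleHom.map_lie, Irr.sH_vec]
          simp
        rw [hφ_self _ h1, inv_mul_cancel₀ hφ₁]
        simp
      · have h1 : j (Irr.vec i) ∈ E (n - 2 * (i : ℕ)) := by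
          rw [hE, ← LieModuleHom.map_lie, Irr.sH_vec, map_smul]
        have hi' : (i : ℕ) ≠ 0 := fun h => hi (Fin.ext h)
        rw [hφ_ne _ _ _ h1, if_neg (by omega)]
        simpa using hi
    exact fun u => LinearMap.congr_fun h u
  have hraised : ∀ (i : ℕ) u, raised φ i (j u) = u.coord i := by
    intro i
    induction i with
    | zero => exact hφj
    | succ i ih =>
      intro u
      have h1 : (i : ℂ) + 1 ≠ 0 := Nat.cast_add_one_ne_zero i
      rw [raised_succ, ← LieModuleHom.map_lie, ih, Irr.coord_lie]
      simp [sE]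
      field_simp
  refine ⟨T, fun u => Irr.ext_coord fun i => ?_⟩
  rcases lt_or_ge i 0 with hi | hi
  · rw [Irr.coord_of_lt hi, Irr.coord_of_lt hi]
  lift i to ℕ using hi
  rw [hT, hraised]

end Retraction

end AffineSl2
end

noncomputable section
namespace AffineSl2
namespace Verma

variable {ℓ : ℂ} {r : ℕ}

/-! ### Submodules of Verma modules whose maximal proper submodule is irreducible -/

/-- A subspace stable under all `x(n)` as a submodule. -/
def ofLoopStable (N : Submodule ℂ (Verma ℓ r)) (h : ∀ n x, ∀ v ∈ N, ⁅loop n x, v⁆ ∈ N) :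
    LieSubmodule ℂ Affine (Verma ℓ r) where
  __ := N
  lie_mem {a v} hv := by
    induction a using affine_induction with
    | hl n x => exact h n x v hv
    | hc => rw [lie_central_apply]; exact N.smul_mem _ hv
    | hadd a b ha hb => rw [add_lie]; exact N.add_mem ha hb
    | hsmul c a ha => rw [smul_lie]; exact N.smul_mem _ ha

@[simp] theorem mem_ofLoopStable {N : Submodule ℂ (Verma ℓ r)}
    {h : ∀ n x, ∀ v ∈ N, ⁅loop n x, v⁆ ∈ N} {v : Verma ℓ r} : v ∈ ofLoopStable N h ↔ v ∈ N := Iff.rfl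

theorem vec_zero_ne_zero : Irr.vec (0 : Fin (r + 1)) ≠ 0 := fun h => by
  have := Irr.coord_vec (0 : Fin (r + 1)) 0
  rw [h, Irr.coord_zero] at this
  simp at this

theorem le_maxProper {N : LieSubmodule ℂ Affine (Verma ℓ r)} (h : N ≠ ⊤) : N ≤ maxProper ℓ r :=
  le_sSup h

section Irreducible

variable (hJ : LieModule.IsIrreducible ℂ Affine (maxProper ℓ r))
include hJ

theorem maxProper_ne_bot : maxProper ℓ r ≠ ⊥ := by
  intro h
  have h1 : Nontrivial (LieSubmodule ℂ Affine (maxProper ℓ r)) := hJ.toNontrivial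
  refine bot_ne_top (α := LieSubmodule ℂ Affine (maxProper ℓ r)) (eq_comm.1 ?_)
  rw [eq_bot_iff]
  rintro ⟨v, hv⟩ -
  rw [h, LieSubmodule.mem_bot] at hv
  rw [LieSubmodule.mem_bot]
  exact Subtype.ext hv

theorem eq_bot_or_eq_maxProper {N : LieSubmodule ℂ Affine (Verma ℓ r)} (hN : N ≠ ⊤) :
    N = ⊥ ∨ N = maxProper ℓ r := by
  have hle := le_maxProper hN
  rcases hJ.eq_bot_or_eq_top (N.comap (maxProper ℓ r).incl) with h | h
  · left
    rw [eq_bot_iff]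
    intro v hv
    have h1 : (⟨v, hle hv⟩ : maxProper ℓ r) ∈ N.comap (maxProper ℓ r).incl := hv
    rw [h, LieSubmodule.mem_bot] at h1
    rw [LieSubmodule.mem_bot]
    exact congrArg Subtype.val h1
  · right
    refine le_antisymm hle fun v hv => ?_
    have h1 : (⟨v, hv⟩ : maxProper ℓ r) ∈ N.comap (maxProper ℓ r).incl := h ▸ LieSubmodule.mem_top _
    exact h1

/-- A sum of proper submodules could a priori be everything. In that case irreducibility would make
every proper submodule zero, and then their sum would be zero. -/
theorem maxProper_ne_top : maxProper ℓ r ≠ ⊤ := by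
  intro h
  have h1 : maxProper ℓ r ≤ ⊥ := sSup_le fun N hN => by
    rcases eq_bot_or_eq_maxProper hJ hN with h1 | h1
    · exact h1.le
    · exact absurd (h1.trans h) hN
  exact maxProper_ne_bot hJ (le_bot_iff.1 h1)

theorem eq_zero_of_incl_mem_maxProper {u : Irr r} (hu : incl ℓ r u ∈ maxProper ℓ r) : u = 0 := by
  let K : Submodule ℂ (Irr r) := (maxProper ℓ r).toSubmodule.comap (incl ℓ r)
  have hK : ∀ (x : Sl2), ∀ u ∈ K, ⁅x, u⁆ ∈ K := fun x u hu => by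
    change incl ℓ r ⁅x, u⁆ ∈ maxProper ℓ r
    rw [← loop_zero_incl]
    exact LieSubmodule.lie_mem _ hu
  rcases Irr.eq_bot_or_eq_top hK with h | h
  · have : u ∈ K := hu
    rwa [h, Submodule.mem_bot] at this
  · refine absurd ?_ (maxProper_ne_top hJ)
    rw [← LieSubmodule.toSubmodule_eq_top]
    refine eq_top_of_lie_stable (fun u => ?_) fun a v hv => LieSubmodule.lie_mem _ hv
    exact (h ▸ Submodule.mem_top : u ∈ K)

/-- The maximal proper submodule is homogeneous. -/
theorem comp_mem_maxProper {v : Verma ℓ r} (hv : v ∈ maxProper ℓ r) (d : ℤ) :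
    comp ℓ r d v ∈ maxProper ℓ r := by
  obtain ⟨τ, hτ, hτd⟩ := exists_rescaling ℓ r
  -- The preimage of J(r) under `τ` is a submodule. It is proper since `τ` fixes M(r), and nonzero
  -- since `τ` is onto; so it equals J(r), which is thus `τ`-stable.
  let N := ofLoopStable ((maxProper ℓ r).toSubmodule.comap τ) fun n x v hv => by
    rw [Submodule.mem_comap, hτ]
    exact Submodule.smul_mem _ _ (LieSubmodule.lie_mem _ hv)
  have hmem : ∀ v, v ∈ N ↔ τ v ∈ maxProper ℓ r := fun v => Iff.rfl
  have htop : N ≠ ⊤ := by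
    intro h
    have h1 : ∀ u, τ (incl ℓ r u) = incl ℓ r u := fun u => by
      refine ext_comp fun d => ?_
      rw [hτd, comp_incl]
      split_ifs with hd
      · simp [hd]
      · simp
    have h2 : incl ℓ r (Irr.vec 0) ∈ maxProper ℓ r := by
      rw [← h1, ← hmem, h]
      exact LieSubmodule.mem_top _
    exact vec_zero_ne_zero (eq_zero_of_incl_mem_maxProper hJ h2)
  have hbot : N ≠ ⊥ := by
    intro h
    refine maxProper_ne_bot hJ ((LieSubmodule.eq_bot_iff _).2 fun v hv => ?_)
    obtain ⟨s, hs⟩ := exists_eq_sum_comp v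
    have h1 : τ (∑ d ∈ s, (2 : ℂ) ^ d • comp ℓ r d v) = v := by
      conv_rhs => rw [hs]
      rw [map_sum]
      refine Finset.sum_congr rfl fun d _ => ext_comp fun e => ?_
      rw [hτd, map_smul, comp_comp, smul_smul]
      split_ifs with hed
      · rw [hed, ← zpow_add₀ two_ne_zero, neg_add_cancel, zpow_zero, one_smul]
      · rw [smul_zero]
    have h2 : (∑ d ∈ s, (2 : ℂ) ^ d • comp ℓ r d v) ∈ N := by rw [hmem, h1]; exact hv
    rw [h, LieSubmodule.mem_bot] at h2
    rw [← h1, h2, map_zero]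
  have hNJ := (eq_bot_or_eq_maxProper hJ htop).resolve_left hbot
  refine comp_mem_of_rescaling hτd (N := (maxProper ℓ r).toSubmodule) (fun w hw => ?_) hv d
  have : w ∈ N := hNJ ▸ hw
  exact this

end Irreducible

/-! ### The contravariant form -/

/-- The isomorphism of `M(r)` with its dual. -/
def dualIso (r : ℕ) : Irr r ≃ₗ[ℂ] Module.Dual ℂ (Irr r) := (Irr.exists_dualIso r).choose

theorem dualIso_lie (x : Sl2) (u v : Irr r) : dualIso r ⁅x, u⁆ v = -dualIso r u ⁅x, v⁆ :=
  (Irr.exists_dualIso r).choose_spec x u v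

theorem exists_top (ℓ : ℂ) (r : ℕ) :
    ∃ t : Verma ℓ r →ₗ[ℂ] Irr r, ∀ v, incl ℓ r (t v) = comp ℓ r 0 v := by
  have h : ∀ v, comp ℓ r 0 v ∈ LinearMap.range (incl ℓ r) := fun v =>
    grade_zero_eq (ℓ := ℓ) (r := r) ▸ comp_mem_grade 0 v
  refine ⟨(LinearEquiv.ofInjective (incl ℓ r) (incl_injective ℓ r)).symm.toLinearMap ∘ₗ
    (comp ℓ r 0).codRestrict _ h, fun v => ?_⟩
  have := (LinearEquiv.ofInjective (incl ℓ r) (incl_injective ℓ r)).apply_symm_apply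
    ⟨comp ℓ r 0 v, h v⟩
  exact congrArg Subtype.val this

/-- The projection onto the lowest degree component `M(r)`. -/
def top (ℓ : ℂ) (r : ℕ) : Verma ℓ r →ₗ[ℂ] Irr r := (exists_top ℓ r).choose

theorem incl_top (v : Verma ℓ r) : incl ℓ r (top ℓ r v) = comp ℓ r 0 v :=
  (exists_top ℓ r).choose_spec v

theorem top_incl (u : Irr r) : top ℓ r (incl ℓ r u) = u :=
  incl_injective ℓ r (by rw [incl_top, comp_incl, if_pos rfl])

theorem top_comp_zero (v : Verma ℓ r) : top ℓ r (comp ℓ r 0 v) = top ℓ r v :=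
  incl_injective ℓ r (by rw [incl_top, incl_top, comp_comp, if_pos rfl])

theorem top_loop_zero (x : Sl2) (v : Verma ℓ r) : top ℓ r ⁅loop 0 x, v⁆ = ⁅x, top ℓ r v⁆ :=
  incl_injective ℓ r (by rw [incl_top, comp_loop, add_zero, ← incl_top, loop_zero_incl])

theorem top_loop_neg {n : ℤ} (hn : n < 0) (x : Sl2) (v : Verma ℓ r) :
    top ℓ r ⁅loop n x, v⁆ = 0 := by
  refine incl_injective ℓ r ?_
  have h := comp_mem_grade (0 + n) v
  rw [grade_of_neg (by omega), Submodule.mem_bot] at h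
  rw [incl_top, comp_loop, h, lie_zero, map_zero]

theorem top_mem_of_maxProper (hJ : LieModule.IsIrreducible ℂ Affine (maxProper ℓ r))
    {v : Verma ℓ r} (hv : v ∈ maxProper ℓ r) : top ℓ r v = 0 := by
  refine eq_zero_of_incl_mem_maxProper hJ ?_
  rw [incl_top]
  exact comp_mem_maxProper hJ hv 0

/-- The transposed operators on the dual of a Verma module. -/
def transAct (ℓ : ℂ) (r : ℕ) (n : ℤ) : Sl2 →ₗ[ℂ] Module.End ℂ (Module.Dual ℂ (Verma ℓ r)) :=
  -(Module.Dual.transpose ∘ₗ act ℓ r (-n))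

theorem transAct_apply (n : ℤ) (x : Sl2) (φ : Module.Dual ℂ (Verma ℓ r)) (v : Verma ℓ r) :
    transAct ℓ r n x φ v = -φ ⁅loop (-n) x, v⁆ := rfl

theorem transAct_isLevelRep : IsLevelRep ℓ (transAct ℓ r) := fun m n x y φ => by
  ext v
  have h := act_isLevelRep (-n) (-m) y x v
  simp only [act_apply] at h
  have h1 := congrArg φ h
  rw [map_sub, map_add, map_smul, map_smul, ← neg_add_rev, ← lie_skew, loop_neg, neg_lie,
    map_neg] at h1
  simp only [LinearMap.sub_apply, LinearMap.add_apply, LinearMap.smul_apply, transAct_apply,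
    neg_neg]
  rw [h1]
  by_cases hmn : m + n = 0
  · rw [if_pos hmn, if_pos (by omega), ← form_isSymm.eq x y]
    obtain rfl : n = -m := by omega
    simp
  · rw [if_neg hmn, if_neg (by omega)]

/-- The dual with transposed operators has level ℓ, and functionals factoring through `top` are
killed by its positive modes because `top` kills the images of negative modes. -/
theorem exists_shapovalov (ℓ : ℂ) (r : ℕ) :
    ∃ S : Verma ℓ r →ₗ[ℂ] Module.Dual ℂ (Verma ℓ r),
      (∀ u, S (incl ℓ r u) = dualIso r u ∘ₗ top ℓ r) ∧
      ∀ n x w, S ⁅loop n x, w⁆ = transAct ℓ r n x (S w) := by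
  refine exists_lift transAct_isLevelRep
    (LinearMap.lcomp ℂ ℂ (top ℓ r) ∘ₗ (dualIso r).toLinearMap) fun n x u => ?_
  ext v
  change -(dualIso r u (top ℓ r ⁅loop (-(n : ℤ)) x, v⁆)) = dualIso r (posAct n x u) (top ℓ r v)
  rcases Nat.eq_zero_or_pos n with rfl | hn
  · rw [Nat.cast_zero, neg_zero, top_loop_zero, posAct, if_pos rfl, dualIso_lie]
  · rw [top_loop_neg (by omega), posAct, if_neg (by omega)]
    simp

/-- The contravariant form of a Verma module. -/
def shapovalov (ℓ : ℂ) (r : ℕ) : Verma ℓ r →ₗ[ℂ] Module.Dual ℂ (Verma ℓ r) :=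
  (exists_shapovalov ℓ r).choose

theorem shapovalov_incl (u : Irr r) (v : Verma ℓ r) :
    shapovalov ℓ r (incl ℓ r u) v = dualIso r u (top ℓ r v) :=
  LinearMap.congr_fun ((exists_shapovalov ℓ r).choose_spec.1 u) v

theorem shapovalov_loop (n : ℤ) (x : Sl2) (w v : Verma ℓ r) :
    shapovalov ℓ r ⁅loop n x, w⁆ v = -shapovalov ℓ r w ⁅loop (-n) x, v⁆ :=
  LinearMap.congr_fun ((exists_shapovalov ℓ r).choose_spec.2 n x w) v

theorem shapovalov_loop_right (n : ℤ) (x : Sl2) (w v : Verma ℓ r) :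
    shapovalov ℓ r w ⁅loop n x, v⁆ = -shapovalov ℓ r ⁅loop (-n) x, w⁆ v := by
  rw [shapovalov_loop, neg_neg, neg_neg]

theorem shapovalov_incl_right (w : Verma ℓ r) (u : Irr r) :
    shapovalov ℓ r w (incl ℓ r u) = dualIso r (top ℓ r w) u := by
  let P : Submodule ℂ (Verma ℓ r) := LinearMap.eqLocus
    ((shapovalov ℓ r).flip (incl ℓ r u)) ((dualIso r).toLinearMap.flip u ∘ₗ top ℓ r)
  have hP : P = ⊤ := by
    refine eq_top_of_neg_stable (fun u' => ?_) (fun n hn x v _ => ?_)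
    · change shapovalov ℓ r (incl ℓ r u') (incl ℓ r u) = dualIso r (top ℓ r (incl ℓ r u')) u
      rw [shapovalov_incl, top_incl, top_incl]
    · change shapovalov ℓ r ⁅loop (-(n : ℤ)) x, v⁆ (incl ℓ r u) =
        dualIso r (top ℓ r ⁅loop (-(n : ℤ)) x, v⁆) u
      rw [shapovalov_loop, neg_neg, loop_pos_incl (by omega), top_loop_neg (by omega)]
      simp
  exact (hP ▸ Submodule.mem_top : w ∈ P)

/-- Orthogonality of different degrees, which reduces the form to finite-dimensional pieces. -/
theorem shapovalov_comp (w v : Verma ℓ r) (d : ℤ) :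
    shapovalov ℓ r w (comp ℓ r d v) = shapovalov ℓ r (comp ℓ r d w) (comp ℓ r d v) := by
  let P : Submodule ℂ (Verma ℓ r) :=
    { carrier := {v | ∀ w d, shapovalov ℓ r w (comp ℓ r d v) =
        shapovalov ℓ r (comp ℓ r d w) (comp ℓ r d v)}
      add_mem' := fun hv hv' w d => by rw [map_add, map_add, map_add, hv, hv']
      zero_mem' := fun w d => by simp
      smul_mem' := fun c v hv w d => by rw [map_smul, map_smul, map_smul, hv] }
  have hP : P = ⊤ := by
    refine eq_top_of_neg_stable (fun u w d => ?_) (fun n hn x v hv w d => ?_)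
    · rw [comp_incl]
      split_ifs with hd
      · rw [shapovalov_incl_right, shapovalov_incl_right, hd, top_comp_zero]
      · simp
    · rw [comp_loop, shapovalov_loop_right, shapovalov_loop_right, hv, comp_loop, neg_neg,
        neg_add_cancel_right]
  exact (hP ▸ Submodule.mem_top : v ∈ P) w d

/-- The right radical is a submodule, and it is proper because the form is nondegenerate on M(r). -/
theorem mem_maxProper_of_shapovalov_right {v : Verma ℓ r} (hv : ∀ w, shapovalov ℓ r w v = 0) :
    v ∈ maxProper ℓ r := by
  let N := ofLoopStable (LinearMap.ker (shapovalov ℓ r).flip) fun n x v hv => by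
    rw [LinearMap.mem_ker] at hv ⊢
    ext w
    have := LinearMap.congr_fun hv ⁅loop (-n) x, w⁆
    rw [LinearMap.flip_apply, LinearMap.zero_apply] at this
    rw [LinearMap.flip_apply, shapovalov_loop_right, this, neg_zero, LinearMap.zero_apply]
  have hN : N ≠ ⊤ := by
    intro h
    have h1 : ∀ u u' : Irr r, dualIso r u u' = 0 := fun u u' => by
      have h2 : incl ℓ r u' ∈ N := h ▸ LieSubmodule.mem_top _
      have := LinearMap.congr_fun (LinearMap.mem_ker.1 (mem_ofLoopStable.1 h2)) (incl ℓ r u)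
      rwa [LinearMap.flip_apply, shapovalov_incl, top_incl, LinearMap.zero_apply] at this
    exact vec_zero_ne_zero ((dualIso r).injective (by
      rw [map_zero]; exact LinearMap.ext (h1 (Irr.vec 0))))
  refine le_maxProper hN (mem_ofLoopStable.2 (LinearMap.mem_ker.2 ?_))
  ext w
  exact hv w

theorem mem_maxProper_of_shapovalov {w : Verma ℓ r} (hw : shapovalov ℓ r w = 0) :
    w ∈ maxProper ℓ r := by
  let N := ofLoopStable (LinearMap.ker (shapovalov ℓ r)) fun n x w hw => by
    rw [LinearMap.mem_ker] at hw ⊢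
    ext v
    rw [shapovalov_loop, hw, LinearMap.zero_apply, neg_zero, LinearMap.zero_apply]
  have hN : N ≠ ⊤ := by
    intro h
    have h2 : incl ℓ r (Irr.vec 0) ∈ N := h ▸ LieSubmodule.mem_top _
    have h3 := LinearMap.mem_ker.1 (mem_ofLoopStable.1 h2)
    refine vec_zero_ne_zero ((dualIso r).injective ?_)
    rw [map_zero]
    ext u
    have := LinearMap.congr_fun h3 (incl ℓ r u)
    rwa [shapovalov_incl, top_incl, LinearMap.zero_apply] at this
  exact le_maxProper hN (mem_ofLoopStable.2 (LinearMap.mem_ker.2 hw))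

/-- J(r) is graded and meets M(r) in zero, so it pairs trivially with M(r); contravariance moves
negative modes back onto J(r). -/
theorem shapovalov_eq_zero (hJ : LieModule.IsIrreducible ℂ Affine (maxProper ℓ r))
    {w : Verma ℓ r} (hw : w ∈ maxProper ℓ r) : shapovalov ℓ r w = 0 := by
  let P : Submodule ℂ (Verma ℓ r) :=
    { carrier := {v | ∀ w ∈ maxProper ℓ r, shapovalov ℓ r w v = 0}
      add_mem' := fun hv hv' w hw => by rw [map_add, hv w hw, hv' w hw, add_zero]
      zero_mem' := fun w _ => map_zero _
      smul_mem' := fun c v hv w hw => by rw [map_smul, hv w hw, smul_zero] }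
  have hP : P = ⊤ := by
    refine eq_top_of_neg_stable (fun u w hw => ?_) (fun n hn x v hv w hw => ?_)
    · rw [shapovalov_incl_right, top_mem_of_maxProper hJ hw, map_zero, LinearMap.zero_apply]
    · rw [shapovalov_loop_right, hv _ (LieSubmodule.lie_mem _ hw), neg_zero]
  ext v
  exact (hP ▸ Submodule.mem_top : v ∈ P) w hw

theorem shapovalov_right_eq_zero (hJ : LieModule.IsIrreducible ℂ Affine (maxProper ℓ r))
    {v : Verma ℓ r} (hv : v ∈ maxProper ℓ r) (w : Verma ℓ r) : shapovalov ℓ r w v = 0 := by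
  let P : Submodule ℂ (Verma ℓ r) :=
    { carrier := {w | ∀ v ∈ maxProper ℓ r, shapovalov ℓ r w v = 0}
      add_mem' := fun hw hw' v hv => by
        rw [map_add, LinearMap.add_apply, hw v hv, hw' v hv, add_zero]
      zero_mem' := fun v _ => by simp
      smul_mem' := fun c w hw v hv => by
        rw [map_smul, LinearMap.smul_apply, hw v hv, smul_zero] }
  have hP : P = ⊤ := by
    refine eq_top_of_neg_stable (fun u v hv => ?_) (fun n hn x w hw v hv => ?_)
    · rw [shapovalov_incl, top_mem_of_maxProper hJ hv, map_zero]
    · rw [shapovalov_loop, hw _ (LieSubmodule.lie_mem _ hv), neg_zero]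
  exact (hP ▸ Submodule.mem_top : w ∈ P) v hv

/-! ### The completed contravariant form -/

/-- The action of the current algebra on families of vectors. -/
def famActNat (ℓ : ℂ) (r : ℕ) (n : ℕ) : Sl2 →ₗ[ℂ] Module.End ℂ (ℤ → Verma ℓ r) := famAct ℓ r n

@[simp] theorem famActNat_apply (n : ℕ) (x : Sl2) (y : ℤ → Verma ℓ r) (d : ℤ) :
    famActNat ℓ r n x y d = ⁅loop n x, y (d + n)⁆ := rfl

theorem famActNat_isCurrentRep : IsCurrentRep (famActNat ℓ r) := fun m n x y w => by
  refine (famAct_isLevelRep m n x y w).trans ?_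
  rw [← Nat.cast_add]
  split_ifs with h
  · have : m = 0 := by omega
    simp [this, famActNat]
  · simp [famActNat]

/-- The families whose members are homogeneous of the appropriate degree: the completion of the
Verma module. -/
def completion (ℓ : ℂ) (r : ℕ) : Submodule ℂ (ℤ → Verma ℓ r) := Submodule.pi Set.univ (grade ℓ r)

theorem mem_completion {y : ℤ → Verma ℓ r} : y ∈ completion ℓ r ↔ ∀ d, y d ∈ grade ℓ r d := by
  simp [completion, Submodule.mem_pi]

theorem famActNat_mem_completion (n : ℕ) (x : Sl2) {y : ℤ → Verma ℓ r} (hy : y ∈ completion ℓ r) :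
    famActNat ℓ r n x y ∈ completion ℓ r := by
  rw [mem_completion] at hy ⊢
  intro d
  have := loop_mem_grade n x (hy (d + n))
  rwa [add_sub_cancel_right] at this

theorem exists_completedForm (ℓ : ℂ) (r : ℕ) :
    ∃ S : (ℤ → Verma ℓ r) →ₗ[ℂ] Module.Dual ℂ (Verma ℓ r),
      (∀ y u, S y (incl ℓ r u) = dualIso r (top ℓ r (y 0)) u) ∧ IsDualHom (famActNat ℓ r) S := by
  refine exists_isDualHom famActNat_isCurrentRep
    ((dualIso r).toLinearMap ∘ₗ top ℓ r ∘ₗ LinearMap.proj 0) fun x y u => ?_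
  change dualIso r (top ℓ r ⁅loop 0 x, y (0 + 0)⁆) u = -dualIso r (top ℓ r (y 0)) ⁅x, u⁆
  rw [add_zero, top_loop_zero, dualIso_lie]

/-- The extension of the contravariant form to the completion. -/
def completedForm (ℓ : ℂ) (r : ℕ) : (ℤ → Verma ℓ r) →ₗ[ℂ] Module.Dual ℂ (Verma ℓ r) :=
  (exists_completedForm ℓ r).choose

theorem completedForm_incl (y : ℤ → Verma ℓ r) (u : Irr r) :
    completedForm ℓ r y (incl ℓ r u) = dualIso r (top ℓ r (y 0)) u :=
  (exists_completedForm ℓ r).choose_spec.1 y u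

theorem completedForm_isDualHom : IsDualHom (famActNat ℓ r) (completedForm ℓ r) :=
  (exists_completedForm ℓ r).choose_spec.2

/-- The form on families, defined by coinduction, is thereby the degreewise contravariant form,
summed over the finitely many components of `v`. -/
theorem completedForm_comp (y : ℤ → Verma ℓ r) (v : Verma ℓ r) (d : ℤ) :
    completedForm ℓ r y (comp ℓ r d v) = shapovalov ℓ r (y d) (comp ℓ r d v) := by
  let P : Submodule ℂ (Verma ℓ r) :=
    { carrier := {v | ∀ y d, completedForm ℓ r y (comp ℓ r d v) =
        shapovalov ℓ r (y d) (comp ℓ r d v)}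
      add_mem' := fun hv hv' y d => by rw [map_add, map_add, map_add, hv, hv']
      zero_mem' := fun y d => by simp
      smul_mem' := fun c v hv y d => by rw [map_smul, map_smul, map_smul, hv] }
  have hP : P = ⊤ := by
    refine eq_top_of_neg_stable (fun u y d => ?_) (fun n hn x v hv y d => ?_)
    · rw [comp_incl]
      split_ifs with hd
      · rw [completedForm_incl, shapovalov_incl_right, hd]
      · simp
    · have h := completedForm_isDualHom n x y (comp ℓ r (d + -n) v)
      rw [comp_loop, shapovalov_loop_right, ← neg_eq_iff_eq_neg.2 h, hv, famActNat_apply,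
        neg_add_cancel_right, neg_neg]
  exact (hP ▸ Submodule.mem_top : v ∈ P) y d

theorem completedForm_eq_zero_of_forall_mem (hJ : LieModule.IsIrreducible ℂ Affine (maxProper ℓ r))
    {y : ℤ → Verma ℓ r} (hy : ∀ d, y d ∈ maxProper ℓ r) : completedForm ℓ r y = 0 := by
  ext v
  obtain ⟨s, hs⟩ := exists_eq_sum_comp v
  rw [hs, map_sum]
  refine Finset.sum_eq_zero fun d _ => ?_
  rw [completedForm_comp, shapovalov_eq_zero hJ (hy d), LinearMap.zero_apply]

theorem completedForm_apply_eq_zero (hJ : LieModule.IsIrreducible ℂ Affine (maxProper ℓ r))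
    (y : ℤ → Verma ℓ r) {v : Verma ℓ r} (hv : v ∈ maxProper ℓ r) : completedForm ℓ r y v = 0 := by
  obtain ⟨s, hs⟩ := exists_eq_sum_comp v
  rw [hs, map_sum]
  refine Finset.sum_eq_zero fun d _ => ?_
  rw [completedForm_comp, shapovalov_right_eq_zero hJ (comp_mem_maxProper hJ hv d)]

theorem mem_maxProper_of_completedForm_eq_zero {y : ℤ → Verma ℓ r} (hy : y ∈ completion ℓ r)
    (h : completedForm ℓ r y = 0) (d : ℤ) : y d ∈ maxProper ℓ r := by
  refine mem_maxProper_of_shapovalov ?_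
  ext v
  obtain ⟨s, hs⟩ := exists_eq_sum_comp v
  rw [hs, map_sum, LinearMap.zero_apply]
  refine Finset.sum_eq_zero fun e _ => ?_
  rcases eq_or_ne e d with rfl | hed
  · rw [← completedForm_comp, h, LinearMap.zero_apply]
  · rw [shapovalov_comp, comp_of_mem_grade (mem_completion.1 hy d), if_neg hed, map_zero,
      LinearMap.zero_apply]

/-- On the finite-dimensional V(d) the range of the form is the full annihilator of its right
radical, which lies in J(r). Solutions in different degrees are independent, as families in the
completion are unrestricted. -/
theorem exists_completedForm_eq {F : Module.Dual ℂ (Verma ℓ r)}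
    (hF : ∀ v ∈ maxProper ℓ r, F v = 0) : ∃ y ∈ completion ℓ r, completedForm ℓ r y = F := by
  have key : ∀ d, ∃ y ∈ grade ℓ r d, ∀ v ∈ grade ℓ r d, shapovalov ℓ r y v = F v := by
    intro d
    let s : grade ℓ r d →ₗ[ℂ] Module.Dual ℂ (grade ℓ r d) :=
      LinearMap.lcomp ℂ ℂ (grade ℓ r d).subtype ∘ₗ shapovalov ℓ r ∘ₗ (grade ℓ r d).subtype
    have hs : ∀ y v, s y v = shapovalov ℓ r y v := fun y v => rfl
    have hmem : F ∘ₗ (grade ℓ r d).subtype ∈ LinearMap.range s := by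
      rw [← Subspace.dualCoannihilator_dualAnnihilator_eq (W := LinearMap.range s),
        Submodule.mem_dualAnnihilator]
      intro v hv
      rw [Submodule.mem_dualCoannihilator] at hv
      refine hF v (mem_maxProper_of_shapovalov_right fun w => ?_)
      have h1 := hv _ ⟨⟨comp ℓ r d w, comp_mem_grade d w⟩, rfl⟩
      rw [hs] at h1
      have h2 := shapovalov_comp w (v : Verma ℓ r) d
      rw [mem_grade_iff.1 v.2] at h2
      rw [h2, h1]
    obtain ⟨y, hy⟩ := hmem
    exact ⟨y, y.2, fun v hv => LinearMap.congr_fun hy ⟨v, hv⟩⟩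
  choose y hy hyF using key
  refine ⟨y, mem_completion.2 hy, ?_⟩
  ext v
  obtain ⟨s, hs⟩ := exists_eq_sum_comp v
  rw [hs, map_sum, map_sum]
  exact Finset.sum_congr rfl fun d _ => by
    rw [completedForm_comp, hyF d _ (comp_mem_grade d v)]

end Verma
end AffineSl2
end

noncomputable section
namespace AffineSl2
namespace Verma

variable {ℓ : ℂ} {r r' : ℕ}

/-! ### Homomorphisms between Verma modules -/

theorem exists_hom_of_iso (e : maxProper ℓ r ≃ₗ⁅ℂ, Affine⁆ IrrQuot ℓ r') :
    ∃ α : Verma ℓ r' →ₗ[ℂ] Verma ℓ r, (∀ n x v, α ⁅loop n x, v⁆ = ⁅loop n x, α v⁆) ∧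
      LinearMap.range α = (maxProper ℓ r).toSubmodule := by
  let α : Verma ℓ r' →ₗ⁅ℂ, Affine⁆ Verma ℓ r :=
    (maxProper ℓ r).incl.comp ((e.symm : IrrQuot ℓ r' →ₗ⁅ℂ, Affine⁆ maxProper ℓ r).comp
      (LieSubmodule.Quotient.mk' (maxProper ℓ r')))
  refine ⟨α, fun n x v => α.map_lie _ _, le_antisymm ?_ fun w hw => ?_⟩
  · rintro _ ⟨v, rfl⟩
    exact (e.symm (LieSubmodule.Quotient.mk' (maxProper ℓ r') v)).2
  · obtain ⟨v, hv⟩ := LieSubmodule.Quotient.surjective_mk' (maxProper ℓ r') (e ⟨w, hw⟩)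
    refine ⟨v, ?_⟩
    change ((e.symm (LieSubmodule.Quotient.mk' (maxProper ℓ r') v) : maxProper ℓ r) :
      Verma ℓ r) = w
    rw [hv, LieModuleEquiv.symm_apply_apply]

/-- A homomorphism between Verma modules that is homogeneous of degree `d₀`, with range `J(r)` and
kernel `J(r')`. -/
structure IsGradedHom (α : Verma ℓ r' →ₗ[ℂ] Verma ℓ r) (d₀ : ℤ) : Prop where
  map_loop : ∀ n x v, α ⁅loop n x, v⁆ = ⁅loop n x, α v⁆
  comp_map : ∀ d v, comp ℓ r d (α v) = α (comp ℓ r' (d - d₀) v)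
  range_eq : LinearMap.range α = (maxProper ℓ r).toSubmodule
  ker_eq : LinearMap.ker α = (maxProper ℓ r').toSubmodule

/-- The given isomorphism need not respect degrees. A nonzero homogeneous component of its
restriction to M(r') still satisfies the defining relations, and irreducibility fixes the range and
kernel of its extension. -/
theorem exists_isGradedHom (hJ : LieModule.IsIrreducible ℂ Affine (maxProper ℓ r))
    (hJ' : LieModule.IsIrreducible ℂ Affine (maxProper ℓ r'))
    (e : maxProper ℓ r ≃ₗ⁅ℂ, Affine⁆ IrrQuot ℓ r') :
    ∃ (α : Verma ℓ r' →ₗ[ℂ] Verma ℓ r) (d₀ : ℤ), IsGradedHom α d₀ := by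
  obtain ⟨β, hβ, hβr⟩ := exists_hom_of_iso e
  have hβJ : ∀ v, β v ∈ maxProper ℓ r := fun v => by
    rw [← LieSubmodule.mem_toSubmodule, ← hβr]
    exact ⟨v, rfl⟩
  obtain ⟨u₀, d₀, hd₀⟩ : ∃ u d, comp ℓ r d (β (incl ℓ r' u)) ≠ 0 := by
    by_contra! h
    have h1 : LinearMap.ker β = ⊤ := eq_top_of_neg_stable
      (fun u => LinearMap.mem_ker.2 (ext_comp fun d => by rw [h, map_zero]))
      (fun n _ x v hv => by
        rw [LinearMap.mem_ker] at hv ⊢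
        rw [hβ, hv, lie_zero])
    refine maxProper_ne_bot hJ ?_
    rw [← LieSubmodule.toSubmodule_eq_bot, ← hβr, LinearMap.range_eq_bot, ← LinearMap.ker_eq_top, h1]
  obtain ⟨α, hα0, hα⟩ := exists_lift (act_isLevelRep (ℓ := ℓ) (r := r))
    (comp ℓ r d₀ ∘ₗ β ∘ₗ incl ℓ r') fun n x u => by
      change ⁅loop n x, comp ℓ r d₀ (β (incl ℓ r' u))⁆ = comp ℓ r d₀ (β (incl ℓ r' (posAct n x u)))
      have h1 := comp_loop (d₀ - n) n x (β (incl ℓ r' u))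
      rw [sub_add_cancel, ← hβ, loop_incl] at h1
      rw [← h1]
      rcases Nat.eq_zero_or_pos n with rfl | hn
      · simp
      · simp [posAct, show n ≠ 0 by omega]
  have hcomp : ∀ d v, comp ℓ r d (α v) = α (comp ℓ r' (d - d₀) v) := by
    intro d v
    let P : Submodule ℂ (Verma ℓ r') :=
      { carrier := {v | ∀ d, comp ℓ r d (α v) = α (comp ℓ r' (d - d₀) v)}
        add_mem' := fun hv hv' d => by rw [map_add, map_add, map_add, map_add, hv, hv']
        zero_mem' := fun d => by simp
        smul_mem' := fun c v hv d => by rw [map_smul, map_smul, map_smul, map_smul, hv] }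
    have hP : P = ⊤ := by
      refine eq_top_of_neg_stable (fun u d => ?_) (fun n hn x v hv d => ?_)
      · rw [hα0, comp_incl]
        change comp ℓ r d (comp ℓ r d₀ (β (incl ℓ r' u))) = _
        rw [comp_comp]
        by_cases h : d = d₀
        · rw [if_pos h, if_pos (by omega), hα0]; rfl
        · rw [if_neg h, if_neg (by omega), map_zero]
      · rw [hα, act_apply, comp_loop, hv, comp_loop, hα, act_apply]
        congr 3
        ring_nf
    exact (hP ▸ Submodule.mem_top : v ∈ P) d
  have hαJ : ∀ v, α v ∈ maxProper ℓ r := by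
    intro v
    have h1 : (maxProper ℓ r).toSubmodule.comap α = ⊤ := eq_top_of_neg_stable
      (fun u => by
        rw [Submodule.mem_comap, hα0]
        exact comp_mem_maxProper hJ (hβJ _) d₀)
      (fun n _ x v hv => by
        rw [Submodule.mem_comap] at hv ⊢
        rw [hα]
        exact LieSubmodule.lie_mem _ hv)
    exact (h1 ▸ Submodule.mem_top : v ∈ (maxProper ℓ r).toSubmodule.comap α)
  let R := ofLoopStable (LinearMap.range α) (by
    rintro n x _ ⟨v, rfl⟩
    exact ⟨⁅loop n x, v⁆, hα n x v⟩)
  let K := ofLoopStable (LinearMap.ker α) (fun n x v hv => by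
    rw [LinearMap.mem_ker] at hv ⊢
    rw [hα, hv, map_zero])
  have hR : R = maxProper ℓ r := by
    have hle : R ≤ maxProper ℓ r := by
      rintro _ ⟨v, rfl⟩
      exact hαJ v
    refine (eq_bot_or_eq_maxProper hJ (ne_top_of_le_ne_top (maxProper_ne_top hJ) hle)).resolve_left
      fun h => hd₀ ?_
    have h1 : α (incl ℓ r' u₀) ∈ R := ⟨_, rfl⟩
    rw [h, LieSubmodule.mem_bot, hα0] at h1
    exact h1
  -- Were `α` injective, the image of J(r') would be zero or J(r), making J(r') zero or everything.
  have hK : K = maxProper ℓ r' := by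
    refine (eq_bot_or_eq_maxProper hJ' fun h => ?_).resolve_left fun h => ?_
    · have h1 : incl ℓ r' u₀ ∈ K := h ▸ LieSubmodule.mem_top _
      have h2 : α (incl ℓ r' u₀) = 0 := h1
      rw [hα0] at h2
      exact hd₀ h2
    · have hinj : ∀ v, α v = 0 → v = 0 := fun v hv => by
        have h1 : v ∈ K := hv
        rwa [h, LieSubmodule.mem_bot] at h1
      let M := ofLoopStable ((maxProper ℓ r').toSubmodule.map α) (by
        rintro n x _ ⟨v, hv, rfl⟩
        exact ⟨⁅loop n x, v⁆, LieSubmodule.lie_mem _ hv, hα n x v⟩)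
      have hle : M ≤ maxProper ℓ r := by
        rintro _ ⟨v, -, rfl⟩
        exact hαJ v
      rcases eq_bot_or_eq_maxProper hJ (ne_top_of_le_ne_top (maxProper_ne_top hJ) hle) with h1 | h1
      · refine maxProper_ne_bot hJ' ((LieSubmodule.eq_bot_iff _).2 fun v hv => hinj v ?_)
        have h2 : α v ∈ M := ⟨v, hv, rfl⟩
        rwa [h1, LieSubmodule.mem_bot] at h2
      · refine maxProper_ne_top hJ' (eq_top_iff.2 fun v _ => ?_)
        have h2 : α v ∈ M := h1 ▸ hαJ v
        obtain ⟨w, hw, hwv⟩ := h2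
        have h3 := hinj (v - w) (by rw [map_sub, hwv, sub_self])
        rw [sub_eq_zero.1 h3]
        exact hw
  exact ⟨α, d₀, hα, hcomp, congrArg LieSubmodule.toSubmodule hR,
    congrArg LieSubmodule.toSubmodule hK⟩

/-! ### The `sl(2, ℂ)`-module structure of the homogeneous components -/

instance (d : ℤ) : LieRingModule Sl2 (grade ℓ r d) where
  bracket x v := ⟨⁅loop 0 x, (v : Verma ℓ r)⁆, by simpa using loop_mem_grade 0 x v.2⟩
  add_lie x y v := Subtype.ext (by simp [loop_add])
  lie_add x v w := Subtype.ext (lie_add _ _ _)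
  leibniz_lie x y v := Subtype.ext (by
    change ⁅loop 0 x, ⁅loop 0 y, (v : Verma ℓ r)⁆⁆ =
      ⁅loop 0 ⁅x, y⁆, (v : Verma ℓ r)⁆ + ⁅loop 0 y, ⁅loop 0 x, (v : Verma ℓ r)⁆⁆
    rw [leibniz_lie, lie_loop_loop]
    simp)

@[simp] theorem coe_lie_grade (d : ℤ) (x : Sl2) (v : grade ℓ r d) :
    (↑⁅x, v⁆ : Verma ℓ r) = ⁅loop 0 x, (v : Verma ℓ r)⁆ := rfl

instance (d : ℤ) : LieModule ℂ Sl2 (grade ℓ r d) where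
  smul_lie c x v := Subtype.ext (by simp [loop_smul])
  lie_smul c x v := Subtype.ext (lie_smul _ _ _)

/-- Supplies the diagonalizability required by `exists_retraction`: h, e and f are themselves weight
vectors, so negative modes preserve sums of weight spaces. -/
theorem iSup_weights_eq_top (ℓ : ℂ) (r : ℕ) : ⨆ c, (act ℓ r 0 sH).eigenspace c = ⊤ := by
  have hE : ∀ c v, v ∈ (act ℓ r 0 sH).eigenspace c ↔ ⁅loop 0 sH, v⁆ = c • v := fun c v =>
    Module.End.mem_eigenspace_iff
  refine eq_top_of_neg_stable (fun u => ?_) (fun n hn x v hv => ?_)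
  · have h1 : (⨆ c, (act ℓ r 0 sH).eigenspace c).comap (incl ℓ r) = ⊤ := by
      rw [eq_top_iff, ← Irr.span_vec, Submodule.span_le]
      rintro _ ⟨i, rfl⟩
      refine Submodule.mem_iSup_of_mem ((r : ℂ) - 2 * (i : ℕ)) ((hE _ _).2 ?_)
      rw [loop_zero_incl, Irr.sH_vec, map_smul]
    exact (h1 ▸ Submodule.mem_top : u ∈ (⨆ c, (act ℓ r 0 sH).eigenspace c).comap (incl ℓ r))
  · have key : ∀ (y : Sl2) (k : ℂ), ⁅sH, y⁆ = k • y →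
        ⁅loop (-(n : ℤ)) y, v⁆ ∈ ⨆ c, (act ℓ r 0 sH).eigenspace c := by
      intro y k hy
      induction hv using Submodule.iSup_induction' with
      | zero => rw [lie_zero]; exact Submodule.zero_mem _
      | add v w _ _ hv hw => rw [lie_add]; exact Submodule.add_mem _ hv hw
      | mem c v hv =>
        refine Submodule.mem_iSup_of_mem (k + c) ((hE _ _).2 ?_)
        rw [leibniz_lie, (hE _ _).1 hv, lie_loop_loop, if_neg (by omega), hy, zero_add, zero_smul,
          add_zero, loop_smul, smul_lie, lie_smul, add_smul]
    rw [sl2_eq x, loop_add, loop_add, loop_smul, loop_smul, loop_smul, add_lie, add_lie, smul_lie,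
      smul_lie, smul_lie]
    refine Submodule.add_mem _ (Submodule.add_mem _ ?_ ?_) ?_
    · exact Submodule.smul_mem _ _ (key sH 0 (by simp))
    · exact Submodule.smul_mem _ _ (key sE 2 lie_sH_sE)
    · exact Submodule.smul_mem _ _ (key sF (-2) lie_sH_sF)

theorem iSup_weights_grade_eq_top (d : ℤ) :
    ⨆ c, (LieModule.toEnd ℂ Sl2 (grade ℓ r d) sH).eigenspace c = ⊤ := by
  have key : ∀ v ∈ ⨆ c, (act ℓ r 0 sH).eigenspace c,
      (⟨comp ℓ r d v, comp_mem_grade d v⟩ : grade ℓ r d) ∈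
        ⨆ c, (LieModule.toEnd ℂ Sl2 (grade ℓ r d) sH).eigenspace c := by
    intro v hv
    induction hv using Submodule.iSup_induction' with
    | zero =>
      convert Submodule.zero_mem _
      exact map_zero _
    | add v w _ _ hv hw =>
      convert Submodule.add_mem _ hv hw
      exact map_add _ _ _
    | mem c v hv =>
      refine Submodule.mem_iSup_of_mem c (Module.End.mem_eigenspace_iff.2 (Subtype.ext ?_))
      have h1 : ⁅loop 0 sH, v⁆ = c • v := Module.End.mem_eigenspace_iff.1 hv
      have h2 := comp_loop d 0 sH v
      rw [add_zero, h1, map_smul] at h2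
      exact h2.symm
  refine eq_top_iff.2 fun v _ => ?_
  have h := key v (iSup_weights_eq_top ℓ r ▸ Submodule.mem_top)
  convert h
  exact (mem_grade_iff.1 v.2).symm

/-! ### Transport along a homogeneous homomorphism. -/

namespace IsGradedHom

variable {α : Verma ℓ r' →ₗ[ℂ] Verma ℓ r} {d₀ : ℤ} (hα : IsGradedHom α d₀)
include hα

theorem map_mem_grade {d : ℤ} {v : Verma ℓ r'} (hv : v ∈ grade ℓ r' (d - d₀)) :
    α v ∈ grade ℓ r d := by
  rw [mem_grade_iff, hα.comp_map, mem_grade_iff.1 hv]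

theorem map_mem (v : Verma ℓ r') : α v ∈ maxProper ℓ r := by
  rw [← LieSubmodule.mem_toSubmodule, ← hα.range_eq]
  exact ⟨v, rfl⟩

theorem map_eq_zero_iff (v : Verma ℓ r') : α v = 0 ↔ v ∈ maxProper ℓ r' := by
  rw [← LieSubmodule.mem_toSubmodule, ← hα.ker_eq, LinearMap.mem_ker]

/-- Families of vectors in the maximal proper submodule come from the source. -/
theorem exists_preimage {y : ℤ → Verma ℓ r} (hy : y ∈ completion ℓ r)
    (hyJ : ∀ d, y d ∈ maxProper ℓ r) :
    ∃ z ∈ completion ℓ r', ∀ d, y d = α (z (d - d₀)) := by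
  have h : ∀ d, ∃ v, α v = y d := fun d => by
    have := hyJ d
    rw [← LieSubmodule.mem_toSubmodule, ← hα.range_eq] at this
    exact this
  choose v hv using h
  refine ⟨fun d => comp ℓ r' d (v (d + d₀)), mem_completion.2 fun d => comp_mem_grade _ _,
    fun d => ?_⟩
  change y d = α (comp ℓ r' (d - d₀) (v (d - d₀ + d₀)))
  rw [sub_add_cancel, ← hα.comp_map, hv, mem_grade_iff.1 (mem_completion.1 hy d)]

/-- The contravariant form of the source extends to the completion of the target. -/
theorem exists_extension (hJ' : LieModule.IsIrreducible ℂ Affine (maxProper ℓ r')) :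
    ∃ Ψ : (ℤ → Verma ℓ r) →ₗ[ℂ] Module.Dual ℂ (Verma ℓ r'), IsDualHom (famActNat ℓ r) Ψ ∧
      ∀ z : ℤ → Verma ℓ r', Ψ (fun d => α (z (d - d₀))) = completedForm ℓ r' z := by
  have hmem : ∀ u, α (incl ℓ r' u) ∈ grade ℓ r d₀ := fun u =>
    hα.map_mem_grade (by rw [sub_self]; exact incl_mem_grade u)
  let j : Irr r' →ₗ⁅ℂ, Sl2⁆ grade ℓ r d₀ :=
    { (α ∘ₗ incl ℓ r').codRestrict (grade ℓ r d₀) hmem with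
      map_lie' := fun {x u} => Subtype.ext (by
        change α (incl ℓ r' ⁅x, u⁆) = ⁅loop 0 x, α (incl ℓ r' u)⁆
        rw [← hα.map_loop, loop_zero_incl]) }
  have hj : Function.Injective j := by
    refine (injective_iff_map_eq_zero j).2 fun u hu => ?_
    have h1 : α (incl ℓ r' u) = 0 := congrArg Subtype.val hu
    exact eq_zero_of_incl_mem_maxProper hJ' ((hα.map_eq_zero_iff _).1 h1)
  -- The retraction of V(r)(d₀) onto M(r') prescribes `Ψ` on the lowest component; coinduction
  -- supplies the rest.
  obtain ⟨ρ, hρ⟩ := exists_retraction (iSup_weights_grade_eq_top d₀) j hj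
  let π : (ℤ → Verma ℓ r) →ₗ[ℂ] grade ℓ r d₀ :=
    (comp ℓ r d₀ ∘ₗ LinearMap.proj d₀).codRestrict _ fun y => comp_mem_grade _ _
  have hπ : ∀ x y, π (famActNat ℓ r 0 x y) = ⁅x, π y⁆ := fun x y => Subtype.ext (by
    change comp ℓ r d₀ ⁅loop 0 x, y (d₀ + 0)⁆ = ⁅loop 0 x, comp ℓ r d₀ (y d₀)⁆
    rw [comp_loop, add_zero])
  obtain ⟨Ψ, hΨ0, hΨ⟩ := exists_isDualHom (ℓ := ℓ) famActNat_isCurrentRep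
    ((dualIso r').toLinearMap ∘ₗ (ρ : grade ℓ r d₀ →ₗ[ℂ] Irr r') ∘ₗ π) fun x y u => by
      change dualIso r' (ρ (π (famActNat ℓ r 0 x y))) u = -dualIso r' (ρ (π y)) ⁅x, u⁆
      rw [hπ, LieModuleHom.map_lie, dualIso_lie]
  refine ⟨Ψ, hΨ, fun z => ?_⟩
  let A : (ℤ → Verma ℓ r') →ₗ[ℂ] (ℤ → Verma ℓ r) :=
    { toFun := fun z d => α (z (d - d₀))
      map_add' := fun z z' => by ext d; simp
      map_smul' := fun c z => by ext d; simp }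
  have hA : IsDualHom (famActNat ℓ r') (Ψ ∘ₗ A) := fun n x z v => by
    have h1 : A (famActNat ℓ r' n x z) = famActNat ℓ r n x (A z) := by
      ext d
      change α ⁅loop n x, z (d - d₀ + n)⁆ = ⁅loop n x, α (z (d + n - d₀))⁆
      rw [hα.map_loop]
      congr 3
      ring
    rw [LinearMap.comp_apply, h1, hΨ]
    rfl
  -- Both maps are equivariant into a coinduced module, so only their values on M(r') need
  -- comparing.
  have h2 : Ψ ∘ₗ A = completedForm ℓ r' := by
    refine hA.ext completedForm_isDualHom fun z u => ?_
    rw [LinearMap.comp_apply, hΨ0, completedForm_incl]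
    change dualIso r' (ρ (π (A z))) u = _
    have h3 : π (A z) = j (top ℓ r' (z 0)) := Subtype.ext (by
      change comp ℓ r d₀ (α (z (d₀ - d₀))) = α (incl ℓ r' (top ℓ r' (z 0)))
      rw [hα.comp_map, sub_self, incl_top])
    rw [h3, hρ]
  exact LinearMap.congr_fun h2 z

end IsGradedHom

end Verma
end AffineSl2
end

noncomputable section
namespace AffineSl2

/-! ### The evaluation module `M(p) ⊗ M(q)` -/

/-- The action on `M(p) ⊗ M(q)` of the current algebra: it acts on `M(p)` through evaluation at
`t = 1` and on `M(q)` through evaluation at `t = 0`. -/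
def evalAct (p q n : ℕ) : Sl2 →ₗ[ℂ] Module.End ℂ (Irr p ⊗[ℂ] Irr q) :=
  if n = 0 then (LieModule.toEnd ℂ Sl2 (Irr p ⊗[ℂ] Irr q) : Sl2 →ₗ[ℂ] _)
  else LinearMap.rTensorHom (Irr q) ∘ₗ (LieModule.toEnd ℂ Sl2 (Irr p) : Sl2 →ₗ[ℂ] _)

theorem evalAct_zero {p q : ℕ} (x : Sl2) (w : Irr p ⊗[ℂ] Irr q) : evalAct p q 0 x w = ⁅x, w⁆ := rfl

theorem evalAct_tmul {p q : ℕ} (n : ℕ) (x : Sl2) (u : Irr p) (v : Irr q) :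
    evalAct p q n x (u ⊗ₜ v) = ⁅x, u⁆ ⊗ₜ v + u ⊗ₜ posAct n x v := by
  rcases Nat.eq_zero_or_pos n with rfl | hn
  · rw [evalAct_zero, TensorProduct.LieModule.lie_tmul_right, posAct, if_pos rfl]
  · rw [evalAct, if_neg hn.ne', posAct, if_neg hn.ne', TensorProduct.tmul_zero, add_zero]
    rfl

theorem posAct_bracket {q : ℕ} (m n : ℕ) (x y : Sl2) (v : Irr q) :
    posAct m x (posAct n y v) - posAct n y (posAct m x v) = posAct (m + n) ⁅x, y⁆ v := by
  rcases Nat.eq_zero_or_pos m with rfl | hm <;> rcases Nat.eq_zero_or_pos n with rfl | hn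
  · simp [posAct]
  · simp [posAct, hn.ne']
  · simp [posAct, hm.ne']
  · simp [posAct, hm.ne', hn.ne']

theorem evalAct_isCurrentRep (p q : ℕ) : IsCurrentRep (evalAct p q) := fun m n x y w => by
  induction w using TensorProduct.induction_on with
  | zero => simp
  | add w w' h h' =>
    simp only [map_add]
    rw [← h, ← h']
    abel
  | tmul u v =>
    simp only [evalAct_tmul, map_add]
    rw [← posAct_bracket, lie_lie, TensorProduct.sub_tmul, TensorProduct.tmul_sub]
    abel

namespace Verma

variable {ℓ : ℂ} {r r' r'' : ℕ}

/-! ### Equivariant lifts through the contravariant form. -/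

section Maps

variable {X X' : Type*} [AddCommGroup X] [Module ℂ X] [AddCommGroup X'] [Module ℂ X']

theorem IsDualHom.comp_hom {A : ℕ → Sl2 →ₗ[ℂ] Module.End ℂ X}
    {S : X →ₗ[ℂ] Module.Dual ℂ (Verma ℓ r)} (hS : IsDualHom A S)
    {α : Verma ℓ r' →ₗ[ℂ] Verma ℓ r} (hα : ∀ n x v, α ⁅loop n x, v⁆ = ⁅loop n x, α v⁆) :
    IsDualHom A (LinearMap.lcomp ℂ ℂ α ∘ₗ S) := fun n x w v => by
  change S (A n x w) (α v) = -S w (α ⁅loop (-(n : ℤ)) x, v⁆)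
  rw [hS, hα]

theorem IsDualHom.comp_equivariant {A : ℕ → Sl2 →ₗ[ℂ] Module.End ℂ X}
    {A' : ℕ → Sl2 →ₗ[ℂ] Module.End ℂ X'} {S : X →ₗ[ℂ] Module.Dual ℂ (Verma ℓ r)}
    (hS : IsDualHom A S) {g : X' →ₗ[ℂ] X} (hg : ∀ n x w, g (A' n x w) = A n x (g w)) :
    IsDualHom A' (S ∘ₗ g) := fun n x w v => by
  rw [LinearMap.comp_apply, LinearMap.comp_apply, hg, hS]

/-- Maps to the dual of a Verma module whose maximal proper submodule is an irreducible quotient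
of a Verma module with the same property lift uniquely to the completion, if there are no nonzero
maps to the duals of these other Verma modules. -/
theorem exists_unique_equivariant_lift
    (hJ : LieModule.IsIrreducible ℂ Affine (maxProper ℓ r))
    (hJ' : LieModule.IsIrreducible ℂ Affine (maxProper ℓ r'))
    (e : maxProper ℓ r ≃ₗ⁅ℂ, Affine⁆ IrrQuot ℓ r')
    (e' : maxProper ℓ r' ≃ₗ⁅ℂ, Affine⁆ IrrQuot ℓ r'')
    {A : ℕ → Sl2 →ₗ[ℂ] Module.End ℂ X}
    (hA' : ∀ G : X →ₗ[ℂ] Module.Dual ℂ (Verma ℓ r'), IsDualHom A G → G = 0)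
    (hA'' : ∀ G : X →ₗ[ℂ] Module.Dual ℂ (Verma ℓ r''), IsDualHom A G → G = 0)
    {F : X →ₗ[ℂ] Module.Dual ℂ (Verma ℓ r)} (hF : IsDualHom A F) :
    ∃! y : X →ₗ[ℂ] (ℤ → Verma ℓ r), (∀ w, y w ∈ completion ℓ r) ∧
      (∀ n x w, y (A n x w) = famActNat ℓ r n x (y w)) ∧ completedForm ℓ r ∘ₗ y = F := by
  obtain ⟨α, d₀, hα⟩ := exists_isGradedHom hJ hJ' e
  obtain ⟨Ψ, hΨ, hΨα⟩ := hα.exists_extension hJ'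
  obtain ⟨β, hβ, hβr⟩ := exists_hom_of_iso e'
  have hFJ : ∀ w, ∀ v ∈ maxProper ℓ r, F w v = 0 := fun w v hv => by
    rw [← LieSubmodule.mem_toSubmodule, ← hα.range_eq] at hv
    obtain ⟨v, rfl⟩ := hv
    exact LinearMap.congr_fun (LinearMap.congr_fun (hA' _ (hF.comp_hom hα.map_loop)) w) v
  -- The first condition writes y as the image of a family z; the second, where `Ψ` is the form of
  -- V(r'), puts z in J(r'), the kernel of `α`.
  have hinj : ∀ y ∈ completion ℓ r, completedForm ℓ r y = 0 → Ψ y = 0 → y = 0 := by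
    intro y hy h1 h2
    obtain ⟨z, hz, hyz⟩ := hα.exists_preimage hy (mem_maxProper_of_completedForm_eq_zero hy h1)
    obtain rfl : y = fun d => α (z (d - d₀)) := funext hyz
    rw [hΨα] at h2
    funext d
    exact (hα.map_eq_zero_iff _).2 (mem_maxProper_of_completedForm_eq_zero hz h2 _)
  have hinj' : ∀ y ∈ completion ℓ r, ∀ y' ∈ completion ℓ r,
      completedForm ℓ r y = completedForm ℓ r y' → Ψ y = Ψ y' → y = y' :=
    fun y hy y' hy' h1 h2 => sub_eq_zero.1 (hinj _ (Submodule.sub_mem _ hy hy')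
      (by rw [map_sub, h1, sub_self]) (by rw [map_sub, h2, sub_self]))
  -- A merely linear lift of `F`; equivariance is recovered after correction.
  obtain ⟨s, hs, hsF⟩ : ∃ s : X →ₗ[ℂ] (ℤ → Verma ℓ r),
      (∀ w, s w ∈ completion ℓ r) ∧ ∀ w, completedForm ℓ r (s w) = F w := by
    let T := completedForm ℓ r ∘ₗ (completion ℓ r).subtype
    obtain ⟨s, hs⟩ := Module.projective_lifting_property T.rangeRestrict
      (F.codRestrict (LinearMap.range T) fun w => by
        obtain ⟨y, hy, hyF⟩ := exists_completedForm_eq (hFJ w)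
        exact ⟨⟨y, hy⟩, hyF⟩) T.surjective_rangeRestrict
    exact ⟨(completion ℓ r).subtype ∘ₗ s, fun w => (s w).2, fun w =>
      congrArg Subtype.val (LinearMap.congr_fun hs w)⟩
  have hΨJ : ∀ y ∈ completion ℓ r, completedForm ℓ r y = 0 → ∀ v ∈ maxProper ℓ r', Ψ y v = 0 := by
    intro y hy h v hv
    obtain ⟨z, hz, hyz⟩ := hα.exists_preimage hy (mem_maxProper_of_completedForm_eq_zero hy h)
    obtain rfl : y = fun d => α (z (d - d₀)) := funext hyz
    rw [hΨα]
    exact completedForm_apply_eq_zero hJ' z hv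
  have hβJ : ∀ v, β v ∈ maxProper ℓ r' := fun v => by
    rw [← LieSubmodule.mem_toSubmodule, ← hβr]
    exact ⟨v, rfl⟩
  -- The equivariance defect of `s` lies in the kernel of the form, where `Ψ` takes values vanishing
  -- on J(r'). Pulling back along `β` therefore removes it.
  have hΘ : IsDualHom A (LinearMap.lcomp ℂ ℂ β ∘ₗ Ψ ∘ₗ s) := fun n x w v => by
    change Ψ (s (A n x w)) (β v) = -Ψ (s w) (β ⁅loop (-(n : ℤ)) x, v⁆)
    rw [hβ, ← hΨ, ← sub_eq_zero, ← LinearMap.sub_apply, ← map_sub]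
    refine hΨJ _ (Submodule.sub_mem _ (hs _) (famActNat_mem_completion n x (hs w))) ?_ _ (hβJ v)
    rw [map_sub, sub_eq_zero, hsF]
    ext v
    rw [hF, completedForm_isDualHom, hsF]
  have hΨs : ∀ w, ∀ v ∈ maxProper ℓ r', Ψ (s w) v = 0 := fun w v hv => by
    rw [← LieSubmodule.mem_toSubmodule, ← hβr] at hv
    obtain ⟨v, rfl⟩ := hv
    exact LinearMap.congr_fun (LinearMap.congr_fun (hA'' _ hΘ) w) v
  -- Since `Ψ (s w)` annihilates J(r'), it is the form of V(r') at some z; subtracting the image of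
  -- z cancels it without changing `F w`.
  have hex : ∀ w, ∃ y ∈ completion ℓ r, completedForm ℓ r y = F w ∧ Ψ y = 0 := fun w => by
    obtain ⟨z, hz, hzF⟩ := exists_completedForm_eq (hΨs w)
    refine ⟨s w - fun d => α (z (d - d₀)), Submodule.sub_mem _ (hs w)
      (mem_completion.2 fun d => hα.map_mem_grade (mem_completion.1 hz _)), ?_, ?_⟩
    · rw [map_sub, hsF, completedForm_eq_zero_of_forall_mem hJ fun d => hα.map_mem _, sub_zero]
    · rw [map_sub, hΨα, hzF, sub_self]
  choose y hy hyF hyΨ using hex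
  -- Linearity, equivariance and uniqueness all follow by comparing values under the form and `Ψ`.
  -- For a competing lift, its composite with `Ψ` is an equivariant map to V(r')*, hence zero.
  refine ⟨{ toFun := y, map_add' := fun w w' => ?_, map_smul' := fun c w => ?_ },
    ⟨hy, fun n x w => ?_, LinearMap.ext hyF⟩, fun y' h => LinearMap.ext fun w => ?_⟩
  · refine hinj' _ (hy _) _ (Submodule.add_mem _ (hy _) (hy _)) ?_ ?_
    · rw [map_add, hyF, hyF, hyF, map_add]
    · rw [map_add, hyΨ, hyΨ, hyΨ, add_zero]
  · refine hinj' _ (hy _) _ (Submodule.smul_mem _ _ (hy _)) ?_ ?_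
    · rw [map_smul, hyF, hyF, map_smul, RingHom.id_apply]
    · rw [map_smul, hyΨ, hyΨ, smul_zero]
  · refine hinj' _ (hy _) _ (famActNat_mem_completion n x (hy w)) ?_ ?_
    · ext v
      rw [hyF, hF, completedForm_isDualHom]
      change _ = -completedForm ℓ r (y w) _
      rw [hyF]
    · ext v
      rw [hyΨ, hΨ]
      change _ = -Ψ (y w) _
      rw [hyΨ, LinearMap.zero_apply, LinearMap.zero_apply, neg_zero]
  · exact hinj' _ (h.1 w) _ (hy w) ((LinearMap.congr_fun h.2.2 w).trans (hyF w).symm)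
      ((LinearMap.congr_fun (hA' _ (hΨ.comp_equivariant h.2.1)) w).trans (hyΨ w).symm)

end Maps

/-! ### From equivariant maps to the families Y. -/

variable {p q : ℕ}

/-- Restricting to M(s) gives an sl(2)-map to M(s)* ≅ M(s), which vanishes; coinduction then kills
the whole map. -/
theorem eq_zero_of_isDualHom_evalAct {s : ℕ} (hs : ∀ φ : Irr p ⊗[ℂ] Irr q →ₗ⁅ℂ, Sl2⁆ Irr s, φ = 0)
    {G : Irr p ⊗[ℂ] Irr q →ₗ[ℂ] Module.Dual ℂ (Verma ℓ s)} (hG : IsDualHom (evalAct p q) G) :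
    G = 0 := by
  let φ : Irr p ⊗[ℂ] Irr q →ₗ⁅ℂ, Sl2⁆ Irr s :=
    { (dualIso s).symm.toLinearMap ∘ₗ LinearMap.lcomp ℂ ℂ (incl ℓ s) ∘ₗ G with
      map_lie' := fun {x w} => by
        refine (dualIso s).injective ?_
        ext u
        change dualIso s ((dualIso s).symm (G ⁅x, w⁆ ∘ₗ incl ℓ s)) u =
          dualIso s ⁅x, (dualIso s).symm (G w ∘ₗ incl ℓ s)⁆ u
        rw [dualIso_lie, LinearEquiv.apply_symm_apply, LinearEquiv.apply_symm_apply,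
          ← evalAct_zero, LinearMap.comp_apply, hG, LinearMap.comp_apply, ← loop_zero_incl,
          Nat.cast_zero, neg_zero] }
  refine hG.eq_zero fun w u => ?_
  have h : (dualIso s).symm (G w ∘ₗ incl ℓ s) = 0 := LieModuleHom.congr_fun (hs φ) w
  rw [LinearEquiv.map_eq_zero_iff] at h
  exact LinearMap.congr_fun h u

/-- The map to the dual of a Verma module which is determined by a homomorphism to its lowest
degree component. -/
theorem exists_isDualHom_evalAct (ℓ : ℂ) (f : Irr p ⊗[ℂ] Irr q →ₗ⁅ℂ, Sl2⁆ Irr r) :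
    ∃ F : Irr p ⊗[ℂ] Irr q →ₗ[ℂ] Module.Dual ℂ (Verma ℓ r),
      (∀ w u, F w (incl ℓ r u) = dualIso r (f w) u) ∧ IsDualHom (evalAct p q) F :=
  exists_isDualHom (evalAct_isCurrentRep p q)
    ((dualIso r).toLinearMap ∘ₗ (f : Irr p ⊗[ℂ] Irr q →ₗ[ℂ] Irr r)) fun x w u => by
      change dualIso r (f (evalAct p q 0 x w)) u = -dualIso r (f w) ⁅x, u⁆
      rw [evalAct_zero, LieModuleHom.map_lie, dualIso_lie]

theorem eq_incl_iff {y : ℤ → Verma ℓ r} (hy : y ∈ completion ℓ r) (u : Irr r) :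
    y 0 = incl ℓ r u ↔ top ℓ r (y 0) = u := by
  rw [← (incl_injective ℓ r).eq_iff, incl_top, mem_grade_iff.1 (mem_completion.1 hy 0)]

/-- Evaluation at t = 1 makes every x ⊗ tⁿ act on M(p) as x, which is the right side of the
commutator formula; degree d corresponds to index m = -d. -/
theorem equivariant_iff {y : Irr p ⊗[ℂ] Irr q →ₗ[ℂ] (ℤ → Verma ℓ r)} :
    (∀ n x w, y (evalAct p q n x w) = famActNat ℓ r n x (y w)) ↔
      ∀ (x : Sl2) (n : ℕ) (m : ℤ) (u : Irr p) (v : Irr q),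
        ⁅loop n x, y (u ⊗ₜ v) (-m)⁆ - y (u ⊗ₜ posAct n x v) (-m) =
          y (⁅x, u⁆ ⊗ₜ v) (-(m + n)) := by
  -- The index shift is harmless in the term with M(q): either n = 0, or x(n) kills M(q).
  have h0 : ∀ (x : Sl2) (n : ℕ) (m : ℤ) (u : Irr p) (v : Irr q),
      y (u ⊗ₜ posAct n x v) (-(m + n)) = y (u ⊗ₜ posAct n x v) (-m) := fun x n m u v => by
    rcases Nat.eq_zero_or_pos n with rfl | hn
    · rw [Nat.cast_zero, add_zero]
    · simp [posAct, hn.ne']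
  have h1 : ∀ (x : Sl2) (n : ℕ) (u : Irr p) (v : Irr q),
      y (evalAct p q n x (u ⊗ₜ v)) = famActNat ℓ r n x (y (u ⊗ₜ v)) ↔ ∀ m : ℤ,
        ⁅loop n x, y (u ⊗ₜ v) (-m)⁆ - y (u ⊗ₜ posAct n x v) (-m) =
          y (⁅x, u⁆ ⊗ₜ v) (-(m + n)) := fun x n u v => by
    have h2 : ∀ m : ℤ, (⁅loop n x, y (u ⊗ₜ v) (-m)⁆ - y (u ⊗ₜ posAct n x v) (-m) =
          y (⁅x, u⁆ ⊗ₜ v) (-(m + n))) ↔ y (evalAct p q n x (u ⊗ₜ v)) (-(m + n)) =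
        famActNat ℓ r n x (y (u ⊗ₜ v)) (-(m + n)) := fun m => by
      rw [evalAct_tmul, map_add, Pi.add_apply, h0, famActNat_apply, sub_eq_iff_eq_add, eq_comm,
        show -(m + n) + (n : ℤ) = -m by ring]
    simp only [h2]
    refine ⟨fun h m => by rw [h], fun h => funext fun d => ?_⟩
    have := h (-d - n)
    rwa [show -(-d - n + (n : ℤ)) = d by ring] at this
  refine ⟨fun h x n m u v => (h1 x n u v).1 (h n x _) m, fun h n x w => ?_⟩
  induction w using TensorProduct.induction_on with
  | zero => simp
  | add w w' hw hw' => simp only [map_add, hw, hw']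
  | tmul u v => exact (h1 x n u v).2 fun m => h x n m u v

end Verma
end AffineSl2
end

open AffineSl2 in
theorem theorem6p3 (ℓ p q r r' r'' : ℕ)
    (hJr : LieModule.IsIrreducible ℂ Affine (Verma.maxProper (ℓ : ℂ) r))
    (hJrL : Nonempty (Verma.maxProper (ℓ : ℂ) r ≃ₗ⁅ℂ, Affine⁆ Verma.IrrQuot (ℓ : ℂ) r'))
    (hJr' : LieModule.IsIrreducible ℂ Affine (Verma.maxProper (ℓ : ℂ) r'))
    (hJr'L : Nonempty (Verma.maxProper (ℓ : ℂ) r' ≃ₗ⁅ℂ, Affine⁆ Verma.IrrQuot (ℓ : ℂ) r''))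
    (hr' : ∀ φ : Irr p ⊗[ℂ] Irr q →ₗ⁅ℂ, Sl2⁆ Irr r', φ = 0)
    (hr'' : ∀ φ : Irr p ⊗[ℂ] Irr q →ₗ⁅ℂ, Sl2⁆ Irr r'', φ = 0)
    (f : Irr p ⊗[ℂ] Irr q →ₗ⁅ℂ, Sl2⁆ Irr r) :
    ∃! Y : ℤ → (Irr p ⊗[ℂ] Irr q →ₗ[ℂ] Verma (ℓ : ℂ) r),
      (∀ (m : ℤ) (w : Irr p ⊗[ℂ] Irr q), Y m w ∈ Verma.grade (ℓ : ℂ) r (-m)) ∧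
      (∀ w : Irr p ⊗[ℂ] Irr q, Y 0 w = Verma.incl (ℓ : ℂ) r (f w)) ∧
      ∀ (x : Sl2) (n : ℕ) (m : ℤ) (u : Irr p) (v : Irr q),
        ⁅loop n x, Y m (u ⊗ₜ[ℂ] v)⁆ - Y m (u ⊗ₜ[ℂ] posAct n x v) =
          Y (m + n) (⁅x, u⁆ ⊗ₜ[ℂ] v) := by
  obtain ⟨F, hF0, hF⟩ := Verma.exists_isDualHom_evalAct (ℓ : ℂ) f
  obtain ⟨y, ⟨hy, hyA, hyF⟩, huniq⟩ := Verma.exists_unique_equivariant_lift hJr hJr' hJrL.some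
    hJr'L.some (fun G => Verma.eq_zero_of_isDualHom_evalAct hr')
    (fun G => Verma.eq_zero_of_isDualHom_evalAct hr'') hF
  refine ⟨fun m => LinearMap.proj (-m) ∘ₗ y, ⟨fun m w => Verma.mem_completion.1 (hy w) _,
    fun w => ?_, Verma.equivariant_iff.1 hyA⟩, fun Y ⟨hY, hY0, hYA⟩ => ?_⟩
  · refine (Verma.eq_incl_iff (hy w) _).2 ((Verma.dualIso r).injective (LinearMap.ext fun u => ?_))
    rw [← Verma.completedForm_incl, ← hF0, ← hyF]
    rfl
  · let y' : Irr p ⊗[ℂ] Irr q →ₗ[ℂ] (ℤ → Verma (ℓ : ℂ) r) := LinearMap.pi fun d => Y (-d)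
    have hy'Y : ∀ w m, y' w (-m) = Y m w := fun w m => by
      change Y (- -m) w = _
      rw [neg_neg]
    have hy' : ∀ w, y' w ∈ Verma.completion (ℓ : ℂ) r := fun w => Verma.mem_completion.2 fun d => by
      have := hY (-d) w
      rwa [neg_neg] at this
    have hy'A := (Verma.equivariant_iff (y := y')).2 fun x n m u v => by
      rw [hy'Y, hy'Y, hy'Y, hYA]
    -- By coinduction it suffices to compare on M(r), where only Y₀, that is f, enters.
    have hy'F : Verma.completedForm (ℓ : ℂ) r ∘ₗ y' = F := by
      refine (Verma.completedForm_isDualHom.comp_equivariant hy'A).ext hF fun w u => ?_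
      rw [LinearMap.comp_apply, Verma.completedForm_incl, hF0,
        (Verma.eq_incl_iff (hy' w) (f w)).1 (by rw [← hY0, ← hy'Y, neg_zero])]
    refine funext fun m => LinearMap.ext fun w => ?_
    rw [← hy'Y, huniq y' ⟨hy', hy'A, hy'F⟩]
    rfl
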